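/- **Notation.** Let $q$ be a prime power. For a monic polynomial $P$ with $P(0)\neq 0$ over $\mathbb F_q$ put $P^*(x)=P(0)^{-1}x^{\deg P}P(1/x)$; over $\mathbb F_{q^2}$ put $P^*(x)=\bar P(0)^{-1}x^{\deg P}\bar P(1/x)$, where $\bar P$ is obtained from $P$ by raising the coefficients to the $q$-th power. Let - $\mathcal L_n(q)$ be the set of monic $P\in\mathbb F_q[x]$ of degree $n$ with $P(0)=(-1)^n$; - $\mathcal U_n(q)$ be the set of monic $P\in\mathbb F_{q^2}[x]$ of degree $n$ with $P=P^*$ and $P(0)=(-1)^n$; - $\mathcal O_n(q)$ ($n$ even) be the set of monic $P\in\mathbb F_q[x]$ of degree $n$ with $P=P^*$ and $P(0)=1$. Let $G$ be a classical finite simple group of rank $r\ge 1$ over $\mathbb F_q$, that is, $G=\tilde G/Z(\tilde G)$ is simple, where $\tilde G$ is the group of $\mathbb F_q$-points of the simply connected group of the given type (apart from finitely many $G$, this is the universal central extension of $G$). Let the set of polynomials $\mathcal P$ and the map $f$ from conjugacy classes of $\tilde G$ to polynomials be as follows. - Type $A_r$: $\tilde G=\mathrm{SL}_{r+1}(\mathbb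 F_q)$, $\mathcal P=\mathcal L_{r+1}(q)$, and $f$ is the characteristic polynomial. - Type ${}^2A_r$: $\tilde G=\mathrm{SU}_{r+1}(\mathbb F_q)\subset \mathrm{SL}_{r+1}(\mathbb F_{q^2})$, $\mathcal P=\mathcal U_{r+1}(q)$, and $f$ is the characteristic polynomial. - Type $B_r$: $\tilde G=\mathrm{Spin}_{2r+1}(\mathbb F_q)$, $\mathcal P=\mathcal O_{2r}(q)$, and $f$ is the characteristic polynomial of the image in $\mathrm{SO}_{2r+1}(\mathbb F_q)$, divided by $x-1$. - Type $C_r$: $\tilde G=\mathrm{Sp}_{2r}(\mathbb F_q)$, $\mathcal P=\mathcal O_{2r}(q)$, and $f$ is the characteristic polynomial. - Types $D_r$, ${}^2D_r$: $\tilde G=\mathrm{Spin}^{\pm}_{2r}(\mathbb F_q)$, $\mathcal P=\mathcal O_{2r}(q)$, and $f$ is the characteristic polynomial of the image in $\mathrm{SO}^{\pm}_{2r}(\mathbb F_q)$. **Proposition.** For every $\epsilon>0$ there is a constant $C$, depending only on $\epsilon$, such that for every classical finite simple group $G$ (of any of these types, any rank $r$ and any $q$), the proportion of $P\in\mathcal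 P$ for which some conjugacy class in $f^{-1}(P)$ has centralizer order in $\tilde G$ greater than $Cq^r$ is less than $\epsilon$. -/

import Mathlib

open Polynomial

noncomputable section

/-! ### The sets of polynomials -/

/-- `𝓛_n(q)`: the monic polynomials `P` of degree `n` over `K = 𝔽_q` with `P(0) = (-1)^n`. -/
def linearPolys (K : Type*) [Field K] (n : ℕ) : Set K[X] :=
  {P | P.Monic ∧ P.natDegree = n ∧ P.eval 0 = (-1) ^ n}

/-- `P^*(x) = P(0)⁻¹ x^{deg P} P(1/x)`. The Mathlib operation `Polynomial.reverse` is
`P ↦ x^{deg P} P(1/x)`. -/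
def dualPoly {K : Type*} [Field K] (P : K[X]) : K[X] :=
  C (P.eval 0)⁻¹ * P.reverse

/-- `P^*(x) = P̄(0)⁻¹ x^{deg P} P̄(1/x)`, where `P̄` is obtained from `P` by applying the
involution `star` to the coefficients. -/
def starDualPoly {K : Type*} [Field K] [StarRing K] (P : K[X]) : K[X] :=
  dualPoly (P.map (starRingEnd K))

/-- `𝓤_n(q)`: the monic polynomials `P = P^*` of degree `n` over `K = 𝔽_{q²}` with
`P(0) = (-1)^n`, where `star` is the `q`-Frobenius of `K`. -/
def unitaryPolys (K : Type*) [Field K] [StarRing K] (n : ℕ) : Set K[X] :=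
  {P | P.Monic ∧ P.natDegree = n ∧ starDualPoly P = P ∧ P.eval 0 = (-1) ^ n}

/-- `𝓞_n(q)` (for even `n`): the monic polynomials `P = P^*` of degree `n` over `K = 𝔽_q` with
`P(0) = 1`. -/
def orthogonalPolys (K : Type*) [Field K] (n : ℕ) : Set K[X] :=
  {P | P.Monic ∧ P.natDegree = n ∧ dualPoly P = P ∧ P.eval 0 = 1}

/-! ### Spin groups and their vector representation, in every characteristic -/

/-- Nonsingular quadratic forms: no nonzero vector of the radical of the polar form is isotropic.
In characteristic `≠ 2`, or in even dimension over a perfect field, this says that the polar form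
is nondegenerate; in odd dimension over a finite field of characteristic `2` it says that the
radical of the polar form is an anisotropic line. -/
def QuadNonsingular {K V : Type*} [Field K] [AddCommGroup V] [Module K V]
    (Q : QuadraticForm K V) : Prop :=
  ∀ v, Q v = 0 → (∀ w, QuadraticMap.polar Q v w = 0) → v = 0

section Spin

variable {K V : Type*} [Field K] [AddCommGroup V] [Module K V] (Q : QuadraticForm K V)

theorem clifford_ι_injective : Function.Injective (CliffordAlgebra.ι Q) := by
  obtain ⟨B, hB⟩ := LinearMap.BilinMap.toQuadraticMap_surjective (R := K) (-Q)
  have h : B.toQuadraticMap = (0 : QuadraticForm K V) - Q := by rw [hB, zero_sub]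
  have hinj : Function.Injective (CliffordAlgebra.ι (0 : QuadraticForm K V)) :=
    (ExteriorAlgebra.ι_leftInverse (R := K) (M := V)).injective
  intro v w hvw
  apply hinj
  rw [← CliffordAlgebra.changeForm_ι h v, ← CliffordAlgebra.changeForm_ι h w, hvw]

theorem lipschitz_conj_mem_range {x : (CliffordAlgebra Q)ˣ} (hx : x ∈ lipschitzGroup Q) (v : V) :
    (x : CliffordAlgebra Q) * CliffordAlgebra.ι Q v * ((x⁻¹ : (CliffordAlgebra Q)ˣ) :
      CliffordAlgebra Q) ∈ LinearMap.range (CliffordAlgebra.ι Q) := by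
  rcases subsingleton_or_nontrivial (CliffordAlgebra Q) with hs | hs
  · exact ⟨0, Subsingleton.elim _ _⟩
  have key : ∀ (x : (CliffordAlgebra Q)ˣ) (a : V), CliffordAlgebra.ι Q a = x → Q a ≠ 0 := by
    intro x a ha h0
    have h := CliffordAlgebra.ι_sq_scalar Q a
    rw [h0, map_zero, ha, ← Units.val_mul] at h
    exact (x * x).ne_zero h
  unfold lipschitzGroup at hx
  induction hx using Subgroup.closure_induction'' generalizing v with
  | mem x hx =>
    obtain ⟨a, ha⟩ := hx
    let := x.invertible
    let : Invertible (CliffordAlgebra.ι Q a) := by rwa [ha]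
    let : Invertible (Q a) := invertibleOfNonzero (key x a ha)
    simp_rw [← invOf_units x, ← ha, CliffordAlgebra.ι_mul_ι_mul_invOf_ι,
      LinearMap.mem_range_self]
  | inv_mem x hx =>
    obtain ⟨a, ha⟩ := hx
    let := x.invertible
    let : Invertible (CliffordAlgebra.ι Q a) := by rwa [ha]
    let : Invertible (Q a) := invertibleOfNonzero (key x a ha)
    simp_rw [← invOf_units x, inv_inv, ← ha, CliffordAlgebra.invOf_ι_mul_ι_mul_ι,
      LinearMap.mem_range_self]
  | one => simp_rw [inv_one, Units.val_one, one_mul, mul_one, LinearMap.mem_range_self]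
  | mul y z _ _ hy hz =>
    simp_rw [mul_inv_rev, Units.val_mul]
    suffices (y : CliffordAlgebra Q) * (z * CliffordAlgebra.ι Q v * ↑z⁻¹) * ↑y⁻¹ ∈
        LinearMap.range (CliffordAlgebra.ι Q) by simpa only [mul_assoc] using this
    obtain ⟨z', hz'⟩ := hz v
    obtain ⟨y', hy'⟩ := hy z'
    simp_rw [← hz', ← hy', LinearMap.mem_range_self]

theorem spin_conj_mem_range (g : spinGroup Q) (v : V) :
    (g : CliffordAlgebra Q) * CliffordAlgebra.ι Q v * ((g⁻¹ : spinGroup Q) : CliffordAlgebra Q) ∈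
      LinearMap.range (CliffordAlgebra.ι Q) :=
  lipschitz_conj_mem_range Q (x := spinGroup.toUnits g)
    (spinGroup.units_mem_lipschitzGroup g.2) v

/-- The action of an element `g` of the spin group on `V`, identified with the space of vectors
of the Clifford algebra, by conjugation `v ↦ g v g⁻¹`. -/
def spinVectorAction (g : spinGroup Q) : V →ₗ[K] V :=
  (LinearEquiv.ofInjective (CliffordAlgebra.ι Q) (clifford_ι_injective Q)).symm.toLinearMap ∘ₗ
    LinearMap.codRestrict (LinearMap.range (CliffordAlgebra.ι Q))
      (LinearMap.mulLeftRight K ((g : CliffordAlgebra Q),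
        ((g⁻¹ : spinGroup Q) : CliffordAlgebra Q)) ∘ₗ CliffordAlgebra.ι Q)
      (fun v => by simpa using spin_conj_mem_range Q g v)

theorem ι_spinVectorAction (g : spinGroup Q) (v : V) :
    CliffordAlgebra.ι Q (spinVectorAction Q g v) =
      (g : CliffordAlgebra Q) * CliffordAlgebra.ι Q v *
        ((g⁻¹ : spinGroup Q) : CliffordAlgebra Q) := by
  have h : ∀ y : LinearMap.range (CliffordAlgebra.ι Q), CliffordAlgebra.ι Q
      ((LinearEquiv.ofInjective (CliffordAlgebra.ι Q) (clifford_ι_injective Q)).symm y) = y := by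
    intro y
    exact congrArg Subtype.val ((LinearEquiv.ofInjective (CliffordAlgebra.ι Q)
      (clifford_ι_injective Q)).apply_symm_apply y)
  simp [spinVectorAction, h]

/-- The vector representation `Spin(V) → GL(V)`, whose image lies in `SO(V)`. -/
def spinVectorRep : spinGroup Q →* Module.End K V where
  toFun := spinVectorAction Q
  map_one' := by
    ext v
    apply clifford_ι_injective Q
    simp [ι_spinVectorAction]
  map_mul' g h := by
    ext v
    apply clifford_ι_injective Q
    simp [ι_spinVectorAction, mul_assoc]

end Spin

/-! ### The maps `f` and the proportion of polynomials -/

/-- Type `A`: the characteristic polynomial on `SL_n(q)`. -/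
def slCharpoly (K : Type*) [Field K] (n : ℕ) (g : Matrix.SpecialLinearGroup (Fin n) K) : K[X] :=
  (g : Matrix (Fin n) (Fin n) K).charpoly

/-- Type `²A`: the characteristic polynomial on `SU_n(q)`. -/
def suCharpoly (K : Type*) [Field K] [StarRing K] (n : ℕ)
    (g : Matrix.specialUnitaryGroup (Fin n) K) : K[X] :=
  (g : Matrix (Fin n) (Fin n) K).charpoly

/-- Type `C`: the characteristic polynomial on `Sp_{2r}(q)`. -/
def spCharpoly (K : Type*) [Field K] (r : ℕ) (g : Matrix.symplecticGroup (Fin r) K) : K[X] :=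
  (g : Matrix (Fin r ⊕ Fin r) (Fin r ⊕ Fin r) K).charpoly

/-- Types `D`, `²D`: the characteristic polynomial of the vector representation. -/
def spinCharpoly {K V : Type*} [Field K] [AddCommGroup V] [Module K V] [FiniteDimensional K V]
    (Q : QuadraticForm K V) (g : spinGroup Q) : K[X] :=
  (spinVectorRep Q g).charpoly

/-- Type `B`: the characteristic polynomial of the vector representation, divided by `x - 1`. -/
def spinOddCharpoly {K V : Type*} [Field K] [AddCommGroup V] [Module K V]
    [FiniteDimensional K V] (Q : QuadraticForm K V) (g : spinGroup Q) : K[X] :=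
  spinCharpoly Q g /ₘ (X - C 1)

/-- The `P ∈ S` over which (with respect to `f`) lies the conjugacy class of some element `g` of
`Γ` whose centralizer has order greater than `B`. -/
def largeCentralizerPolys {Γ K : Type*} [Group Γ] [Field K] (f : Γ → K[X]) (S : Set K[X])
    (B : ℝ) : Set K[X] :=
  {P ∈ S | ∃ g : Γ, f g = P ∧ B < (Nat.card (Subgroup.centralizer {g}) : ℝ)}

/-- The proportion of the `P ∈ S` over which (with respect to `f`) lies a conjugacy class of `Γ`
with centralizer order greater than `B` is less than `ε`. -/
def FewLargeCentralizers {Γ K : Type*} [Group Γ] [Field K] (f : Γ → K[X]) (S : Set K[X])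
    (B ε : ℝ) : Prop :=
  ((largeCentralizerPolys f S B).ncard : ℝ) < ε * (S.ncard : ℝ)

end

/-!
Let `g` be an isometry of a space `V` over a finite field `K` (an element of `U_n`, `Sp_{2r}` or
`O_n`), and put `s = √|K|`. If the characteristic polynomial `P` of `g` is squarefree and, in case
the form has trivial involution, prime to `X² - 1`, then `g` is cyclic, so every endomorphism
commuting with `g` is a polynomial in `g`, and the adjunction of the form induces on `A = K[x] /
P` the involution `τ` with `τ(x) = x⁻¹`. Isometries commuting with `g` correspond to `a ∈ A` with
`a τ(a) = 1`. The Cayley transform `a ↦ (a + 1)⁻¹`, taken modulo the annihilator of `a + 1`,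
bounds their number by a sum over the `τ`-stable ideals of `A`, that is, over the self-dual
divisors `D` of `P`: it is at most `s ^ deg P * ∑ s ^ (-deg D)`
(`card_norm_one_le_weightedDivisorSum`, `card_commuting_isometries_le`).

In general let `D` be a self-dual polynomial of maximal degree with `D² ∣ P`. Then `P = R S` with
`R`, `S` self-dual and coprime, `S` squarefree and prime to `X² - 1` (for the forms with trivial
involution), and `deg R ≤ 3 deg D + 2` (`IsDivisorFamily.exists_coprime_factorization`). The two
primary parts are orthogonal and are respected by the centralizer; the first one contributes at
most `|K| ^ (deg R)²` (`card_isometries_le_mul`).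

It remains to see that for most `P` the degree of `D` and the sum over the divisors are bounded.
The self-dual polynomials of degree `m` number about `s ^ m`, up to a factor depending on the
constant term (`SliceBounds`), so the expected number of `D` with `deg D ≥ Δ` and `D² ∣ P` is a
multiple of `s ^ (-Δ)`, and the expected value of the divisor sum is bounded; Markov's inequality
gives `exists_card_exceptional_lt`. If `s` is bounded, the factor `|K| ^ (deg R)²` is bounded as
well. If `s` is large, then for most `P` there is no repeated factor and, for the forms with
trivial involution, no factor `X ∓ 1`, so that `R = 1`. In both cases the centralizer has order at
most a constant times `s ^ deg P`.

For `SL_n` there is no form; the commutant of an endomorphism with squarefree characteristic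
polynomial `P` has `|K| ^ deg P` elements, and the same splitting applies with `s = |K|` and all
monic polynomials prime to `X` in place of the self-dual ones. For `SL_n` and `SU_n` a further
factor of about `q` is gained from the determinant: if `P` is squarefree, the determinant takes
every value on `K[g]` (`exists_det_aeval_eq`), and every value `t ^ (q - 1)` on the unitary
elements `b* b⁻¹` with `b ∈ K[g]`. For the spin groups, an even element of the Clifford algebra
that commutes with all vectors is a scalar, so the vector representation has a kernel of order at
most two (`QuadNonsingular.card_centralizer_le`). In odd dimension its image has determinant one,
so the characteristic polynomial is exactly `(X - 1) P`, and the additional eigenspace is an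
anisotropic line when `X - 1` is prime to `P`.
-/

noncomputable section

/-! ### Primary decomposition of an endomorphism and cyclic vectors -/

section LinearAlgebra

variable {K V : Type*} [Field K] [AddCommGroup V] [Module K V] [FiniteDimensional K V]

/-- Every irreducible factor of the characteristic polynomial divides every polynomial that
annihilates the endomorphism: it has a root, which is an eigenvalue over an extension field. -/
theorem irreducible_dvd_of_dvd_charpoly (g : Module.End K V) {f p : K[X]} (hf : Irreducible f)
    (hfg : f ∣ g.charpoly) (hp : aeval g p = 0) : f ∣ p := by
  classical
  have : Fact (Irreducible f) := ⟨hf⟩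
  let b := Module.finBasis K V
  let A := LinearMap.toMatrix b b g
  have hA : A.charpoly = g.charpoly := LinearMap.charpoly_toMatrix g b
  have hpA : aeval A p = 0 := by
    have h := Polynomial.aeval_algHom_apply (LinearMap.toMatrixAlgEquiv b).toAlgHom g p
    rw [hp, map_zero] at h
    exact h
  let φ : K →+* AdjoinRoot f := AdjoinRoot.of f
  let A' := A.map φ
  let α := AdjoinRoot.root f
  have hroot : IsRoot A'.charpoly α := by
    rw [Matrix.charpoly_map, hA, IsRoot, eval_map]
    exact eval₂_eq_zero_of_dvd_of_eval₂_eq_zero _ _ hfg (AdjoinRoot.eval₂_root f)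
  have hA'p : aeval A' (p.map φ) = 0 := by
    have h1 : φ.mapMatrix (aeval A p) = aeval A' (p.map φ) := by
      rw [aeval_def, hom_eval₂, aeval_def, eval₂_map]
      congr 1
      ext r i j
      simp [Matrix.algebraMap_matrix_apply, apply_ite φ]
    rw [← h1, hpA, map_zero]
  have h2 := spectrum.subset_polynomial_aeval A' (p.map φ)
    ⟨α, Matrix.mem_spectrum_of_isRoot_charpoly hroot, rfl⟩
  rw [hA'p, spectrum.mem_iff, sub_zero] at h2
  have h3 : eval α (p.map φ) = 0 := by
    by_contra h0
    exact h2 ((IsUnit.mk0 _ h0).map (algebraMap _ _))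
  rw [eval_map] at h3
  exact AdjoinRoot.mk_eq_zero.1 ((AdjoinRoot.aeval_eq p).symm.trans h3)

omit [FiniteDimensional K V] in
theorem commute_aeval {g h : Module.End K V} (hc : Commute h g) (p : K[X]) :
    Commute h (aeval g p) := by
  induction p using Polynomial.induction_on' with
  | add p q hp hq => rw [map_add]; exact hp.add_right hq
  | monomial n a =>
    rw [aeval_monomial]
    exact (Algebra.commute_algebraMap_right a h).mul_right (hc.pow_right n)

theorem dvd_of_squarefree_of_irreducible_dvd {P m : K[X]} (hP : Squarefree P)
    (h : ∀ f, Irreducible f → f ∣ P → f ∣ m) : P ∣ m := by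
  classical
  have hP0 : P ≠ 0 := hP.ne_zero
  obtain ⟨Q, hQ⟩ := gcd_dvd_left P m
  by_cases hu : IsUnit Q
  · exact (associated_of_dvd_dvd ((hu.dvd_mul_right).1 (hQ ▸ dvd_rfl)) ⟨Q, hQ⟩).dvd.trans
      (gcd_dvd_right P m)
  · have hQ0 : Q ≠ 0 := by rintro rfl; simp at hQ; exact hP0 hQ
    obtain ⟨f, hf, hfQ⟩ := WfDvdMonoid.exists_irreducible_factor hu hQ0
    have hfP : f ∣ P := hQ ▸ hfQ.mul_left _
    have hfg : f ∣ gcd P m := dvd_gcd hfP (h f hf hfP)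
    exact absurd (hP f (hQ ▸ mul_dvd_mul hfg hfQ)) hf.not_isUnit

theorem minpoly_eq_charpoly_of_squarefree (g : Module.End K V) (h : Squarefree g.charpoly) :
    minpoly K g = g.charpoly :=
  (eq_of_monic_of_associated (minpoly.monic (LinearMap.isIntegral g)) g.charpoly_monic
    (associated_of_dvd_dvd (LinearMap.minpoly_dvd_charpoly g)
      (dvd_of_squarefree_of_irreducible_dvd h fun _ hf hfg =>
        irreducible_dvd_of_dvd_charpoly g hf hfg (minpoly.aeval K g))))

omit [FiniteDimensional K V] in
theorem aeval_restrict_apply (g : Module.End K V) {U : Submodule K V} (hU : ∀ x ∈ U, g x ∈ U)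
    (p : K[X]) (x : U) : ((aeval (g.restrict hU) p x : U) : V) = aeval g p x := by
  induction p using Polynomial.induction_on' generalizing x with
  | add p q hp hq => simp [hp, hq]
  | monomial n a =>
    rw [aeval_monomial, aeval_monomial]
    have : ∀ x : U, (((g.restrict hU) ^ n) x : V) = (g ^ n) x := by
      induction n with
      | zero => simp
      | succ n ih => intro x; simp [pow_succ, ih]
    simp [this]

omit [FiniteDimensional K V] in
/-- The kernel of `p(g)` is stable under every endomorphism that commutes with `g`. -/
theorem map_mem_ker_aeval {g h : Module.End K V} (hc : Commute h g) (p : K[X]) :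
    ∀ x ∈ LinearMap.ker (aeval g p), h x ∈ LinearMap.ker (aeval g p) := by
  intro x hx
  rw [LinearMap.mem_ker] at hx ⊢
  have := congrArg (fun k : Module.End K V => k x) (commute_aeval hc p).eq
  simp only [Module.End.mul_apply, hx, map_zero] at this
  exact this.symm

theorem charpoly_eq_mul_of_isCompl (g : Module.End K V) {U W : Submodule K V} (h : IsCompl U W)
    (hU : ∀ x ∈ U, g x ∈ U) (hW : ∀ x ∈ W, g x ∈ W) :
    g.charpoly = (g.restrict hU).charpoly * (g.restrict hW).charpoly := by
  rw [← LinearMap.charpoly_prodMap,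
    ← LinearEquiv.charpoly_conj (Submodule.prodEquivOfIsCompl U W h)]
  congr 1
  ext x
  obtain ⟨y, rfl⟩ := (Submodule.prodEquivOfIsCompl U W h).surjective x
  simp [LinearEquiv.conj_apply]

theorem det_eq_mul_of_isCompl (g : Module.End K V) {U W : Submodule K V} (h : IsCompl U W)
    (hU : ∀ x ∈ U, g x ∈ U) (hW : ∀ x ∈ W, g x ∈ W) :
    LinearMap.det g = LinearMap.det (g.restrict hU) * LinearMap.det (g.restrict hW) := by
  rw [← LinearMap.det_prodMap, ← LinearMap.det_conj _ (Submodule.prodEquivOfIsCompl U W h)]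
  congr 1
  ext x
  obtain ⟨y, rfl⟩ := (Submodule.prodEquivOfIsCompl U W h).surjective x
  simp

omit [FiniteDimensional K V] in
theorem isCompl_ker_aeval (g : Module.End K V) {R S : K[X]} (hRS : IsCoprime R S)
    (h : aeval g (R * S) = 0) :
    IsCompl (LinearMap.ker (aeval g R)) (LinearMap.ker (aeval g S)) :=
  ⟨disjoint_ker_aeval_of_isCoprime g hRS, by
    rw [codisjoint_iff, sup_ker_aeval_eq_ker_aeval_mul_of_coprime g hRS, h, LinearMap.ker_zero]⟩

/-- The characteristic polynomials of `g` on the kernels of `R(g)` and `S(g)`, when the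
characteristic polynomial is the product of the coprime monic polynomials `R` and `S`. -/
theorem charpoly_restrict_ker_aeval (g : Module.End K V) {R S : K[X]} (hRS : IsCoprime R S)
    (hR : R.Monic) (hS : S.Monic) (h : g.charpoly = R * S) :
    (g.restrict (map_mem_ker_aeval (Commute.refl g) R)).charpoly = R ∧
      (g.restrict (map_mem_ker_aeval (Commute.refl g) S)).charpoly = S := by
  have hc := isCompl_ker_aeval g hRS (h ▸ g.aeval_self_charpoly)
  have hmul := charpoly_eq_mul_of_isCompl g hc (map_mem_ker_aeval (Commute.refl g) R)
    (map_mem_ker_aeval (Commute.refl g) S)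
  have key : ∀ R S : K[X], IsCoprime R S →
      (g.restrict (map_mem_ker_aeval (Commute.refl g) R)).charpoly ∣ R * S →
      (g.restrict (map_mem_ker_aeval (Commute.refl g) R)).charpoly ∣ R := by
    intro R S hRS hd
    refine IsCoprime.dvd_of_dvd_mul_right ?_ hd
    refine isCoprime_of_irreducible_dvd
      (fun hh => (g.restrict (map_mem_ker_aeval (Commute.refl g) R)).charpoly_monic.ne_zero hh.1)
      fun f hf hf1 hf2 => ?_
    have hfR : f ∣ R := irreducible_dvd_of_dvd_charpoly _ hf hf1 (by
      ext x
      rw [aeval_restrict_apply]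
      exact x.2)
    exact hf.not_isUnit (hRS.isUnit_of_dvd' hfR hf2)
  have h1 := key R S hRS (by rw [← h, hmul]; exact dvd_mul_right _ _)
  have h2 := key S R hRS.symm (by rw [mul_comm, ← h, hmul]; exact dvd_mul_left _ _)
  obtain ⟨a, ha⟩ := h1
  obtain ⟨b, hb⟩ := h2
  rw [hmul] at h
  set χ := (g.restrict (map_mem_ker_aeval (Commute.refl g) R)).charpoly
  set ψ := (g.restrict (map_mem_ker_aeval (Commute.refl g) S)).charpoly
  have hχ : χ.Monic := LinearMap.charpoly_monic _
  have hψ : ψ.Monic := LinearMap.charpoly_monic _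
  have hab : a * b = 1 := by
    have : χ * ψ * (a * b) = χ * ψ * 1 := by
      rw [mul_one]; nth_rw 2 [h]; rw [ha, hb]; ring
    exact mul_left_cancel₀ (mul_ne_zero hχ.ne_zero hψ.ne_zero) this
  constructor
  · exact eq_of_monic_of_associated hχ hR ⟨⟨a, b, hab, by rw [mul_comm, hab]⟩, ha.symm⟩
  · exact eq_of_monic_of_associated hψ hS ⟨⟨b, a, by rw [mul_comm, hab], hab⟩, hb.symm⟩

/-- An endomorphism with squarefree characteristic polynomial has a cyclic vector. -/
theorem exists_cyclic_vector (g : Module.End K V) (h : Squarefree g.charpoly) :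
    ∃ u : V, (∀ p : K[X], aeval g p u = 0 ↔ g.charpoly ∣ p) ∧ ∀ w, ∃ p : K[X], aeval g p u = w := by
  obtain ⟨x, hx⟩ := Module.exists_ker_toSpanSingleton_eq_annihilator K[X] (Module.AEval' g)
  obtain ⟨u, rfl⟩ := (Module.AEval'.of g).surjective x
  have h1 : ∀ p : K[X], aeval g p u = 0 ↔ g.charpoly ∣ p := by
    intro p
    have h2 : p ∈ LinearMap.ker (LinearMap.toSpanSingleton K[X] _ (Module.AEval'.of g u)) ↔
        g.charpoly ∣ p := by
      rw [hx, Module.AEval.annihilator_eq_ker_aeval, minpoly.ker_aeval_eq_span_minpoly,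
        minpoly_eq_charpoly_of_squarefree g h, Ideal.mem_span_singleton]
    rw [← h2, LinearMap.mem_ker, LinearMap.toSpanSingleton_apply]
    constructor
    · intro h3
      have := Module.AEval.of_aeval_smul (R := K) g p u
      rw [Module.End.smul_def, h3, map_zero] at this
      exact this.symm
    · intro h3
      have := Module.AEval.of_aeval_smul (R := K) g p u
      rw [Module.End.smul_def] at this
      exact (Module.AEval'.of g).map_eq_zero_iff.1 (this.trans h3)
  refine ⟨u, h1, ?_⟩
  let T : degreeLT K g.charpoly.natDegree →ₗ[K] V :=
    (LinearMap.applyₗ u ∘ₗ (aeval g).toLinearMap) ∘ₗ Submodule.subtype _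
  have hT : Function.Injective T := by
    rw [← LinearMap.ker_eq_bot, LinearMap.ker_eq_bot']
    rintro ⟨p, hp⟩ h0
    have h2 := (h1 p).1 h0
    have h3 : p = 0 := by
      refine eq_zero_of_dvd_of_degree_lt h2 ?_
      rw [mem_degreeLT] at hp
      rwa [degree_eq_natDegree g.charpoly_monic.ne_zero]
    exact Subtype.ext h3
  have hfr : Module.finrank K (degreeLT K g.charpoly.natDegree) = Module.finrank K V := by
    rw [(degreeLTEquiv K _).finrank_eq, Module.finrank_fin_fun, g.charpoly_natDegree]
  have : FiniteDimensional K (degreeLT K g.charpoly.natDegree) :=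
    Module.Finite.equiv (degreeLTEquiv K _).symm
  have hs := (LinearMap.injective_iff_surjective_of_finrank_eq_finrank hfr).1 hT
  intro w
  obtain ⟨p, hp⟩ := hs w
  exact ⟨p, hp⟩

/-- The centralizer of a cyclic endomorphism consists of polynomials in it. -/
theorem exists_aeval_eq_of_commute (g : Module.End K V) (h : Squarefree g.charpoly)
    {a : Module.End K V} (ha : Commute a g) : ∃ p : K[X], a = aeval g p := by
  obtain ⟨u, -, hu⟩ := exists_cyclic_vector g h
  obtain ⟨p, hp⟩ := hu (a u)
  refine ⟨p, LinearMap.ext fun w => ?_⟩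
  obtain ⟨r, rfl⟩ := hu w
  have h2 := congrArg (fun k : Module.End K V => k u) (commute_aeval ha r).eq
  simp only [Module.End.mul_apply] at h2
  rw [h2, ← hp, ← Module.End.mul_apply, ← Module.End.mul_apply, ← map_mul, ← map_mul, mul_comm]

end LinearAlgebra

/-! ### Elements of norm one in a finite commutative ring with involution -/

section NormOne

variable {A : Type*} [CommRing A] [Finite A] [IsReduced A]

/-- In a finite reduced commutative ring, `x` is invertible modulo its annihilator. -/
theorem exists_mul_sub_one_mem_annihilator {I : Ideal A} {x : A} (hI : ∀ b, b ∈ I ↔ b * x = 0) :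
    ∃ c, c * x - 1 ∈ I := by
  have : Finite (A ⧸ I) := Quotient.finite _
  have hinj : Function.Injective (fun y : A ⧸ I => y * Ideal.Quotient.mk I x) := by
    intro y z hyz
    obtain ⟨y, rfl⟩ := Ideal.Quotient.mk_surjective y
    obtain ⟨z, rfl⟩ := Ideal.Quotient.mk_surjective z
    simp only [← map_mul] at hyz
    rw [Ideal.Quotient.eq, hI] at hyz ⊢
    refine IsReduced.eq_zero _ ⟨2, ?_⟩
    linear_combination (y - z) * hyz
  obtain ⟨c, hc⟩ := (Finite.injective_iff_surjective.1 hinj) 1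
  obtain ⟨c, rfl⟩ := Ideal.Quotient.mk_surjective c
  refine ⟨c, ?_⟩
  rw [← Ideal.Quotient.eq, map_mul, map_one]
  exact hc

/-- The elements `a` of norm one for which `a + 1` has a given annihilator `I`. The inverse `c` of
`a + 1` in `A ⧸ I` satisfies `c + τ c = 1`, and two solutions `c`, `c'` of this equation are
determined by `c + t c'`. -/
theorem sq_card_norm_one_le (τ : A →+* A) {t : A} (ht : IsUnit (t - τ t))
    (I : Ideal A) :
    (Nat.card {a : A // a * τ a = 1 ∧ ∀ b, b ∈ I ↔ b * (a + 1) = 0}) ^ 2 ≤ Nat.card (A ⧸ I) := by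
  set U := {a : A // a * τ a = 1 ∧ ∀ b, b ∈ I ↔ b * (a + 1) = 0}
  have hstab : ∀ a : U, ∀ b ∈ I, τ b ∈ I := by
    intro a b hb
    rw [a.2.2] at hb ⊢
    have h1 := congrArg τ hb
    simp only [map_mul, map_add, map_one, map_zero] at h1
    linear_combination a.1 * h1 - τ b * a.2.1
  have hcanc : ∀ a : U, ∀ b, b * (a.1 + 1) ∈ I → b ∈ I := by
    intro a b hb
    rw [a.2.2] at hb ⊢
    refine IsReduced.eq_zero _ ⟨2, ?_⟩
    linear_combination b * hb
  choose c hc using fun a : U => exists_mul_sub_one_mem_annihilator a.2.2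
  have hct : ∀ a : U, c a + τ (c a) - 1 ∈ I := by
    intro a
    apply hcanc a
    have h1 := I.mul_mem_left a.1 (hstab a _ (hc a))
    simp only [map_mul, map_sub, map_add, map_one] at h1
    have h2 := I.add_mem h1 (hc a)
    convert h2 using 1
    linear_combination (-τ (c a)) * a.2.1
  have hinj : Function.Injective (fun a : U × U => Ideal.Quotient.mk I (c a.1 + t * c a.2)) := by
    have hdet : ∀ a b : U, c a - c b ∈ I → a = b := by
      intro a b hab
      have h1 : a.1 - b.1 ∈ I := by
        have h2 := I.mul_mem_left ((a.1 + 1) * (b.1 + 1)) hab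
        have h3 := I.mul_mem_left (b.1 + 1) (hc a)
        have h4 := I.mul_mem_left (a.1 + 1) (hc b)
        convert I.sub_mem (I.sub_mem h3 h2) h4 using 1
        ring
      have h2 := (a.2.2 _).1 h1
      have h3 := (b.2.2 _).1 h1
      refine Subtype.ext (sub_eq_zero.1 (IsReduced.eq_zero _ ⟨2, ?_⟩))
      linear_combination h2 - h3
    rintro ⟨a, a'⟩ ⟨b, b'⟩ h
    simp only [Ideal.Quotient.eq] at h
    have ha : (c a - c b) + τ (c a - c b) ∈ I := by
      convert I.sub_mem (hct a) (hct b) using 1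
      rw [map_sub]; ring
    have ha' : (c a' - c b') + τ (c a' - c b') ∈ I := by
      convert I.sub_mem (hct a') (hct b') using 1
      rw [map_sub]; ring
    have h1 : (c a - c b) + t * (c a' - c b') ∈ I := by convert h using 1; ring
    have h2 := hstab a _ h1
    rw [map_add, map_mul] at h2
    have h3 : (t - τ t) * (c a' - c b') ∈ I := by
      convert I.add_mem (I.add_mem h1 h2) (I.neg_mem (I.add_mem ha (I.mul_mem_left (τ t) ha')))
        using 1
      ring
    have h4 : c a' - c b' ∈ I := (Ideal.unit_mul_mem_iff_mem I ht).1 h3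
    have h5 : c a - c b ∈ I := by
      convert I.sub_mem h1 (I.mul_mem_left t h4) using 1
      ring
    rw [hdet _ _ h4, hdet _ _ h5]
  have : Finite (A ⧸ I) := Quotient.finite _
  have := Nat.card_le_card_of_injective _ hinj
  rwa [Nat.card_prod, ← sq] at this

open Classical in
theorem card_norm_one_le_sum_ideals (τ : A →+* A) {t : A}
    (ht : IsUnit (t - τ t)) [Fintype (Ideal A)] :
    (Nat.card {a : A // a * τ a = 1} : ℝ) ≤
      ∑ I : Ideal A with ∀ b ∈ I, τ b ∈ I, √(Nat.card (A ⧸ I) : ℝ) := by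
  have := Fintype.ofFinite {a : A // a * τ a = 1}
  let J : {a : A // a * τ a = 1} → Ideal A := fun a =>
    (Ideal.span {a.1 + 1}).annihilator
  have hJ : ∀ a b, b ∈ J a ↔ b * (a.1 + 1) = 0 := fun a b => by
    simp only [J, Ideal.span, Submodule.mem_annihilator_span_singleton, smul_eq_mul]
  rw [Nat.card_eq_fintype_card, ← Finset.card_univ,
    Finset.card_eq_sum_card_fiberwise (f := J) (t := {I | ∀ b ∈ I, τ b ∈ I}), Nat.cast_sum]
  · apply Finset.sum_le_sum
    intro I _
    apply Real.le_sqrt_of_sq_le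
    have h1 := sq_card_norm_one_le τ ht I
    have h2 : Finset.card {a | J a = I} ≤
        Nat.card {a : A // a * τ a = 1 ∧ ∀ b, b ∈ I ↔ b * (a + 1) = 0} := by
      rw [← Fintype.card_subtype, ← Nat.card_eq_fintype_card]
      refine Nat.card_le_card_of_injective
        (fun a => ⟨a.1.1, a.1.2, fun b =>
          (iff_of_eq (congrArg (b ∈ ·) a.2)).symm.trans (hJ a.1 b)⟩) fun a b hab => ?_
      exact Subtype.ext (Subtype.ext (Subtype.mk.inj hab))
    exact_mod_cast (Nat.pow_le_pow_left h2 2).trans h1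
  · intro a _
    simp only [Finset.coe_filter, Finset.mem_univ, true_and, Set.mem_ofPred_eq]
    intro b hb
    rw [hJ] at hb ⊢
    have h1 := congrArg τ hb
    simp only [map_mul, map_add, map_one, map_zero] at h1
    linear_combination a.1 * h1 - τ b * a.2

end NormOne

/-! ### Self-dual polynomials -/

section SelfDual

variable {K : Type*} [Field K]

/-- The polynomial `x^{deg P} P^σ(1/x)`, where `P^σ` is obtained by applying `σ` to the
coefficients of `P`. -/
def conjReverse (σ : K →+* K) (P : K[X]) : K[X] := (P.map σ).reverse

/-- Monic polynomials with nonzero constant term that agree up to a constant with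
`x^{deg P} P^σ(1/x)`; by degrees, divisibility is enough. -/
structure IsSelfDual (σ : K →+* K) (P : K[X]) : Prop where
  monic : P.Monic
  coeff_zero_ne : P.coeff 0 ≠ 0
  dvd_conjReverse : P ∣ conjReverse σ P

variable {σ : K →+* K}

theorem conjReverse_mul (P Q : K[X]) :
    conjReverse σ (P * Q) = conjReverse σ P * conjReverse σ Q := by
  rw [conjReverse, Polynomial.map_mul, reverse_mul_of_domain]; rfl

theorem natDegree_conjReverse {P : K[X]} (h : P.coeff 0 ≠ 0) :
    (conjReverse σ P).natDegree = P.natDegree := by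
  rw [conjReverse, reverse_natDegree, natDegree_map, natTrailingDegree_eq_zero.2 (Or.inr ?_),
    Nat.sub_zero]
  rw [coeff_map]
  exact (map_ne_zero σ).2 h

theorem coeff_zero_conjReverse (P : K[X]) : (conjReverse σ P).coeff 0 = σ P.leadingCoeff := by
  rw [conjReverse, coeff_zero_reverse, leadingCoeff_map]

theorem conjReverse_ne_zero {P : K[X]} (h : P ≠ 0) : conjReverse σ P ≠ 0 := by
  rwa [conjReverse, Ne, reverse_eq_zero, Polynomial.map_eq_zero]

theorem conjReverse_dvd {P Q : K[X]} (h : P ∣ Q) : conjReverse σ P ∣ conjReverse σ Q := by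
  obtain ⟨R, rfl⟩ := h
  exact ⟨_, conjReverse_mul P R⟩

theorem conjReverse_conjReverse (hσ : ∀ x, σ (σ x) = x) {P : K[X]} (h : P.coeff 0 ≠ 0) :
    conjReverse σ (conjReverse σ P) = P := by
  have h1 := natDegree_conjReverse (σ := σ) h
  ext n
  rw [conjReverse, coeff_reverse, natDegree_map, h1, coeff_map, conjReverse, coeff_reverse,
    natDegree_map, revAt_invol, coeff_map, hσ]

theorem coeff_zero_ne_of_dvd {P Q : K[X]} (h : P ∣ Q) (hQ : Q.coeff 0 ≠ 0) : P.coeff 0 ≠ 0 := by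
  obtain ⟨R, rfl⟩ := h
  rw [mul_coeff_zero] at hQ
  exact left_ne_zero_of_mul hQ

theorem IsSelfDual.associated {P : K[X]} (h : IsSelfDual σ P) : Associated P (conjReverse σ P) :=
  associated_of_dvd_of_natDegree_le h.dvd_conjReverse (conjReverse_ne_zero h.monic.ne_zero)
    (natDegree_conjReverse h.coeff_zero_ne).le

theorem isSelfDual_of_conjReverse_dvd {P : K[X]} (hP : P.Monic) (h0 : P.coeff 0 ≠ 0)
    (h : conjReverse σ P ∣ P) : IsSelfDual σ P :=
  ⟨hP, h0, (associated_of_dvd_of_natDegree_le h hP.ne_zero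
    (natDegree_conjReverse h0).ge).symm.dvd⟩

theorem isSelfDual_one : IsSelfDual σ 1 :=
  ⟨monic_one, by simp, one_dvd _⟩

theorem IsSelfDual.mul {P Q : K[X]} (hP : IsSelfDual σ P) (hQ : IsSelfDual σ Q) :
    IsSelfDual σ (P * Q) :=
  ⟨hP.monic.mul hQ.monic, by rw [mul_coeff_zero]; exact mul_ne_zero hP.2 hQ.2, by
    rw [conjReverse_mul]; exact mul_dvd_mul hP.3 hQ.3⟩

theorem IsSelfDual.of_mul {P Q : K[X]} (hP : IsSelfDual σ P) (h : IsSelfDual σ (P * Q)) :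
    IsSelfDual σ Q := by
  refine ⟨hP.monic.of_mul_monic_left h.monic,
    coeff_zero_ne_of_dvd (dvd_mul_left Q P) h.coeff_zero_ne, ?_⟩
  obtain ⟨u, hu⟩ := hP.associated
  have h1 := h.dvd_conjReverse
  rw [conjReverse_mul, ← hu, mul_assoc] at h1
  exact (Units.dvd_mul_left).1 ((mul_dvd_mul_iff_left hP.monic.ne_zero).1 h1)

theorem coeff_zero_normalize_ne [DecidableEq K] {P : K[X]} (h : P.coeff 0 ≠ 0) :
    (normalize P).coeff 0 ≠ 0 :=
  coeff_zero_ne_of_dvd (normalize_associated P).dvd h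

theorem IsSelfDual.normalize_gcd [DecidableEq K] {P Q : K[X]} (hP : IsSelfDual σ P)
    (hQ : IsSelfDual σ Q) : IsSelfDual σ (normalize (gcd P Q)) := by
  have h0 : gcd P Q ≠ 0 := gcd_ne_zero_of_left hP.monic.ne_zero
  have h1 := (normalize_associated (gcd P Q)).dvd
  refine isSelfDual_of_conjReverse_dvd (monic_normalize h0)
    (coeff_zero_ne_of_dvd (h1.trans (gcd_dvd_left P Q)) hP.coeff_zero_ne) ?_
  refine (dvd_gcd ?_ ?_).trans (normalize_associated (gcd P Q)).symm.dvd
  · exact (conjReverse_dvd (h1.trans (gcd_dvd_left P Q))).trans hP.associated.symm.dvd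
  · exact (conjReverse_dvd (h1.trans (gcd_dvd_right P Q))).trans hQ.associated.symm.dvd

/-- If an irreducible `f` divides a self-dual polynomial twice, then so does `f` or the product of
`f` with its dual. -/
theorem IsSelfDual.exists_sq_dvd (hσ : ∀ x, σ (σ x) = x) {T : K[X]} (hT : IsSelfDual σ T)
    (h : ¬ Squarefree T) : ∃ D, IsSelfDual σ D ∧ 0 < D.natDegree ∧ D ^ 2 ∣ T := by
  classical
  have hex : ∃ f, Irreducible f ∧ f * f ∣ T := by
    by_contra! hc
    exact h ((squarefree_iff_irreducible_sq_not_dvd_of_ne_zero hT.monic.ne_zero).2 hc)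
  obtain ⟨f, hf, hfT⟩ := hex
  have hfT' : f ∣ T := (dvd_mul_right f f).trans hfT
  have hf0 := coeff_zero_ne_of_dvd hfT' hT.coeff_zero_ne
  have key : ∀ D : K[X], f ∣ D → D.coeff 0 ≠ 0 → conjReverse σ D ∣ D → D ^ 2 ∣ T →
      ∃ D, IsSelfDual σ D ∧ 0 < D.natDegree ∧ D ^ 2 ∣ T := by
    intro D hfD hD0 hD hDT
    have hne : D ≠ 0 := by rintro rfl; simp at hD0
    have ha := normalize_associated D
    refine ⟨normalize D, isSelfDual_of_conjReverse_dvd (monic_normalize hne)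
      (coeff_zero_normalize_ne hD0) ((conjReverse_dvd ha.dvd).trans (hD.trans ha.symm.dvd)), ?_,
      (pow_dvd_pow_of_dvd ha.dvd 2).trans hDT⟩
    have h1 : f.natDegree ≤ (normalize D).natDegree :=
      natDegree_le_of_dvd (hfD.trans ha.symm.dvd) (monic_normalize hne).ne_zero
    exact hf.natDegree_pos.trans_le h1
  by_cases hd : f ∣ conjReverse σ f
  · refine key f dvd_rfl hf0 ?_ (by rwa [sq])
    exact (associated_of_dvd_of_natDegree_le hd (conjReverse_ne_zero hf.ne_zero)
      (natDegree_conjReverse hf0).le).symm.dvd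
  · have hr : conjReverse σ f ^ 2 ∣ T := by
      have := (conjReverse_dvd (σ := σ) hfT).trans hT.associated.symm.dvd
      rwa [conjReverse_mul, ← sq] at this
    refine key (f * conjReverse σ f) (dvd_mul_right _ _) ?_ ?_ ?_
    · rw [mul_coeff_zero, coeff_zero_conjReverse]
      exact mul_ne_zero hf0 ((map_ne_zero σ).2 (leadingCoeff_ne_zero.2 hf.ne_zero))
    · rw [conjReverse_mul, conjReverse_conjReverse hσ hf0, mul_comm]
    · rw [mul_pow]
      exact IsCoprime.mul_dvd ((hf.coprime_iff_not_dvd.2 hd).pow) (by rwa [sq]) hr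

theorem isSelfDual_of_dualPoly {P : K[X]} (hP : P.Monic) (h0 : P.eval 0 ≠ 0)
    (h : dualPoly (P.map σ) = P) : IsSelfDual σ P := by
  have h1 : P.coeff 0 ≠ 0 := by rwa [coeff_zero_eq_eval_zero]
  refine ⟨hP, h1, ?_⟩
  nth_rw 1 [← h]
  refine (IsUnit.mul_left_dvd (isUnit_C.2 (IsUnit.mk0 _ (inv_ne_zero ?_)))).2 dvd_rfl
  rw [← coeff_zero_eq_eval_zero, coeff_map]
  exact (map_ne_zero σ).2 h1

theorem isSelfDual_X_sub_C {a : K} (ha : a * a = 1) :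
    IsSelfDual (RingHom.id K) (X - C a) := by
  have ha0 : a ≠ 0 := by rintro rfl; simp at ha
  refine ⟨monic_X_sub_C a, by simpa using ha0, ?_⟩
  let : Invertible a := ⟨a, ha, ha⟩
  rw [dvd_iff_isRoot, conjReverse, Polynomial.map_id, IsRoot]
  exact (eval₂_reverse_eq_zero_iff (RingHom.id K) a (X - C a)).2 (by simp)

theorem IsSelfDual.conjReverse_eq {P : K[X]} (h : IsSelfDual σ P) :
    conjReverse σ P = C (σ (P.coeff 0)) * P := by
  obtain ⟨Q, hQ⟩ := h.dvd_conjReverse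
  have hdeg := natDegree_conjReverse (σ := σ) h.coeff_zero_ne
  have hQ0 : Q ≠ 0 := by rintro rfl; exact conjReverse_ne_zero h.monic.ne_zero (by simpa using hQ)
  rw [hQ, h.monic.natDegree_mul' hQ0] at hdeg
  obtain ⟨c, rfl⟩ := natDegree_eq_zero.1 (by omega : Q.natDegree = 0)
  have h1 := congrArg leadingCoeff hQ
  rw [conjReverse, reverse_leadingCoeff, leadingCoeff_mul, h.monic.leadingCoeff, one_mul,
    leadingCoeff_C, trailingCoeff, natTrailingDegree_eq_zero.2 (Or.inr ?_), coeff_map] at h1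
  · rw [hQ, h1, mul_comm]
  · rw [coeff_map]; exact (map_ne_zero σ).2 h.coeff_zero_ne

theorem IsSelfDual.dualPoly_eq {P : K[X]} (h : IsSelfDual σ P) : dualPoly (P.map σ) = P := by
  have h1 := h.conjReverse_eq
  rw [conjReverse] at h1
  rw [dualPoly, h1, ← mul_assoc, ← C_mul, ← coeff_zero_eq_eval_zero, coeff_map, inv_mul_cancel₀,
    C_1, one_mul]
  exact (map_ne_zero σ).2 h.coeff_zero_ne

/-- The coefficients of a self-dual polynomial of degree `n` satisfy
`P_n-i = P(0) σ(P_i)`. -/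
theorem IsSelfDual.coeff_eq {P : K[X]} (h : IsSelfDual σ P) {i : ℕ} (hi : i ≤ P.natDegree) :
    σ (P.coeff (P.natDegree - i)) = σ (P.coeff 0) * P.coeff i := by
  have h1 := congrArg (fun p => coeff p i) h.conjReverse_eq
  simpa [conjReverse, coeff_reverse, revAt_le, hi] using h1

end SelfDual

/-! ### Splitting off the repeated factors -/

section Family

variable {K : Type*} [Field K]

/-- Families of monic polynomials that are closed under products, quotients and greatest common
divisors, and in which squarefreeness is detected by the squares of members of the family. -/
structure IsDivisorFamily (F : K[X] → Prop) : Prop where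
  monic : ∀ {P}, F P → P.Monic
  one : F 1
  mul : ∀ {P Q}, F P → F Q → F (P * Q)
  of_mul : ∀ {P Q}, F P → F (P * Q) → F Q
  exists_gcd : ∀ {P Q}, F P → F Q → ∃ G, F G ∧ G ∣ P ∧ G ∣ Q ∧ ∀ f, f ∣ P → f ∣ Q → f ∣ G
  exists_sq_dvd : ∀ {P}, F P → ¬ Squarefree P → ∃ D, F D ∧ 0 < D.natDegree ∧ D ^ 2 ∣ P

theorem isDivisorFamily_isSelfDual {σ : K →+* K} (hσ : ∀ x, σ (σ x) = x) :
    IsDivisorFamily (IsSelfDual σ) := by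
  classical
  exact ⟨fun h => h.monic, isSelfDual_one, fun h1 h2 => h1.mul h2, fun h1 h2 => h1.of_mul h2,
    fun {P Q} h1 h2 => ⟨_, h1.normalize_gcd h2,
      (normalize_associated _).dvd.trans (gcd_dvd_left P Q),
      (normalize_associated _).dvd.trans (gcd_dvd_right P Q),
      fun f hf1 hf2 => (dvd_gcd hf1 hf2).trans (normalize_associated _).symm.dvd⟩,
    fun h1 h2 => h1.exists_sq_dvd hσ h2⟩

theorem isDivisorFamily_coeff_zero_ne :
    IsDivisorFamily (fun P : K[X] => P.Monic ∧ P.coeff 0 ≠ 0) := by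
  classical
  refine ⟨fun h => h.1, by simp, fun h1 h2 => ⟨h1.1.mul h2.1, ?_⟩, fun {P Q} h1 h2 =>
    ⟨h1.1.of_mul_monic_left h2.1, coeff_zero_ne_of_dvd (dvd_mul_left Q P) h2.2⟩,
    fun {P Q} h1 h2 => ⟨normalize (gcd P Q), ⟨monic_normalize
      (gcd_ne_zero_of_left h1.1.ne_zero), ?_⟩,
      (normalize_associated _).dvd.trans (gcd_dvd_left P Q),
      (normalize_associated _).dvd.trans (gcd_dvd_right P Q),
      fun f hf1 hf2 => (dvd_gcd hf1 hf2).trans (normalize_associated _).symm.dvd⟩, ?_⟩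
  · rw [mul_coeff_zero]; exact mul_ne_zero h1.2 h2.2
  · exact coeff_zero_ne_of_dvd ((normalize_associated _).dvd.trans (gcd_dvd_left P Q)) h1.2
  · intro P hP hsq
    have hex : ∃ f, Irreducible f ∧ f * f ∣ P := by
      by_contra! hc
      exact hsq ((squarefree_iff_irreducible_sq_not_dvd_of_ne_zero hP.1.ne_zero).2 hc)
    obtain ⟨f, hf, hfP⟩ := hex
    have ha := normalize_associated f
    refine ⟨normalize f, ⟨monic_normalize hf.ne_zero, coeff_zero_ne_of_dvd
      (ha.dvd.trans ((dvd_mul_right f f).trans hfP)) hP.2⟩, ?_, ?_⟩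
    · rw [natDegree_eq_of_degree_eq (degree_normalize)]
      exact hf.natDegree_pos
    · rw [sq]; exact (mul_dvd_mul ha.dvd ha.dvd).trans hfP

/-- Every member `P` of a divisor family is a product of coprime members `R` and `S`, where `S` is
squarefree and prime to `E`, and the degree of `R` is controlled by the largest square dividing
`P`. -/
theorem IsDivisorFamily.exists_coprime_factorization {F : K[X] → Prop} (hF : IsDivisorFamily F)
    {P E : K[X]} (hP : F P) (hE : F E) :
    ∃ D R S, F D ∧ F R ∧ F S ∧ D ^ 2 ∣ P ∧ P = R * S ∧ Squarefree S ∧ IsCoprime R S ∧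
      IsCoprime S E ∧ R.natDegree ≤ 3 * D.natDegree + E.natDegree ∧ (D = 1 → R ∣ E) := by
  classical
  let N : ℕ → Prop := fun k => ∃ D, F D ∧ D ^ 2 ∣ P ∧ D.natDegree = k
  have hb : ∀ k, N k → k ≤ P.natDegree := by
    rintro k ⟨D, hD, hDP, rfl⟩
    exact (natDegree_le_of_dvd ((dvd_pow_self D two_ne_zero).trans hDP) (hF.monic hP).ne_zero)
  have hN0 : N 0 := ⟨1, hF.one, by simp, by simp⟩
  obtain ⟨D, hD, hDP, hDk⟩ := Nat.findGreatest_spec (P := N) (Nat.zero_le _) hN0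
  have hmax : ∀ D', F D' → D' ^ 2 ∣ P → D'.natDegree ≤ D.natDegree := by
    intro D' h1 h2
    rw [hDk]
    exact Nat.le_findGreatest (hb _ ⟨D', h1, h2, rfl⟩) ⟨D', h1, h2, rfl⟩
  obtain ⟨T, hT⟩ := hDP
  have hD2 : F (D ^ 2) := by rw [sq]; exact hF.mul hD hD
  have hFT : F T := hF.of_mul hD2 (hT ▸ hP)
  have hTsq : Squarefree T := by
    by_contra hc
    obtain ⟨D', hD', hpos, hdvd⟩ := hF.exists_sq_dvd hFT hc
    have h1 := hmax (D * D') (hF.mul hD hD') (by rw [mul_pow, hT]; exact mul_dvd_mul_left _ hdvd)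
    rw [(hF.monic hD).natDegree_mul (hF.monic hD')] at h1
    omega
  obtain ⟨G, hG, hGT, hGD, hGmax⟩ := hF.exists_gcd hFT (hF.mul hD hE)
  obtain ⟨S, hS⟩ := hGT
  have hFS : F S := hF.of_mul hG (hS ▸ hFT)
  have hSsq : Squarefree S := hTsq.squarefree_of_dvd (hS ▸ dvd_mul_left S G)
  have hcop : IsCoprime S (D * E) := by
    refine isCoprime_of_irreducible_dvd (fun h => (hF.monic hFS).ne_zero h.1)
      fun f hf hf1 hf2 => hf.not_isUnit (hTsq f ?_)
    rw [hS]
    exact mul_dvd_mul (hGmax f (hS ▸ hf1.mul_left G) hf2) hf1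
  have hcopD : IsCoprime S D := hcop.of_mul_right_left
  have hcopG : IsCoprime S G := hcop.of_isCoprime_of_dvd_right hGD
  refine ⟨D, D ^ 2 * G, S, hD, hF.mul hD2 hG, hFS, ⟨T, hT⟩, by rw [hT, hS, mul_assoc], hSsq,
    ((hcopD.pow_right).mul_right hcopG).symm, hcop.of_mul_right_right, ?_, ?_⟩
  · have h1 := natDegree_le_of_dvd hGD (mul_ne_zero (hF.monic hD).ne_zero (hF.monic hE).ne_zero)
    rw [(hF.monic hD).natDegree_mul (hF.monic hE)] at h1
    rw [(hF.monic hD2).natDegree_mul (hF.monic hG), (hF.monic hD).natDegree_pow]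
    omega
  · rintro rfl
    simpa using hGD

end Family

/-! ### Counting elements of norm one modulo a self-dual polynomial -/

section WeightedDivisorSum

variable (K : Type*) [Field K] [Finite K]

theorem finite_natDegree_le (n : ℕ) : {P : K[X] | P.natDegree ≤ n}.Finite := by
  have : Finite (degreeLT K (n + 1)) :=
    Finite.of_equiv _ (degreeLTEquiv K (n + 1)).symm.toEquiv
  refine (Set.toFinite (degreeLT K (n + 1) : Set K[X])).subset fun P hP => ?_
  rw [SetLike.mem_coe, mem_degreeLT]
  exact degree_le_natDegree.trans_lt (by exact_mod_cast Nat.lt_succ_of_le hP)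

/-- The finite set of polynomials of degree at most `n` over a finite field. -/
def polysNatDegreeLE (n : ℕ) : Finset K[X] := (finite_natDegree_le K n).toFinset

variable {K}

@[simp]
theorem mem_polysNatDegreeLE {n : ℕ} {P : K[X]} :
    P ∈ polysNatDegreeLE K n ↔ P.natDegree ≤ n := by
  simp [polysNatDegreeLE]

open Classical in
/-- The sum of `s^{-deg D}` over the divisors `D` of `P` that satisfy `F`. -/
def weightedDivisorSum (F : K[X] → Prop) (s : ℝ) (P : K[X]) : ℝ :=
  ∑ D ∈ polysNatDegreeLE K P.natDegree with F D ∧ D ∣ P, (s ^ D.natDegree)⁻¹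

theorem one_le_weightedDivisorSum {F : K[X] → Prop} (hF : F 1) {s : ℝ} (hs : 0 ≤ s) (P : K[X]) :
    1 ≤ weightedDivisorSum F s P := by
  classical
  have h1 : (1 : K[X]) ∈ {D ∈ polysNatDegreeLE K P.natDegree | F D ∧ D ∣ P} := by simp [hF]
  have := Finset.single_le_sum (f := fun D : K[X] => (s ^ D.natDegree)⁻¹)
    (fun D _ => by positivity) h1
  simpa [weightedDivisorSum] using this

theorem weightedDivisorSum_le_of_dvd (F : K[X] → Prop) {s : ℝ} (hs : 0 ≤ s) {P Q : K[X]}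
    (h : P ∣ Q) (hQ : Q ≠ 0) : weightedDivisorSum F s P ≤ weightedDivisorSum F s Q := by
  classical
  refine Finset.sum_le_sum_of_subset_of_nonneg (fun D hD => ?_) fun D _ _ => by positivity
  simp only [Finset.mem_filter, mem_polysNatDegreeLE] at hD ⊢
  exact ⟨hD.1.trans (natDegree_le_of_dvd h hQ), hD.2.1, hD.2.2.trans h⟩

end WeightedDivisorSum

section QuotientInvolution

variable {K : Type*} [Field K] {σ : K →+* K} {S : K[X]}

theorem isUnit_root_of_coeff_zero_ne (h : S.coeff 0 ≠ 0) : IsUnit (AdjoinRoot.root S) := by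
  have h1 : (X : K[X]) * S.divX + C (S.coeff 0) = S := X_mul_divX_add S
  have h2 := congrArg (AdjoinRoot.mk S) h1
  rw [map_add, map_mul, AdjoinRoot.mk_X, AdjoinRoot.mk_self, AdjoinRoot.mk_C] at h2
  refine IsUnit.of_mul_eq_one (AdjoinRoot.mk S S.divX * AdjoinRoot.of S (-(S.coeff 0)⁻¹)) ?_
  have h3 : AdjoinRoot.of S (S.coeff 0) * AdjoinRoot.of S ((S.coeff 0)⁻¹) = 1 := by
    rw [← map_mul, mul_inv_cancel₀ h, map_one]
  rw [map_neg]
  linear_combination (-AdjoinRoot.of S ((S.coeff 0)⁻¹)) * h2 + h3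

/-- The involution of `K[x] / S` that extends `σ` and inverts `x`, for a self-dual `S`. -/
theorem exists_quotient_involution (hS : IsSelfDual σ S) :
    ∃ τ : AdjoinRoot S →+* AdjoinRoot S, (∀ c, τ (AdjoinRoot.of S c) = AdjoinRoot.of S (σ c)) ∧
      τ (AdjoinRoot.root S) * AdjoinRoot.root S = 1 := by
  obtain ⟨u, hu⟩ := isUnit_root_of_coeff_zero_ne hS.coeff_zero_ne
  let : Invertible (AdjoinRoot.root S) := ⟨(u⁻¹ : (AdjoinRoot S)ˣ), by simp [← hu], by simp [← hu]⟩
  have h0 : eval₂ ((AdjoinRoot.of S).comp σ) (⅟(AdjoinRoot.root S)) S = 0 := by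
    let : Invertible (⅟(AdjoinRoot.root S)) := invertibleInvOf
    rw [← eval₂_map, ← eval₂_reverse_eq_zero_iff, invOf_invOf]
    exact eval₂_eq_zero_of_dvd_of_eval₂_eq_zero _ _ hS.dvd_conjReverse (AdjoinRoot.eval₂_root S)
  refine ⟨AdjoinRoot.lift _ _ h0, fun c => by simp, by simp⟩

/-- The involution realizes `conjReverse` up to a power of `x`. -/
theorem mk_conjReverse {τ : AdjoinRoot S →+* AdjoinRoot S}
    (hτ : ∀ c, τ (AdjoinRoot.of S c) = AdjoinRoot.of S (σ c))
    (hroot : τ (AdjoinRoot.root S) * AdjoinRoot.root S = 1) (p : K[X]) :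
    AdjoinRoot.mk S (conjReverse σ p) =
      AdjoinRoot.root S ^ p.natDegree * τ (AdjoinRoot.mk S p) := by
  let : Invertible (τ (AdjoinRoot.root S)) := ⟨AdjoinRoot.root S, by rw [mul_comm, hroot], hroot⟩
  have h1 := eval₂_reverse_mul_pow (AdjoinRoot.of S) (τ (AdjoinRoot.root S)) (p.map σ)
  have h2 : eval₂ (AdjoinRoot.of S) (τ (AdjoinRoot.root S)) (p.map σ) =
      τ (AdjoinRoot.mk S p) := by
    rw [eval₂_map, ← AdjoinRoot.aeval_eq p, aeval_def, hom_eval₂]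
    congr 1
    ext c
    simp [hτ]
  rw [h2, natDegree_map] at h1
  have h3 : eval₂ (AdjoinRoot.of S) (⅟(τ (AdjoinRoot.root S))) (p.map σ).reverse =
      AdjoinRoot.mk S (conjReverse σ p) := by
    rw [← AdjoinRoot.aeval_eq (conjReverse σ p)]; rfl
  rw [← h1, h3, mul_comm, mul_assoc, ← mul_pow, hroot, one_pow, mul_one]

/-- The number of elements of norm one modulo a squarefree self-dual polynomial `S`. The ideals
in the bound of `card_norm_one_le_sum_ideals` correspond to the self-dual divisors of `S`. -/
theorem card_norm_one_le_weightedDivisorSum [Finite K] (hS : IsSelfDual σ S) (hsq : Squarefree S)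
    {τ : AdjoinRoot S →+* AdjoinRoot S}
    (hτ : ∀ c, τ (AdjoinRoot.of S c) = AdjoinRoot.of S (σ c))
    (hroot : τ (AdjoinRoot.root S) * AdjoinRoot.root S = 1)
    {t : AdjoinRoot S} (ht : IsUnit (t - τ t)) :
    (Nat.card {a : AdjoinRoot S // a * τ a = 1} : ℝ) ≤
      √(Nat.card K) ^ S.natDegree * weightedDivisorSum (IsSelfDual σ) √(Nat.card K) S := by
  classical
  have hS0 := hS.monic.ne_zero
  have : Module.Finite K (AdjoinRoot S) := (AdjoinRoot.powerBasis hS0).finite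
  have : Finite (AdjoinRoot S) := Module.finite_of_finite K
  have : IsReduced (AdjoinRoot S) :=
    (Ideal.isRadical_iff_quotient_reduced _).1 (isRadical_iff_span_singleton.1 hsq.isRadical)
  have : Finite (Ideal (AdjoinRoot S)) := Finite.of_injective _ SetLike.coe_injective
  have := Fintype.ofFinite (Ideal (AdjoinRoot S))
  refine (card_norm_one_le_sum_ideals τ ht).trans ?_
  set s : ℝ := √(Nat.card K) with hs
  have hspos : 0 < s := Real.sqrt_pos.2 (Nat.cast_pos.2 Nat.card_pos)
  have hexists : ∀ I : Ideal (AdjoinRoot S), ∃ T D : K[X], S = T * D ∧ T.Monic ∧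
      Ideal.comap (AdjoinRoot.mk S) I = Ideal.span {T} := by
    intro I
    obtain ⟨T, hT⟩ := (IsPrincipalIdealRing.principal (Ideal.comap (AdjoinRoot.mk S) I)).principal
    have hST : S ∈ Ideal.comap (AdjoinRoot.mk S) I := by simp [Ideal.mem_comap]
    have hT' : Ideal.comap (AdjoinRoot.mk S) I = Ideal.span {normalize T} := by
      rw [hT]
      exact (Ideal.span_singleton_eq_span_singleton.2 (normalize_associated T).symm)
    rw [hT', Ideal.mem_span_singleton] at hST
    obtain ⟨D, hD⟩ := hST
    refine ⟨normalize T, D, hD, monic_normalize ?_, hT'⟩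
    rintro rfl
    simp at hD
    exact hS0 hD
  choose T D hTD hTm hT using hexists
  have hcard : ∀ I, √(Nat.card (AdjoinRoot S ⧸ I) : ℝ) = s ^ (T I).natDegree := by
    intro I
    have h1 : Nat.card (AdjoinRoot S ⧸ I) = Nat.card K ^ (T I).natDegree := by
      let φ : K[X] →+* AdjoinRoot S ⧸ I := (Ideal.Quotient.mk I).comp (AdjoinRoot.mk S)
      have hφ : Function.Surjective φ :=
        Ideal.Quotient.mk_surjective.comp AdjoinRoot.mk_surjective
      have hker : RingHom.ker φ = Ideal.span {T I} := by
        rw [← hT I]; ext p; simp [φ, RingHom.mem_ker, Ideal.Quotient.eq_zero_iff_mem]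
      rw [← Nat.card_congr (RingHom.quotientKerEquivOfSurjective hφ).toEquiv, hker]
      have h2 : Module.Finite K (K[X] ⧸ Ideal.span {T I}) :=
        (AdjoinRoot.powerBasis (hTm I).ne_zero).finite
      rw [Module.natCard_eq_pow_finrank (K := K), finrank_quotient_span_eq_natDegree]
    rw [h1, Nat.cast_pow, Real.sqrt_eq_iff_mul_self_eq (by positivity) (by positivity), ← mul_pow,
      Real.mul_self_sqrt (by positivity)]
  have hDm : ∀ I, (D I).Monic := fun I => (hTm I).of_mul_monic_left (hTD I ▸ hS.monic)
  have hSD : ∀ I, (∀ b ∈ I, τ b ∈ I) → IsSelfDual σ (D I) := by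
    intro I hI
    have hTI : AdjoinRoot.mk S (T I) ∈ I := by
      rw [← Ideal.mem_comap, hT]; exact Ideal.mem_span_singleton_self _
    have h1 : conjReverse σ (T I) ∈ Ideal.comap (AdjoinRoot.mk S) I := by
      rw [Ideal.mem_comap, mk_conjReverse hτ hroot]
      exact I.mul_mem_left _ (hI _ hTI)
    rw [hT, Ideal.mem_span_singleton] at h1
    have h2 : IsSelfDual σ (T I) :=
      ⟨hTm I, coeff_zero_ne_of_dvd ⟨_, hTD I⟩ hS.coeff_zero_ne, h1⟩
    exact h2.of_mul (hTD I ▸ hS)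
  have hinj : Function.Injective D := by
    intro I J hIJ
    have h1 : T I = T J := by
      have h2 := (hTD I).symm.trans (hTD J)
      rw [hIJ] at h2
      exact mul_right_cancel₀ (hDm J).ne_zero h2
    have h3 : Ideal.comap (AdjoinRoot.mk S) I = Ideal.comap (AdjoinRoot.mk S) J := by
      rw [hT, hT, h1]
    exact Ideal.comap_injective_of_surjective _ AdjoinRoot.mk_surjective h3
  rw [weightedDivisorSum, Finset.mul_sum]
  refine le_trans (le_of_eq ?_) (Finset.sum_le_sum_of_subset_of_nonneg
    (s := Finset.image D {I : Ideal (AdjoinRoot S) | ∀ b ∈ I, τ b ∈ I}) ?_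
    fun _ _ _ => by positivity)
  · rw [Finset.sum_image (fun a _ b _ h => hinj h)]
    refine Finset.sum_congr rfl fun I _ => ?_
    rw [hcard I, eq_mul_inv_iff_mul_eq₀ (by positivity), ← pow_add,
      ← (hTm I).natDegree_mul (hDm I), ← hTD I]
  · intro E hE
    obtain ⟨I, hI, rfl⟩ := Finset.mem_image.1 hE
    have hdvd : D I ∣ S := ⟨T I, by rw [mul_comm]; exact hTD I⟩
    simp only [Finset.mem_filter, mem_polysNatDegreeLE]
    exact ⟨natDegree_le_of_dvd hdvd hS0, hSD I (by simpa using hI), hdvd⟩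

end QuotientInvolution

/-! ### Isometries commuting with a given isometry -/

section Isometries

variable {K V : Type*} [Field K] [AddCommGroup V] [Module K V] [FiniteDimensional K V]
  {σ : K →+* K} {B : V →ₗ[K] V →ₛₗ[σ] K} {g : Module.End K V}

/-- The action of `K[x] / S` on a space with an endomorphism `g` such that `S(g) = 0`. -/
def adjoinRootToEnd {S : K[X]} (h : aeval g S = 0) : AdjoinRoot S →+* Module.End K V :=
  Ideal.Quotient.lift (Ideal.span {S}) (aeval g).toRingHom fun a ha => by
    obtain ⟨b, rfl⟩ := Ideal.mem_span_singleton.1 ha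
    simp [h]

omit [FiniteDimensional K V] in
@[simp]
theorem adjoinRootToEnd_mk {S : K[X]} (h : aeval g S = 0) (p : K[X]) :
    adjoinRootToEnd h (AdjoinRoot.mk S p) = aeval g p := rfl

omit [FiniteDimensional K V] in
/-- The involution of `K[x] / S` is the adjunction with respect to a form preserved by `g`. -/
theorem apply_adjoinRootToEnd (hg : ∀ v w, B (g v) (g w) = B v w) {S : K[X]}
    (h : aeval g S = 0) {τ : AdjoinRoot S →+* AdjoinRoot S}
    (hτ : ∀ c, τ (AdjoinRoot.of S c) = AdjoinRoot.of S (σ c))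
    (hroot : τ (AdjoinRoot.root S) * AdjoinRoot.root S = 1) (a : AdjoinRoot S) (v w : V) :
    B v (adjoinRootToEnd h a w) = B (adjoinRootToEnd h (τ a) v) w := by
  have hmul : ∀ a b : AdjoinRoot S,
      (∀ v w, B v (adjoinRootToEnd h a w) = B (adjoinRootToEnd h (τ a) v) w) →
      (∀ v w, B v (adjoinRootToEnd h b w) = B (adjoinRootToEnd h (τ b) v) w) →
      ∀ v w, B v (adjoinRootToEnd h (a * b) w) = B (adjoinRootToEnd h (τ (a * b)) v) w := by
    intro a b ha hb v w
    rw [map_mul, Module.End.mul_apply, ha, hb, mul_comm a b, map_mul, map_mul,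
      Module.End.mul_apply]
  have hof : ∀ (c : K) (v : V), adjoinRootToEnd h (AdjoinRoot.of S c) v = c • v := by
    intro c v
    rw [← AdjoinRoot.mk_C, adjoinRootToEnd_mk, aeval_C, Module.algebraMap_end_apply]
  have hC : ∀ c v w, B v (adjoinRootToEnd h (AdjoinRoot.of S c) w) =
      B (adjoinRootToEnd h (τ (AdjoinRoot.of S c)) v) w := by
    intro c v w
    rw [hτ, hof, hof]
    simp
  have hX : ∀ v w, B v (adjoinRootToEnd h (AdjoinRoot.root S) w) =
      B (adjoinRootToEnd h (τ (AdjoinRoot.root S)) v) w := by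
    intro v w
    have h1 : ∀ v, adjoinRootToEnd h (AdjoinRoot.root S) v = g v := by
      intro v
      rw [← AdjoinRoot.mk_X, adjoinRootToEnd_mk, aeval_X]
    have h2 : g (adjoinRootToEnd h (τ (AdjoinRoot.root S)) v) = v := by
      rw [← h1, ← Module.End.mul_apply, ← map_mul, mul_comm, hroot, map_one, Module.End.one_apply]
    rw [h1, ← hg (adjoinRootToEnd h (τ (AdjoinRoot.root S)) v), h2]
  induction a using AdjoinRoot.induction_on with
  | ih p =>
    induction p using Polynomial.induction_on generalizing v w with
    | C c => rw [AdjoinRoot.mk_C]; exact hC c v w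
    | add p q hp hq => simp only [map_add, LinearMap.add_apply, hp, hq]
    | monomial n c ih =>
      rw [pow_succ, ← mul_assoc, map_mul, AdjoinRoot.mk_X]
      exact hmul _ _ ih hX v w

/-- Isometries commuting with an isometry `g` whose characteristic polynomial `S` is squarefree:
they are the elements of norm one of `K[g] = K[x] / S`. -/
theorem card_commuting_isometries_le [Finite K]
    (hB : ∀ v, (∀ w, B v w = 0) → v = 0) (hg : ∀ v w, B (g v) (g w) = B v w)
    (hS : IsSelfDual σ g.charpoly) (hsq : Squarefree g.charpoly)
    (ht : (∃ c, σ c ≠ c) ∨ IsCoprime g.charpoly (X ^ 2 - 1)) :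
    (Nat.card {h : Module.End K V // Commute h g ∧ ∀ v w, B (h v) (h w) = B v w} : ℝ) ≤
      √(Nat.card K) ^ g.charpoly.natDegree *
        weightedDivisorSum (IsSelfDual σ) √(Nat.card K) g.charpoly := by
  obtain ⟨τ, hτ, hroot⟩ := exists_quotient_involution hS
  have hS0 := hS.monic.ne_zero
  have : Module.Finite K (AdjoinRoot g.charpoly) := (AdjoinRoot.powerBasis hS0).finite
  have : Finite (AdjoinRoot g.charpoly) := Module.finite_of_finite K
  have htt : ∃ t, IsUnit (t - τ t) := by
    rcases ht with ⟨c, hc⟩ | hcop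
    · refine ⟨AdjoinRoot.of _ c, ?_⟩
      rw [hτ, ← map_sub]
      exact (IsUnit.mk0 _ (sub_ne_zero.2 (Ne.symm hc))).map _
    · refine ⟨AdjoinRoot.root _, ?_⟩
      obtain ⟨a, b, hab⟩ := hcop
      have h1 := congrArg (AdjoinRoot.mk g.charpoly) hab
      simp only [map_add, map_mul, AdjoinRoot.mk_self, mul_zero, zero_add, map_sub, map_pow,
        AdjoinRoot.mk_X, map_one] at h1
      refine IsUnit.of_mul_eq_one (AdjoinRoot.mk _ b * AdjoinRoot.root _) ?_
      linear_combination h1 - AdjoinRoot.mk g.charpoly b * hroot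
  obtain ⟨t, ht⟩ := htt
  refine le_trans ?_ (card_norm_one_le_weightedDivisorSum hS hsq hτ hroot ht)
  have h0 := g.aeval_self_charpoly
  choose p hp using fun h : {h : Module.End K V // Commute h g ∧
    ∀ v w, B (h v) (h w) = B v w} => exists_aeval_eq_of_commute g hsq h.2.1
  rw [Nat.cast_le]
  refine Nat.card_le_card_of_injective (fun h => ⟨AdjoinRoot.mk _ (p h), ?_⟩) fun h h' hh => ?_
  · set a := AdjoinRoot.mk g.charpoly (p h)
    have ha : adjoinRootToEnd h0 a = h.1 := (hp h).symm
    have h1 : adjoinRootToEnd h0 (a * τ a) = 1 := by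
      ext v
      rw [Module.End.one_apply, ← sub_eq_zero]
      refine hB _ fun w => ?_
      rw [map_sub, LinearMap.sub_apply, sub_eq_zero, mul_comm, map_mul,
        Module.End.mul_apply, ← apply_adjoinRootToEnd hg h0 hτ hroot, ha, h.2.2]
    obtain ⟨r, hr⟩ := AdjoinRoot.mk_surjective (a * τ a)
    rw [← hr, adjoinRootToEnd_mk] at h1
    have h2 : minpoly K g ∣ r - 1 := minpoly.dvd K g (by simp [h1])
    rw [minpoly_eq_charpoly_of_squarefree g hsq, ← AdjoinRoot.mk_eq_zero, map_sub, hr, map_one,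
      sub_eq_zero] at h2
    exact h2
  · have h1 := congrArg (adjoinRootToEnd h0) (Subtype.mk.inj hh)
    rw [adjoinRootToEnd_mk, adjoinRootToEnd_mk, ← hp, ← hp] at h1
    exact Subtype.ext h1

omit [FiniteDimensional K V] in
theorem apply_pow_natDegree_aeval (hg : ∀ v w, B (g v) (g w) = B v w) (p : K[X]) (v w : V) :
    B ((g ^ p.natDegree) v) (aeval g p w) = B (aeval g (conjReverse σ p) v) w := by
  have hpow : ∀ (n : ℕ) v w, B ((g ^ n) v) ((g ^ n) w) = B v w := by
    intro n
    induction n with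
    | zero => simp
    | succ n ih => intro v w; rw [pow_succ', Module.End.mul_apply, Module.End.mul_apply, hg, ih]
  have hlt : (conjReverse σ p).natDegree < p.natDegree + 1 :=
    Nat.lt_succ_of_le ((reverse_natDegree_le _).trans (natDegree_map_le))
  rw [aeval_eq_sum_range, aeval_eq_sum_range' hlt, LinearMap.sum_apply, LinearMap.sum_apply,
    map_sum, map_sum, LinearMap.sum_apply, ← Finset.sum_range_reflect]
  refine Finset.sum_congr rfl fun i hi => ?_
  have hi' : i ≤ p.natDegree := Nat.lt_succ_iff.1 (Finset.mem_range.1 hi)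
  have h1 : p.natDegree + 1 - 1 - i = p.natDegree - i := by omega
  rw [h1, conjReverse, coeff_reverse, natDegree_map, revAt_le hi', coeff_map]
  have h2 : (g ^ p.natDegree) v = (g ^ (p.natDegree - i)) ((g ^ i) v) := by
    rw [← Module.End.mul_apply, ← pow_add, Nat.sub_add_cancel hi']
  simp [h2, hpow]

omit [FiniteDimensional K V] in
/-- The kernels of `R(g)` and `S(g)` are orthogonal if `R` is self-dual and prime to `S`. -/
theorem apply_eq_zero_of_mem_ker_aeval (hg : ∀ v w, B (g v) (g w) = B v w) {R S : K[X]}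
    (hR : IsSelfDual σ R) (hRS : IsCoprime R S) {v w : V} (hv : aeval g S v = 0)
    (hw : aeval g R w = 0) : B v w = 0 := by
  obtain ⟨a, b, hab⟩ := hRS
  have h1 : aeval g R (aeval g a v) = v := by
    have h2 := congrArg (fun p => aeval g p v) hab
    simp only [map_add, map_mul, LinearMap.add_apply, Module.End.mul_apply, hv, map_zero,
      add_zero, map_one, Module.End.one_apply] at h2
    rw [← Module.End.mul_apply, ← map_mul, mul_comm, map_mul, Module.End.mul_apply]
    exact h2
  obtain ⟨c, hc⟩ := hR.associated
  have h3 := apply_pow_natDegree_aeval hg R (aeval g a v) w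
  rw [hw, map_zero, ← hc, mul_comm, map_mul, Module.End.mul_apply, h1] at h3
  obtain ⟨k, hk, hk'⟩ := isUnit_iff.1 c.isUnit
  rw [← hk', aeval_C, Module.algebraMap_end_apply, map_smul, LinearMap.smul_apply,
    smul_eq_mul] at h3
  exact (mul_eq_zero.1 h3.symm).resolve_left hk.ne_zero

theorem finrank_ker_aeval {R S : K[X]} (hRS : IsCoprime R S)
    (hR : R.Monic) (hS : S.Monic) (h : g.charpoly = R * S) :
    Module.finrank K (LinearMap.ker (aeval g R)) = R.natDegree := by
  rw [← LinearMap.charpoly_natDegree (g.restrict (map_mem_ker_aeval (Commute.refl g) R)),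
    (charpoly_restrict_ker_aeval g hRS hR hS h).1]

/-- Isometries commuting with an isometry `g` whose characteristic polynomial is `R S`, with `R`
and `S` coprime and `S` squarefree, are determined by their restrictions to the kernels of `R(g)`
and `S(g)`. -/
theorem card_isometries_le_mul [Finite K] (hg : ∀ v w, B (g v) (g w) = B v w)
    {R S : K[X]} (hR : IsSelfDual σ R) (hS : IsSelfDual σ S) (hsq : Squarefree S)
    (hRS : IsCoprime R S) (hχ : g.charpoly = R * S)
    (ht : (∃ c, σ c ≠ c) ∨ IsCoprime S (X ^ 2 - 1))
    (hB : ∀ v, aeval g S v = 0 → (∀ w, B v w = 0) → v = 0)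
    {H : Type*} (f : H → Module.End K V) (hf : Function.Injective f)
    (hfg : ∀ x, Commute (f x) g) (hfB : ∀ x v w, B (f x v) (f x w) = B v w) :
    (Nat.card H : ℝ) ≤
      (Set.range fun x => (f x).domRestrict (LinearMap.ker (aeval g R))).ncard *
      (√(Nat.card K) ^ S.natDegree * weightedDivisorSum (IsSelfDual σ) √(Nat.card K) S) := by
  set U := LinearMap.ker (aeval g R)
  set W := LinearMap.ker (aeval g S)
  have hc : IsCompl U W := isCompl_ker_aeval g hRS (hχ ▸ g.aeval_self_charpoly)
  let gW : Module.End K W := g.restrict (map_mem_ker_aeval (Commute.refl g) S)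
  have hgW : gW.charpoly = S :=
    (charpoly_restrict_ker_aeval g hRS hR.monic hS.monic hχ).2
  let BW : W →ₗ[K] W →ₛₗ[σ] K := B.domRestrict₁₂ W W
  have : Finite V := Module.finite_of_finite K
  have h1 := card_commuting_isometries_le (B := BW) (g := gW) (fun v hv => ?_)
    (fun v w => hg v w) (hgW ▸ hS) (hgW ▸ hsq) (hgW ▸ ht)
  · rw [hgW] at h1
    refine le_trans ?_ (mul_le_mul_of_nonneg_left h1 (Nat.cast_nonneg _))
    rw [← Nat.card_coe_set_eq, ← Nat.cast_mul, ← Nat.card_prod, Nat.cast_le]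
    have : Finite (U →ₗ[K] V) := Module.finite_of_finite K
    have : Finite (Module.End K W) := Module.finite_of_finite K
    refine Nat.card_le_card_of_injective (fun x => (⟨_, ⟨x, rfl⟩⟩,
      ⟨(f x).restrict (map_mem_ker_aeval (hfg x) S), LinearMap.ext fun v => Subtype.ext
        (congrArg (fun k : Module.End K V => k v) (hfg x).eq), fun v w => hfB x v w⟩))
      fun x y hxy => hf (LinearMap.ext fun v => ?_)
    obtain ⟨v, rfl⟩ := (Submodule.prodEquivOfIsCompl U W hc).surjective v
    simp only [Prod.mk.injEq, Subtype.mk.injEq] at hxy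
    have h2 := LinearMap.congr_fun (Subtype.mk.inj hxy.1) v.1
    have h3 := congrArg Subtype.val (LinearMap.congr_fun hxy.2 v.2)
    simp only [LinearMap.domRestrict_apply] at h2
    simp only [LinearMap.coe_restrict_apply] at h3
    simp [h2, h3]
  · refine Subtype.ext (hB v v.2 fun w => ?_)
    obtain ⟨w, rfl⟩ := (Submodule.prodEquivOfIsCompl U W hc).surjective w
    have h2 : B v w.1 = 0 := apply_eq_zero_of_mem_ker_aeval hg hR hRS v.2 w.1.2
    have h3 : B v w.2 = 0 := hv w.2
    simp [h2, h3]

/-- The number of restrictions to the kernel of `R(g)` of endomorphisms commuting with `g`. -/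
theorem ncard_range_domRestrict_le [Finite K] {R S : K[X]} (hRS : IsCoprime R S)
    (hR : R.Monic) (hS : S.Monic) (h : g.charpoly = R * S)
    {H : Type*} (f : H → Module.End K V) (hfg : ∀ x, Commute (f x) g) :
    (Set.range fun x => (f x).domRestrict (LinearMap.ker (aeval g R))).ncard ≤
      Nat.card K ^ R.natDegree ^ 2 := by
  set U := LinearMap.ker (aeval g R) with hU
  have : Finite (Module.End K U) := Module.finite_of_finite K
  have : Finite V := Module.finite_of_finite K
  have h1 : Nat.card (Module.End K U) = Nat.card K ^ R.natDegree ^ 2 := by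
    rw [Module.natCard_eq_pow_finrank (K := K), Module.finrank_linearMap,
      finrank_ker_aeval hRS hR hS h, sq]
  rw [← h1, ← Set.ncard_univ]
  refine (Set.ncard_le_ncard ?_ (Set.toFinite _)).trans
    (Set.ncard_image_le (f := fun k : Module.End K U => U.subtype ∘ₗ k) (Set.toFinite _))
  rintro _ ⟨x, rfl⟩
  exact ⟨(f x).restrict (map_mem_ker_aeval (hfg x) R), trivial, rfl⟩

end Isometries

/-! ### Determinants of polynomials in a cyclic endomorphism -/

section Determinant

variable {K V : Type*} [Field K] [AddCommGroup V] [Module K V] [FiniteDimensional K V]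

/-- For a cyclic endomorphism `g` with characteristic polynomial `f`, the determinant on `K[g]` is
the norm of `K[x] / f`. -/
theorem det_aeval_eq_norm (g : Module.End K V) (hf : Squarefree g.charpoly) (p : K[X]) :
    LinearMap.det (aeval g p) = Algebra.norm K (AdjoinRoot.mk g.charpoly p) := by
  obtain ⟨u, hu, hu'⟩ := exists_cyclic_vector g hf
  let ψ : AdjoinRoot g.charpoly →ₗ[K] V :=
    { toFun := fun a => adjoinRootToEnd g.aeval_self_charpoly a u
      map_add' := fun a b => by simp
      map_smul' := fun c a => by
        rw [Algebra.smul_def, AdjoinRoot.algebraMap_eq, map_mul, ← AdjoinRoot.mk_C,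
          adjoinRootToEnd_mk, aeval_C, Module.End.mul_apply, Module.algebraMap_end_apply,
          RingHom.id_apply] }
  have hψ : Function.Bijective ψ := by
    constructor
    · rw [← LinearMap.ker_eq_bot, LinearMap.ker_eq_bot']
      intro a ha
      obtain ⟨r, rfl⟩ := AdjoinRoot.mk_surjective a
      exact AdjoinRoot.mk_eq_zero.2 ((hu r).1 ha)
    · intro w
      obtain ⟨r, hr⟩ := hu' w
      exact ⟨AdjoinRoot.mk _ r, hr⟩
  let e := LinearEquiv.ofBijective ψ hψ
  rw [Algebra.norm_apply, ← LinearMap.det_conj _ e]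
  congr 1
  ext w
  obtain ⟨a, rfl⟩ := e.surjective w
  obtain ⟨r, rfl⟩ := AdjoinRoot.mk_surjective a
  simp only [LinearMap.comp_apply, LinearEquiv.coe_coe, LinearEquiv.symm_apply_apply]
  change aeval g p (aeval g r u) = adjoinRootToEnd g.aeval_self_charpoly
    (AdjoinRoot.mk _ p * AdjoinRoot.mk _ r) u
  rw [map_mul]; rfl

/-- The determinant is surjective on `K[g]` for finite `K`: on the kernel of `f(g)`, for an
irreducible factor `f` of the characteristic polynomial, it is the norm of a finite field. -/
theorem exists_det_aeval_eq [Finite K] (g : Module.End K V) (hsq : Squarefree g.charpoly)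
    (hpos : 0 < Module.finrank K V) (t : K) : ∃ p : K[X], LinearMap.det (aeval g p) = t := by
  classical
  have hnu : ¬ IsUnit g.charpoly := by
    intro h
    have := natDegree_eq_zero_of_isUnit h
    rw [g.charpoly_natDegree] at this
    omega
  obtain ⟨f₀, hf₀, hf₀d⟩ := WfDvdMonoid.exists_irreducible_factor hnu g.charpoly_monic.ne_zero
  have ha := normalize_associated f₀
  set f := normalize f₀
  have hf : Irreducible f := ha.symm.irreducible hf₀
  have hfm : f.Monic := monic_normalize hf₀.ne_zero
  obtain ⟨f', hf'⟩ := ha.dvd.trans hf₀d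
  have hfm' : f'.Monic := hfm.of_mul_monic_left (hf' ▸ g.charpoly_monic)
  have hcop : IsCoprime f f' := by
    refine hf.coprime_iff_not_dvd.2 fun hd => hf.not_isUnit (hsq f ?_)
    rw [hf']; exact mul_dvd_mul_left f hd
  have hU := map_mem_ker_aeval (Commute.refl g) f
  have hχU : (g.restrict hU).charpoly = f :=
    (charpoly_restrict_ker_aeval g hcop hfm hfm' hf').1
  have : Fact (Irreducible (g.restrict hU).charpoly) := ⟨by rw [hχU]; exact hf⟩
  have : Module.Finite K (AdjoinRoot (g.restrict hU).charpoly) :=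
    (AdjoinRoot.powerBasis (LinearMap.charpoly_monic _).ne_zero).finite
  have : Finite (AdjoinRoot (g.restrict hU).charpoly) := Module.finite_of_finite K
  obtain ⟨a, hat⟩ := FiniteField.norm_surjective K (AdjoinRoot (g.restrict hU).charpoly) t
  obtain ⟨r, rfl⟩ := AdjoinRoot.mk_surjective a
  rw [← det_aeval_eq_norm _ (by rw [hχU]; exact hf.squarefree)] at hat
  obtain ⟨α, β, hαβ⟩ := id hcop
  -- `r` modulo `f` and `1` modulo the cofactor
  let p := r * (β * f') + α * f
  have hc := isCompl_ker_aeval g hcop (hf' ▸ g.aeval_self_charpoly)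
  have hpU := map_mem_ker_aeval (commute_aeval (Commute.refl g) p).symm f
  have hpW := map_mem_ker_aeval (commute_aeval (Commute.refl g) p).symm f'
  refine ⟨p, ?_⟩
  rw [det_eq_mul_of_isCompl (aeval g p) hc hpU hpW]
  have h1 : (aeval g p).restrict hpU = aeval (g.restrict hU) r := by
    ext x
    have hx : aeval g f x.1 = 0 := x.2
    rw [aeval_restrict_apply, LinearMap.coe_restrict_apply]
    have h2 : p = r + (α - r * α) * f := by linear_combination r * hαβ
    rw [h2, map_add, map_mul, LinearMap.add_apply, Module.End.mul_apply, hx, map_zero, add_zero]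
  have h3 : (aeval g p).restrict hpW = LinearMap.id := by
    ext x
    have hx : aeval g f' x.1 = 0 := x.2
    rw [LinearMap.coe_restrict_apply, LinearMap.id_apply]
    have h2 : p = 1 + (r * β - β) * f' := by linear_combination hαβ
    rw [h2, map_add, map_mul, LinearMap.add_apply, Module.End.mul_apply, hx, map_zero, add_zero,
      map_one, Module.End.one_apply]
  rw [h1, h3, LinearMap.det_id, mul_one, hat]

end Determinant

/-! ### Counting monic and self-dual polynomials -/

section Slices

variable {K : Type*} [Field K] [Finite K]

open Classical in
/-- The polynomials of degree `m` with constant term `c` that satisfy `F`. -/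
def slice (F : K[X] → Prop) (m : ℕ) (c : K) : Finset K[X] :=
  {P ∈ polysNatDegreeLE K m | F P ∧ P.natDegree = m ∧ P.coeff 0 = c}

@[simp]
theorem mem_slice {F : K[X] → Prop} {m : ℕ} {c : K} {P : K[X]} :
    P ∈ slice F m c ↔ F P ∧ P.natDegree = m ∧ P.coeff 0 = c := by
  simp only [slice, Finset.mem_filter, mem_polysNatDegreeLE]
  exact ⟨fun h => h.2, fun h => ⟨h.2.1.le, h⟩⟩

omit [Field K] [Finite K] in
theorem natCard_fun_finset (I : Finset ℕ) : Nat.card (I → K) = Nat.card K ^ I.card := by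
  rw [Nat.card_fun, Nat.card_eq_finsetCard]

omit [Finite K] in
theorem Polynomial.Monic.eq_of_coeff_Ioo {P Q : K[X]} {m : ℕ} (hP : P.Monic) (hQ : Q.Monic)
    (hPm : P.natDegree = m) (hQm : Q.natDegree = m) (h0 : P.coeff 0 = Q.coeff 0)
    (h : ∀ i, 0 < i → i < m → P.coeff i = Q.coeff i) : P = Q := by
  ext i
  rcases Nat.eq_zero_or_pos i with rfl | hi
  · exact h0
  rcases lt_trichotomy i m with hlt | rfl | hgt
  · exact h i hi hlt
  · have h1 := hP.coeff_natDegree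
    have h2 := hQ.coeff_natDegree
    rw [hPm] at h1
    rw [hQm] at h2
    rw [h1, h2]
  · rw [coeff_eq_zero_of_natDegree_lt (hPm ▸ hgt), coeff_eq_zero_of_natDegree_lt (hQm ▸ hgt)]

theorem card_slice_monic_le (m : ℕ) (c : K) :
    (slice (fun P : K[X] => P.Monic ∧ P.coeff 0 ≠ 0) m c).card ≤ Nat.card K ^ (m - 1) := by
  have h1 : Nat.card (Finset.Ioo 0 m → K) = Nat.card K ^ (m - 1) := by
    rw [natCard_fun_finset, Nat.card_Ioo]; rfl
  rw [← h1, ← Nat.card_eq_finsetCard]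
  refine Nat.card_le_card_of_injective
    (fun P (i : Finset.Ioo 0 m) => P.1.coeff i) fun P Q h => ?_
  have hP := mem_slice.1 P.2
  have hQ := mem_slice.1 Q.2
  refine Subtype.ext (hP.1.1.eq_of_coeff_Ioo hQ.1.1 hP.2.1 hQ.2.1 (hP.2.2.trans hQ.2.2.symm) ?_)
  intro i hi him
  exact congrFun h ⟨i, Finset.mem_Ioo.2 ⟨hi, him⟩⟩

/-- A self-dual polynomial with a given constant term is determined by the lower half of its
coefficients. -/
theorem card_slice_selfDual_id_le (m : ℕ) (c : K) :
    (slice (IsSelfDual (RingHom.id K)) m c).card ≤ Nat.card K ^ (m / 2) := by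
  have h1 : Nat.card (Finset.Icc 1 (m / 2) → K) = Nat.card K ^ (m / 2) := by
    rw [natCard_fun_finset, Nat.card_Icc]; rfl
  rw [← h1, ← Nat.card_eq_finsetCard]
  refine Nat.card_le_card_of_injective
    (fun P (i : Finset.Icc 1 (m / 2)) => P.1.coeff i) fun P Q h => ?_
  have hP := mem_slice.1 P.2
  have hQ := mem_slice.1 Q.2
  have hlow : ∀ i, 0 < i → i ≤ m / 2 → P.1.coeff i = Q.1.coeff i :=
    fun i hi him => congrFun h ⟨i, Finset.mem_Icc.2 ⟨hi, him⟩⟩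
  refine Subtype.ext (hP.1.monic.eq_of_coeff_Ioo hQ.1.monic hP.2.1 hQ.2.1
    (hP.2.2.trans hQ.2.2.symm) fun i hi him => ?_)
  rcases le_or_gt i (m / 2) with hle | hgt
  · exact hlow i hi hle
  · have h2 := hP.1.coeff_eq (i := m - i) (by rw [hP.2.1]; omega)
    have h3 := hQ.1.coeff_eq (i := m - i) (by rw [hQ.2.1]; omega)
    rw [hP.2.1, hP.2.2, Nat.sub_sub_self him.le, hlow (m - i) (by omega) (by omega)] at h2
    rw [hQ.2.1, hQ.2.2, Nat.sub_sub_self him.le] at h3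
    exact h2.trans h3.symm

/-- Two self-dual polynomials `P`, `P'` with a given constant term are determined by `P + t P'`,
for `t` not fixed by `σ`. -/
theorem card_slice_selfDual_sq_le {σ : K →+* K} {t : K} (ht : σ t ≠ t) {m : ℕ} (hm : 1 ≤ m)
    (c : K) : (slice (IsSelfDual σ) m c).card ^ 2 ≤ Nat.card K ^ (m - 1) := by
  have h1 : Nat.card (Finset.Ioo 0 m → K) = Nat.card K ^ (m - 1) := by
    rw [natCard_fun_finset, Nat.card_Ioo]; rfl
  rw [← h1, ← Nat.card_eq_finsetCard, sq, ← Nat.card_prod]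
  refine Nat.card_le_card_of_injective
    (fun P (i : Finset.Ioo 0 m) => P.1.1.coeff i + t * P.2.1.coeff i) ?_
  rintro ⟨⟨P, hP⟩, ⟨P', hP'⟩⟩ ⟨⟨Q, hQ⟩, ⟨Q', hQ'⟩⟩ h
  rw [mem_slice] at hP hP' hQ hQ'
  have hi : ∀ i, 0 < i → i < m → P.coeff i + t * P'.coeff i = Q.coeff i + t * Q'.coeff i :=
    fun i hi him => congrFun h ⟨i, Finset.mem_Ioo.2 ⟨hi, him⟩⟩
  have hc : c ≠ 0 := hP.2.2 ▸ hP.1.coeff_zero_ne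
  have hrefl : ∀ R, (IsSelfDual σ R ∧ R.natDegree = m ∧ R.coeff 0 = c) → ∀ i, i < m →
      σ (R.coeff (m - i)) = σ c * R.coeff i := by
    rintro R ⟨hR, rfl, rfl⟩ i hi
    exact hR.coeff_eq hi.le
  have key : ∀ i, 0 < i → i < m → P.coeff i = Q.coeff i ∧ P'.coeff i = Q'.coeff i := by
    intro i h0 him
    have e1 := congrArg σ (hi (m - i) (by omega) (by omega))
    simp only [map_add, map_mul, hrefl P hP i him, hrefl P' hP' i him, hrefl Q hQ i him,
      hrefl Q' hQ' i him] at e1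
    have e2 := hi i h0 him
    have e3 : (σ c * (σ t - t)) * (P'.coeff i - Q'.coeff i) = 0 := by
      linear_combination e1 - σ c * e2
    have e4 := sub_eq_zero.1 ((mul_eq_zero.1 e3).resolve_left
      (mul_ne_zero ((map_ne_zero σ).2 hc) (sub_ne_zero.2 ht)))
    exact ⟨by rw [e4] at e2; exact add_right_cancel e2, e4⟩
  simp only [Prod.mk.injEq, Subtype.mk.injEq]
  exact ⟨hP.1.monic.eq_of_coeff_Ioo hQ.1.monic hP.2.1 hQ.2.1 (hP.2.2.trans hQ.2.2.symm)
      fun i h0 him => (key i h0 him).1,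
    hP'.1.monic.eq_of_coeff_Ioo hQ'.1.monic hP'.2.1 hQ'.2.1 (hP'.2.2.trans hQ'.2.2.symm)
      fun i h0 him => (key i h0 him).2⟩

/-- The monic polynomial of degree `n` with constant term `e` and middle coefficients `b`. -/
def monicOfCoeffs (n : ℕ) (e : K) (b : ℕ → K) : K[X] :=
  X ^ n + ∑ i ∈ Finset.range n, C (if i = 0 then e else b i) * X ^ i

omit [Finite K] in
theorem degree_sum_lt (n : ℕ) (b : ℕ → K) :
    (∑ i ∈ Finset.range n, C (b i) * X ^ i : K[X]).degree < n := by
  rw [← mem_degreeLT]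
  refine Submodule.sum_mem _ fun i hi => ?_
  rw [mem_degreeLT]
  exact (degree_C_mul_X_pow_le _ _).trans_lt (by exact_mod_cast Finset.mem_range.1 hi)

omit [Finite K] in
theorem monic_monicOfCoeffs (n : ℕ) (e : K) (b : ℕ → K) : (monicOfCoeffs n e b).Monic :=
  monic_X_pow_add (degree_sum_lt n _)

omit [Finite K] in
theorem natDegree_monicOfCoeffs (n : ℕ) (e : K) (b : ℕ → K) :
    (monicOfCoeffs n e b).natDegree = n := by
  rw [monicOfCoeffs, natDegree_add_eq_left_of_degree_lt, natDegree_X_pow]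
  rw [degree_X_pow]
  exact degree_sum_lt n _

omit [Finite K] in
theorem coeff_monicOfCoeffs {n : ℕ} {e : K} {b : ℕ → K} {i : ℕ} (h0 : 0 < i) (hi : i < n) :
    (monicOfCoeffs n e b).coeff i = b i := by
  simp [monicOfCoeffs, coeff_X_pow, hi.ne, h0.ne', hi]

omit [Finite K] in
theorem coeff_zero_monicOfCoeffs {n : ℕ} (hn : 0 < n) {e : K} {b : ℕ → K} :
    (monicOfCoeffs n e b).coeff 0 = e := by
  simp [monicOfCoeffs, coeff_X_pow, hn.ne, hn]

omit [Finite K] in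
theorem isSelfDual_monicOfCoeffs {σ : K →+* K} {n : ℕ} (hn : 0 < n) {e : K} {b : ℕ → K}
    (he : e * σ e = 1) (hb : ∀ i, 0 < i → i < n → σ (b (n - i)) = σ e * b i) :
    IsSelfDual σ (monicOfCoeffs n e b) := by
  have he0 : e ≠ 0 := left_ne_zero_of_mul_eq_one he
  have hm := monic_monicOfCoeffs n e b
  have hd := natDegree_monicOfCoeffs n e b
  have h0 := coeff_zero_monicOfCoeffs hn (e := e) (b := b)
  have hlead : (monicOfCoeffs n e b).coeff n = 1 := by
    have := hm.coeff_natDegree; rwa [hd] at this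
  refine ⟨hm, by rwa [h0], ⟨C (σ e), ?_⟩⟩
  ext i
  rw [conjReverse, coeff_reverse, natDegree_map, hd, coeff_map, coeff_mul_C, mul_comm]
  rcases lt_or_ge n i with hlt | hle
  · rw [revAt_eq_self_of_lt hlt, coeff_eq_zero_of_natDegree_lt (by rwa [hd]), map_zero, mul_zero]
  rw [revAt_le hle]
  rcases Nat.eq_zero_or_pos i with rfl | hi
  · rw [Nat.sub_zero, hlead, h0, map_one, mul_comm, he]
  rcases hle.eq_or_lt with rfl | hlt
  · rw [Nat.sub_self, h0, hlead, mul_one]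
  · rw [coeff_monicOfCoeffs (by omega) (by omega), coeff_monicOfCoeffs hi hlt, hb i hi hlt]

/-- Extension by zero of a family indexed by a finite set. -/
def extendZero {I : Finset ℕ} (a : I → K) (i : ℕ) : K :=
  if h : i ∈ I then a ⟨i, h⟩ else 0

omit [Finite K] in
theorem extendZero_of_mem {I : Finset ℕ} (a : I → K) {i : ℕ} (h : i ∈ I) :
    extendZero a i = a ⟨i, h⟩ := dif_pos h

theorem le_card_slice_monic {n : ℕ} (hn : 1 ≤ n) {c : K} (hc : c ≠ 0) :
    Nat.card K ^ (n - 1) ≤ (slice (fun P : K[X] => P.Monic ∧ P.coeff 0 ≠ 0) n c).card := by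
  have h1 : Nat.card (Finset.Ioo 0 n → K) = Nat.card K ^ (n - 1) := by
    rw [natCard_fun_finset, Nat.card_Ioo]; rfl
  rw [← h1, ← Nat.card_eq_finsetCard]
  have h0 : ∀ b : ℕ → K, (monicOfCoeffs n c b).coeff 0 = c :=
    fun b => coeff_zero_monicOfCoeffs hn
  refine Nat.card_le_card_of_injective (fun a => ⟨monicOfCoeffs n c (extendZero a),
    mem_slice.2 ⟨⟨monic_monicOfCoeffs _ _ _, by rwa [h0]⟩, natDegree_monicOfCoeffs _ _ _, h0 _⟩⟩)
    fun a a' h => ?_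
  ext ⟨i, hi⟩
  have h2 := congrArg (fun p => coeff p i) (Subtype.mk.inj h)
  have hi' := Finset.mem_Ioo.1 hi
  simpa only [coeff_monicOfCoeffs hi'.1 hi'.2, extendZero_of_mem _ hi] using h2

theorem le_card_slice_selfDual_id {r : ℕ} (hr : 1 ≤ r) :
    Nat.card K ^ r ≤ (slice (IsSelfDual (RingHom.id K)) (2 * r) 1).card := by
  have h1 : Nat.card (Finset.Icc 1 r → K) = Nat.card K ^ r := by
    rw [natCard_fun_finset, Nat.card_Icc]; rfl
  rw [← h1, ← Nat.card_eq_finsetCard]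
  have hn : 0 < 2 * r := by omega
  refine Nat.card_le_card_of_injective
    (fun a => ⟨monicOfCoeffs (2 * r) 1 (fun i => extendZero a (min i (2 * r - i))),
      mem_slice.2 ⟨isSelfDual_monicOfCoeffs hn (by simp) fun i hi hin => ?_,
        natDegree_monicOfCoeffs _ _ _, coeff_zero_monicOfCoeffs hn⟩⟩) fun a a' h => ?_
  · simp only [RingHom.id_apply, one_mul]
    rw [Nat.sub_sub_self hin.le, min_comm]
  · ext ⟨i, hi⟩
    have h2 := congrArg (fun p => coeff p i) (Subtype.mk.inj h)
    have hi' := Finset.mem_Icc.1 hi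
    have hmin : min i (2 * r - i) = i := by omega
    simpa only [coeff_monicOfCoeffs (show 0 < i by omega) (show i < 2 * r by omega), hmin,
      extendZero_of_mem _ hi] using h2

/-- An arbitrary family `a` of middle coefficients is determined by the symmetrizations of `a` and
of `t a`, for `t` not fixed by `σ`. -/
theorem le_card_slice_selfDual_sq {σ : K →+* K} (hσ : ∀ x, σ (σ x) = x) {t : K} (ht : σ t ≠ t)
    {n : ℕ} (hn : 1 ≤ n) {e : K} (he : e * e = 1) (hσe : σ e = e) :
    Nat.card K ^ (n - 1) ≤ (slice (IsSelfDual σ) n e).card ^ 2 := by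
  have h1 : Nat.card (Finset.Ioo 0 n → K) = Nat.card K ^ (n - 1) := by
    rw [natCard_fun_finset, Nat.card_Ioo]; rfl
  rw [← h1, ← Nat.card_eq_finsetCard, sq, ← Nat.card_prod]
  let φ : (ℕ → K) → ℕ → K := fun a i => a i + e * σ (a (n - i))
  have hφ : ∀ a, monicOfCoeffs n e (φ a) ∈ slice (IsSelfDual σ) n e := by
    intro a
    refine mem_slice.2 ⟨isSelfDual_monicOfCoeffs hn (by rw [hσe, he]) fun i hi hin => ?_,
      natDegree_monicOfCoeffs _ _ _, coeff_zero_monicOfCoeffs hn⟩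
    simp only [φ, map_add, map_mul, hσ, hσe, Nat.sub_sub_self hin.le]
    linear_combination (-σ (a (n - i))) * he
  refine Nat.card_le_card_of_injective
    (fun a => (⟨monicOfCoeffs n e (φ (extendZero a)), hφ _⟩,
      ⟨monicOfCoeffs n e (φ fun i => t * extendZero a i), hφ _⟩)) fun a a' h => ?_
  ext ⟨i, hi⟩
  simp only [Prod.mk.injEq, Subtype.mk.injEq] at h
  have hi' := Finset.mem_Ioo.1 hi
  have h2 := congrArg (fun p => coeff p i) h.1
  have h3 := congrArg (fun p => coeff p i) h.2
  simp only [coeff_monicOfCoeffs hi'.1 hi'.2, φ, map_mul] at h2 h3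
  rw [← extendZero_of_mem a hi, ← extendZero_of_mem a' hi]
  have h4 : (t - σ t) * (extendZero a i - extendZero a' i) = 0 := by
    linear_combination h3 - σ t * h2
  exact sub_eq_zero.1 ((mul_eq_zero.1 h4).resolve_left (sub_ne_zero.2 (Ne.symm ht)))

end Slices

/-! ### Repeated factors and divisor sums of random polynomials -/

section Density

variable {K : Type*} [Field K] [Finite K]

/-- Bounds for the number of members of a divisor family `F` with given degree and constant term,
in terms of a number `s` with about `s ^ m` members of degree `m`, and a factor `κ` accounting for
the constant term. -/
structure SliceBounds (F : K[X] → Prop) (s κ : ℝ) (n : ℕ) (c₀ : K) : Prop where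
  family : IsDivisorFamily F
  le_s : 4 / 3 ≤ s
  pos : 0 < κ
  two_le : 2 ≤ n
  coeff_zero_ne : ∀ {D}, F D → D.coeff 0 ≠ 0
  card_le : ∀ m c, 1 ≤ m → ((slice F m c).card : ℝ) ≤ κ * s ^ m
  le_card : κ * s ^ n ≤ (slice F n c₀).card
  exists_values : ∃ N : Finset K, (∀ D, F D → D.coeff 0 ∈ N) ∧ N.card * κ ≤ 2

namespace SliceBounds

variable {F : K[X] → Prop} {s κ : ℝ} {n : ℕ} {c₀ : K}

open Classical in
theorem card_natDegree_le (h : SliceBounds F s κ n c₀) (δ : ℕ) :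
    (Finset.card {D ∈ polysNatDegreeLE K n | F D ∧ D.natDegree = δ} : ℝ) ≤ 2 * s ^ δ := by
  have hs := h.le_s
  have hs0 : 0 < s := by linarith
  rcases Nat.eq_zero_or_pos δ with rfl | hδ
  · have h1 : ({D ∈ polysNatDegreeLE K n | F D ∧ D.natDegree = 0} : Finset K[X]) ⊆ {1} := by
      intro D hD
      simp only [Finset.mem_filter] at hD
      exact Finset.mem_singleton.2 ((h.family.monic hD.2.1).natDegree_eq_zero.1 hD.2.2)
    have h2 : (Finset.card {D ∈ polysNatDegreeLE K n | F D ∧ D.natDegree = 0} : ℝ) ≤ 1 := by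
      exact_mod_cast (Finset.card_le_card h1).trans (by simp)
    rw [pow_zero]; linarith
  · obtain ⟨N, hN, hNκ⟩ := h.exists_values
    have h1 : ({D ∈ polysNatDegreeLE K n | F D ∧ D.natDegree = δ} : Finset K[X]) ⊆
        N.biUnion (slice F δ) := by
      intro D hD
      simp only [Finset.mem_filter] at hD
      exact Finset.mem_biUnion.2 ⟨_, hN D hD.2.1, mem_slice.2 ⟨hD.2.1, hD.2.2, rfl⟩⟩
    calc (Finset.card {D ∈ polysNatDegreeLE K n | F D ∧ D.natDegree = δ} : ℝ)
        ≤ ∑ c ∈ N, ((slice F δ c).card : ℝ) := by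
          exact_mod_cast (Finset.card_le_card h1).trans Finset.card_biUnion_le
      _ ≤ ∑ c ∈ N, κ * s ^ δ := Finset.sum_le_sum fun c _ => h.card_le δ c hδ
      _ = (N.card * κ) * s ^ δ := by rw [Finset.sum_const, nsmul_eq_mul, mul_assoc]
      _ ≤ 2 * s ^ δ := by gcongr

open Classical in
/-- The proportion of multiples of `D` is at most `s^{-deg D}`. -/
theorem card_multiples_le (h : SliceBounds F s κ n c₀) {D : K[X]} (hD : F D)
    (hDn : D.natDegree < n) :
    (Finset.card {P ∈ slice F n c₀ | D ∣ P} : ℝ) ≤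
      (s ^ D.natDegree)⁻¹ * (slice F n c₀).card := by
  have hs := h.le_s
  have hs0 : 0 < s := by linarith
  have hDm := h.family.monic hD
  have h1 : ({P ∈ slice F n c₀ | D ∣ P} : Finset K[X]) ⊆
      (slice F (n - D.natDegree) (c₀ / D.coeff 0)).image (D * ·) := by
    intro P hP
    simp only [Finset.mem_filter, mem_slice] at hP
    obtain ⟨⟨hP, hPn, hPc⟩, Q, rfl⟩ := hP
    have hQ := h.family.of_mul hD hP
    refine Finset.mem_image.2 ⟨Q, mem_slice.2 ⟨hQ, ?_, ?_⟩, rfl⟩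
    · rw [hDm.natDegree_mul (h.family.monic hQ)] at hPn; omega
    · rw [mul_coeff_zero] at hPc
      rw [← hPc, mul_div_cancel_left₀ _ (h.coeff_zero_ne hD)]
  have h2 : (Finset.card {P ∈ slice F n c₀ | D ∣ P} : ℝ) ≤ κ * s ^ (n - D.natDegree) := by
    refine le_trans ?_ (h.card_le (n - D.natDegree) (c₀ / D.coeff 0) (by omega))
    exact_mod_cast (Finset.card_le_card h1).trans Finset.card_image_le
  refine h2.trans ?_
  rw [le_inv_mul_iff₀ (by positivity)]
  refine le_trans (le_of_eq ?_) h.le_card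
  rw [mul_left_comm, ← pow_add, Nat.add_sub_cancel' hDn.le]

open Classical in
theorem card_sq_multiples_le (h : SliceBounds F s κ n c₀) (δ : ℕ) :
    (Finset.card {P ∈ slice F n c₀ | ∃ D, F D ∧ D.natDegree = δ ∧ D ^ 2 ∣ P} : ℝ) ≤
      2 * (s ^ δ)⁻¹ * (slice F n c₀).card := by
  have hs := h.le_s
  have hs0 : 0 < s := by linarith
  have hsq : ∀ {D}, F D → F (D ^ 2) := fun hD => by rw [sq]; exact h.family.mul hD hD
  have hdeg : ∀ {D}, F D → (D ^ 2).natDegree = 2 * D.natDegree := fun hD =>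
    (h.family.monic hD).natDegree_pow 2
  rcases lt_trichotomy (2 * δ) n with hlt | heq | hgt
  · have h1 : ({P ∈ slice F n c₀ | ∃ D, F D ∧ D.natDegree = δ ∧ D ^ 2 ∣ P} : Finset K[X]) ⊆
        ({D ∈ polysNatDegreeLE K n | F D ∧ D.natDegree = δ} : Finset K[X]).biUnion
          fun D => {P ∈ slice F n c₀ | D ^ 2 ∣ P} := by
      intro P hP
      obtain ⟨hP, D, hD, hDδ, hDP⟩ := Finset.mem_filter.1 hP
      refine Finset.mem_biUnion.2 ⟨D, Finset.mem_filter.2 ⟨?_, hD, hDδ⟩,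
        Finset.mem_filter.2 ⟨hP, hDP⟩⟩
      rw [mem_polysNatDegreeLE]; omega
    calc (Finset.card {P ∈ slice F n c₀ | ∃ D, F D ∧ D.natDegree = δ ∧ D ^ 2 ∣ P} : ℝ)
        ≤ ∑ D ∈ polysNatDegreeLE K n with F D ∧ D.natDegree = δ,
            (Finset.card {P ∈ slice F n c₀ | D ^ 2 ∣ P} : ℝ) := by
          exact_mod_cast (Finset.card_le_card h1).trans Finset.card_biUnion_le
      _ ≤ ∑ D ∈ polysNatDegreeLE K n with F D ∧ D.natDegree = δ,
            (s ^ (2 * δ))⁻¹ * ((slice F n c₀).card : ℝ) := by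
          refine Finset.sum_le_sum fun D hD => ?_
          obtain ⟨-, hD, hDδ⟩ := Finset.mem_filter.1 hD
          have h2 := h.card_multiples_le (hsq hD) (by rw [hdeg hD, hDδ]; exact hlt)
          rwa [hdeg hD, hDδ] at h2
      _ = (Finset.card {D ∈ polysNatDegreeLE K n | F D ∧ D.natDegree = δ} : ℝ) *
            ((s ^ (2 * δ))⁻¹ * ((slice F n c₀).card : ℝ)) := by
          rw [Finset.sum_const, nsmul_eq_mul]
      _ ≤ (2 * s ^ δ) * ((s ^ (2 * δ))⁻¹ * ((slice F n c₀).card : ℝ)) := by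
          gcongr
          exact h.card_natDegree_le δ
      _ = 2 * (s ^ δ)⁻¹ * (slice F n c₀).card := by
          rw [two_mul δ, pow_add]; field_simp
  · -- a monic square of full degree: its root has one of at most two constant terms
    have hδ : 1 ≤ δ := by have := h.two_le; omega
    let N : Finset K := ((X ^ 2 - C c₀ : K[X]).roots).toFinset
    have hN : (N.card : ℝ) ≤ 2 := by
      have h1 : (X ^ 2 - C c₀ : K[X]).natDegree = 2 := natDegree_X_pow_sub_C
      have h2 := (Multiset.toFinset_card_le _).trans (card_roots' (X ^ 2 - C c₀ : K[X]))
      rw [h1] at h2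
      exact_mod_cast h2
    have h1 : ({P ∈ slice F n c₀ | ∃ D, F D ∧ D.natDegree = δ ∧ D ^ 2 ∣ P} : Finset K[X]) ⊆
        (N.biUnion (slice F δ)).image (· ^ 2) := by
      intro P hP
      obtain ⟨hP, D, hD, hDδ, hDP⟩ := Finset.mem_filter.1 hP
      rw [mem_slice] at hP
      have h2 : P = D ^ 2 := by
        refine eq_of_monic_of_associated (h.family.monic hP.1) (h.family.monic (hsq hD))
          (associated_of_dvd_of_natDegree_le hDP (h.family.monic hP.1).ne_zero ?_).symm
        rw [hdeg hD, hP.2.1, hDδ, heq]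
      refine Finset.mem_image.2 ⟨D, Finset.mem_biUnion.2 ⟨D.coeff 0, ?_, mem_slice.2
        ⟨hD, hDδ, rfl⟩⟩, h2.symm⟩
      have h3 := hP.2.2
      rw [h2, sq, mul_coeff_zero] at h3
      rw [Multiset.mem_toFinset, mem_roots (X_pow_sub_C_ne_zero two_pos _), IsRoot]
      simp only [eval_sub, eval_pow, eval_X, eval_C]
      rw [sq, h3, sub_self]
    calc (Finset.card {P ∈ slice F n c₀ | ∃ D, F D ∧ D.natDegree = δ ∧ D ^ 2 ∣ P} : ℝ)
        ≤ ∑ c ∈ N, ((slice F δ c).card : ℝ) := by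
          exact_mod_cast (Finset.card_le_card h1).trans
            (Finset.card_image_le.trans Finset.card_biUnion_le)
      _ ≤ ∑ c ∈ N, κ * s ^ δ := Finset.sum_le_sum fun c _ => h.card_le δ c hδ
      _ = N.card * (κ * s ^ δ) := by rw [Finset.sum_const, nsmul_eq_mul]
      _ ≤ 2 * (κ * s ^ δ) := by
          have := h.pos
          gcongr
      _ = 2 * (s ^ δ)⁻¹ * (κ * s ^ n) := by
          rw [← heq, two_mul δ, pow_add]; field_simp
      _ ≤ 2 * (s ^ δ)⁻¹ * (slice F n c₀).card := by
          gcongr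
          exact h.le_card
  · have h1 : ({P ∈ slice F n c₀ | ∃ D, F D ∧ D.natDegree = δ ∧ D ^ 2 ∣ P} : Finset K[X]) = ∅ := by
      refine Finset.filter_eq_empty_iff.2 ?_
      rintro P hP ⟨D, hD, hDδ, hDP⟩
      rw [mem_slice] at hP
      have := natDegree_le_of_dvd hDP (h.family.monic hP.1).ne_zero
      rw [hdeg hD, hP.2.1, hDδ] at this
      omega
    rw [h1, Finset.card_empty, Nat.cast_zero]
    positivity

theorem sum_inv_pow_le (hs : 4 / 3 ≤ s) (a b : ℕ) :
    ∑ δ ∈ Finset.Ico a b, (s ^ δ)⁻¹ ≤ 4 * (s ^ a)⁻¹ := by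
  have hs0 : 0 < s := by linarith
  have h1 : s⁻¹ ≤ 3 / 4 := by
    rw [inv_le_comm₀ hs0 (by norm_num)]; norm_num; linarith
  rcases le_total b a with hab | hab
  · rw [Finset.Ico_eq_empty (by omega), Finset.sum_empty]; positivity
  obtain ⟨k, rfl⟩ := Nat.exists_eq_add_of_le hab
  have key : ∑ δ ∈ Finset.Ico a (a + k), (s ^ δ)⁻¹ + 4 * (s ^ (a + k))⁻¹ ≤ 4 * (s ^ a)⁻¹ := by
    clear hab
    induction k with
    | zero => simp
    | succ k ih =>
      rw [← add_assoc, Finset.sum_Ico_succ_top (by omega), pow_succ, mul_inv]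
      have h2 : 0 < (s ^ (a + k))⁻¹ := by positivity
      nlinarith
  have : 0 < (s ^ (a + k))⁻¹ := by positivity
  linarith

open Classical in
/-- Large square divisors are rare. -/
theorem card_large_sq_le (h : SliceBounds F s κ n c₀) (Δ : ℕ) :
    (Finset.card {P ∈ slice F n c₀ | ∃ D, F D ∧ Δ ≤ D.natDegree ∧ D ^ 2 ∣ P} : ℝ) ≤
      8 * (s ^ Δ)⁻¹ * (slice F n c₀).card := by
  have hs := h.le_s
  have hs0 : 0 < s := by linarith
  have h1 : ({P ∈ slice F n c₀ | ∃ D, F D ∧ Δ ≤ D.natDegree ∧ D ^ 2 ∣ P} : Finset K[X]) ⊆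
      (Finset.Ico Δ (n + 1)).biUnion
        fun δ => {P ∈ slice F n c₀ | ∃ D, F D ∧ D.natDegree = δ ∧ D ^ 2 ∣ P} := by
    intro P hP
    obtain ⟨hP, D, hD, hDδ, hDP⟩ := Finset.mem_filter.1 hP
    refine Finset.mem_biUnion.2 ⟨D.natDegree, Finset.mem_Ico.2 ⟨hDδ, ?_⟩,
      Finset.mem_filter.2 ⟨hP, D, hD, rfl, hDP⟩⟩
    rw [mem_slice] at hP
    have := natDegree_le_of_dvd ((dvd_pow_self D two_ne_zero).trans hDP)
      (h.family.monic hP.1).ne_zero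
    omega
  calc (Finset.card {P ∈ slice F n c₀ | ∃ D, F D ∧ Δ ≤ D.natDegree ∧ D ^ 2 ∣ P} : ℝ)
      ≤ ∑ δ ∈ Finset.Ico Δ (n + 1),
          (Finset.card {P ∈ slice F n c₀ | ∃ D, F D ∧ D.natDegree = δ ∧ D ^ 2 ∣ P} : ℝ) := by
        exact_mod_cast (Finset.card_le_card h1).trans Finset.card_biUnion_le
    _ ≤ ∑ δ ∈ Finset.Ico Δ (n + 1), 2 * (s ^ δ)⁻¹ * (slice F n c₀).card :=
        Finset.sum_le_sum fun δ _ => h.card_sq_multiples_le δ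
    _ = 2 * (∑ δ ∈ Finset.Ico Δ (n + 1), (s ^ δ)⁻¹) * (slice F n c₀).card := by
        rw [Finset.mul_sum, Finset.sum_mul]
    _ ≤ 2 * (4 * (s ^ Δ)⁻¹) * (slice F n c₀).card := by
        gcongr
        exact sum_inv_pow_le hs _ _
    _ = _ := by ring

/-- The divisor sum is bounded on average. -/
theorem sum_weightedDivisorSum_le (h : SliceBounds F s κ n c₀) :
    ∑ P ∈ slice F n c₀, weightedDivisorSum F s P ≤ 9 * (slice F n c₀).card := by
  classical
  have hs := h.le_s
  have hs0 : 0 < s := by linarith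
  have e1 : ∀ P ∈ slice F n c₀, weightedDivisorSum F s P ≤
      (∑ D ∈ polysNatDegreeLE K n with F D ∧ D.natDegree < n,
        if D ∣ P then (s ^ D.natDegree)⁻¹ else 0) + 1 := by
    intro P hP
    rw [mem_slice] at hP
    have hPm := h.family.monic hP.1
    rw [weightedDivisorSum, hP.2.1,
      ← Finset.sum_filter_add_sum_filter_not _ (fun D : K[X] => D.natDegree < n)]
    refine add_le_add (le_of_eq ?_) ?_
    · rw [← Finset.sum_filter, Finset.filter_filter, Finset.filter_filter]
      refine Finset.sum_congr (Finset.filter_congr fun D _ => ?_) fun _ _ => rfl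
      tauto
    · have h2 : ({D ∈ {D ∈ polysNatDegreeLE K n | F D ∧ D ∣ P} | ¬ D.natDegree < n} :
          Finset K[X]) ⊆ {P} := by
        intro D hD
        simp only [Finset.mem_filter] at hD
        refine Finset.mem_singleton.2 (eq_of_monic_of_associated (h.family.monic hD.1.2.1) hPm
          (associated_of_dvd_of_natDegree_le hD.1.2.2 hPm.ne_zero ?_))
        rw [hP.2.1]; omega
      refine (Finset.sum_le_sum_of_subset_of_nonneg h2 fun _ _ _ => by positivity).trans ?_
      rw [Finset.sum_singleton]
      exact inv_le_one_of_one_le₀ (one_le_pow₀ (by linarith))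
  refine (Finset.sum_le_sum e1).trans ?_
  rw [Finset.sum_add_distrib, Finset.sum_comm, Finset.sum_const, nsmul_eq_mul, mul_one]
  have e2 : ∀ D ∈ ({D ∈ polysNatDegreeLE K n | F D ∧ D.natDegree < n} : Finset K[X]),
      (∑ P ∈ slice F n c₀, if D ∣ P then (s ^ D.natDegree)⁻¹ else 0) ≤
      (s ^ D.natDegree)⁻¹ * (s ^ D.natDegree)⁻¹ * (slice F n c₀).card := by
    intro D hD
    simp only [Finset.mem_filter] at hD
    rw [← Finset.sum_filter, Finset.sum_const, nsmul_eq_mul, mul_comm, mul_assoc]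
    gcongr
    exact h.card_multiples_le hD.2.1 hD.2.2
  refine (add_le_add_left (Finset.sum_le_sum e2) _).trans ?_
  rw [← Finset.sum_mul, ← Finset.sum_fiberwise_of_maps_to (g := fun D : K[X] => D.natDegree)
    (t := Finset.Ico 0 n) (by
      intro D hD
      simp only [Finset.mem_filter] at hD
      exact Finset.mem_Ico.2 ⟨Nat.zero_le _, hD.2.2⟩)]
  have e3 : ∀ δ ∈ Finset.Ico 0 n,
      (∑ D ∈ {D ∈ polysNatDegreeLE K n | F D ∧ D.natDegree < n} with D.natDegree = δ,
        (s ^ D.natDegree)⁻¹ * (s ^ D.natDegree)⁻¹) ≤ 2 * (s ^ δ)⁻¹ := by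
    intro δ hδ
    calc (∑ D ∈ {D ∈ polysNatDegreeLE K n | F D ∧ D.natDegree < n} with D.natDegree = δ,
          (s ^ D.natDegree)⁻¹ * (s ^ D.natDegree)⁻¹)
        ≤ ∑ D ∈ polysNatDegreeLE K n with F D ∧ D.natDegree = δ,
          (s ^ δ)⁻¹ * (s ^ δ)⁻¹ := by
          rw [Finset.filter_filter]
          refine (Finset.sum_le_sum_of_subset_of_nonneg
            (t := {D ∈ polysNatDegreeLE K n | F D ∧ D.natDegree = δ}) (fun D hD => ?_)
            fun _ _ _ => by positivity).trans (Finset.sum_le_sum fun D hD => ?_)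
          · simp only [Finset.mem_filter] at hD ⊢; tauto
          · rw [(Finset.mem_filter.1 hD).2.2]
      _ = (Finset.card {D ∈ polysNatDegreeLE K n | F D ∧ D.natDegree = δ} : ℝ) *
          ((s ^ δ)⁻¹ * (s ^ δ)⁻¹) := by rw [Finset.sum_const, nsmul_eq_mul]
      _ ≤ (2 * s ^ δ) * ((s ^ δ)⁻¹ * (s ^ δ)⁻¹) := by
          gcongr
          exact h.card_natDegree_le δ
      _ = 2 * (s ^ δ)⁻¹ := by field_simp
  have e4 := (Finset.sum_le_sum e3).trans (le_of_eq (Finset.mul_sum _ _ _).symm)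
  have e5 := sum_inv_pow_le hs 0 n
  have e6 : (0 : ℝ) ≤ (slice F n c₀).card := Nat.cast_nonneg _
  rw [pow_zero, inv_one] at e5
  nlinarith

open Classical in
theorem card_large_weightedDivisorSum_le (h : SliceBounds F s κ n c₀) {M : ℝ} (hM : 0 < M) :
    (Finset.card {P ∈ slice F n c₀ | M < weightedDivisorSum F s P} : ℝ) ≤
      9 / M * (slice F n c₀).card := by
  have hs0 : 0 ≤ s := by linarith [h.le_s]
  rw [div_mul_eq_mul_div, le_div_iff₀ hM]
  refine le_trans ?_ h.sum_weightedDivisorSum_le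
  rw [← nsmul_eq_mul, ← Finset.sum_const]
  refine (Finset.sum_le_sum fun P hP => (Finset.mem_filter.1 hP).2.le).trans
    (Finset.sum_le_sum_of_subset_of_nonneg (Finset.filter_subset _ _) fun P _ _ => ?_)
  exact zero_le_one.trans (one_le_weightedDivisorSum h.family.one hs0 P)

theorem card_pos (h : SliceBounds F s κ n c₀) : (0 : ℝ) < (slice F n c₀).card := by
  have hs0 : 0 < s := by linarith [h.le_s]
  have := h.pos
  exact lt_of_lt_of_le (by positivity) h.le_card

end SliceBounds

/-- A polynomial is exceptional if its divisor sum exceeds `M`, or it is divisible by the square of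
a member of `F` of degree at least `Δ`, or, in case `s` is large, it is divisible by the square of a
nonconstant member of `F` or by a member of `E`. -/
def IsExceptional (F : K[X] → Prop) (E : Finset K[X]) (s M s₀ : ℝ) (Δ : ℕ) (P : K[X]) : Prop :=
  M < weightedDivisorSum F s P ∨ (∃ D, F D ∧ Δ ≤ D.natDegree ∧ D ^ 2 ∣ P) ∨
    (s₀ ≤ s ∧ ((∃ D, F D ∧ 1 ≤ D.natDegree ∧ D ^ 2 ∣ P) ∨ ∃ D ∈ E, D ∣ P))

open Classical in
/-- Exceptional polynomials are rare, uniformly in the field and the degree. -/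
theorem exists_card_exceptional_lt (ε : ℝ) (hε : 0 < ε) :
    ∃ (M s₀ : ℝ) (Δ : ℕ), 1 ≤ M ∧ 1 ≤ s₀ ∧ ∀ (K : Type) [Field K] [Finite K] (F : K[X] → Prop)
      (s κ : ℝ) (n : ℕ) (c₀ : K) (E : Finset K[X]), SliceBounds F s κ n c₀ →
      (∀ D ∈ E, F D ∧ D.natDegree = 1) → E.card ≤ 2 →
      (Finset.card {P ∈ slice F n c₀ | IsExceptional F E s M s₀ Δ P} : ℝ) <
        ε * (slice F n c₀).card := by
  -- the exceptional polynomials of the four kinds have proportions at most `9 / M`, `8 / s ^ Δ`,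
  -- `8 / s` and `2 / s`, and `4 / 3 ≤ s`
  obtain ⟨Δ, hΔ⟩ := exists_pow_lt_of_lt_one (show 0 < ε / 32 by positivity)
    (show (3 / 4 : ℝ) < 1 by norm_num)
  refine ⟨1 + 36 / ε, 1 + 40 / ε, Δ, ?_, ?_, ?_⟩
  · have : 0 < 36 / ε := by positivity
    linarith
  · have : 0 < 40 / ε := by positivity
    linarith
  intro K _ _ F s κ n c₀ E h hE hE2
  have hs := h.le_s
  have hs0 : 0 < s := by linarith
  set N : ℝ := ((slice F n c₀).card : ℝ)
  have hN : 0 < N := h.card_pos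
  have hM : (0 : ℝ) < 1 + 36 / ε := by positivity
  have b1 := h.card_large_weightedDivisorSum_le hM
  have b2 := h.card_large_sq_le Δ
  have b3 : (Finset.card {P ∈ slice F n c₀ | 1 + 40 / ε ≤ s ∧
      ((∃ D, F D ∧ 1 ≤ D.natDegree ∧ D ^ 2 ∣ P) ∨ ∃ D ∈ E, D ∣ P)} : ℝ) ≤ ε / 4 * N := by
    by_cases hss : 1 + 40 / ε ≤ s
    · have c1 := h.card_large_sq_le 1
      have c2 : (Finset.card (E.biUnion fun D => {P ∈ slice F n c₀ | D ∣ P}) : ℝ) ≤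
          2 * s⁻¹ * N := by
        calc (Finset.card (E.biUnion fun D => {P ∈ slice F n c₀ | D ∣ P}) : ℝ)
            ≤ ∑ D ∈ E, (Finset.card {P ∈ slice F n c₀ | D ∣ P} : ℝ) := by
              exact_mod_cast Finset.card_biUnion_le
          _ ≤ ∑ D ∈ E, s⁻¹ * N := Finset.sum_le_sum fun D hD => by
              have := h.card_multiples_le (hE D hD).1 (by
                rw [(hE D hD).2]; exact h.two_le)
              rwa [(hE D hD).2, pow_one] at this
          _ = E.card * (s⁻¹ * N) := by rw [Finset.sum_const, nsmul_eq_mul]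
          _ ≤ 2 * (s⁻¹ * N) := by
              gcongr
              exact_mod_cast hE2
          _ = 2 * s⁻¹ * N := by ring
      have c3 : ({P ∈ slice F n c₀ | 1 + 40 / ε ≤ s ∧
          ((∃ D, F D ∧ 1 ≤ D.natDegree ∧ D ^ 2 ∣ P) ∨ ∃ D ∈ E, D ∣ P)} : Finset K[X]) ⊆
          {P ∈ slice F n c₀ | ∃ D, F D ∧ 1 ≤ D.natDegree ∧ D ^ 2 ∣ P} ∪
            E.biUnion fun D => {P ∈ slice F n c₀ | D ∣ P} := by
        intro P hP
        simp only [Finset.mem_filter, Finset.mem_union, Finset.mem_biUnion] at hP ⊢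
        obtain ⟨hP, -, hP1 | ⟨D, hD, hDP⟩⟩ := hP
        · exact Or.inl ⟨hP, hP1⟩
        · exact Or.inr ⟨D, hD, hP, hDP⟩
      have c4 : (Finset.card {P ∈ slice F n c₀ | 1 + 40 / ε ≤ s ∧
          ((∃ D, F D ∧ 1 ≤ D.natDegree ∧ D ^ 2 ∣ P) ∨ ∃ D ∈ E, D ∣ P)} : ℝ) ≤
          8 * (s ^ 1)⁻¹ * N + 2 * s⁻¹ * N := by
        refine le_trans ?_ (add_le_add c1 c2)
        exact_mod_cast (Finset.card_le_card c3).trans (Finset.card_union_le _ _)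
      have c5 : s⁻¹ ≤ ε / 40 := by
        rw [inv_le_comm₀ hs0 (by positivity), inv_div]; linarith
      rw [pow_one] at c4
      nlinarith
    · have : ({P ∈ slice F n c₀ | 1 + 40 / ε ≤ s ∧
          ((∃ D, F D ∧ 1 ≤ D.natDegree ∧ D ^ 2 ∣ P) ∨ ∃ D ∈ E, D ∣ P)} : Finset K[X]) = ∅ :=
        Finset.filter_eq_empty_iff.2 fun P _ hP => hss hP.1
      rw [this, Finset.card_empty, Nat.cast_zero]
      positivity
  have hsub : ({P ∈ slice F n c₀ | IsExceptional F E s (1 + 36 / ε) (1 + 40 / ε) Δ P} :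
      Finset K[X]) ⊆ {P ∈ slice F n c₀ | 1 + 36 / ε < weightedDivisorSum F s P} ∪
      ({P ∈ slice F n c₀ | ∃ D, F D ∧ Δ ≤ D.natDegree ∧ D ^ 2 ∣ P} ∪
      {P ∈ slice F n c₀ | 1 + 40 / ε ≤ s ∧
        ((∃ D, F D ∧ 1 ≤ D.natDegree ∧ D ^ 2 ∣ P) ∨ ∃ D ∈ E, D ∣ P)}) := by
    intro P hP
    obtain ⟨hP, hP'⟩ := Finset.mem_filter.1 hP
    unfold IsExceptional at hP'
    simp only [Finset.mem_filter, Finset.mem_union]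
    exact hP'.imp (⟨hP, ·⟩) (Or.imp (⟨hP, ·⟩) (⟨hP, ·⟩))
  have d1 : (Finset.card {P ∈ slice F n c₀ |
      IsExceptional F E s (1 + 36 / ε) (1 + 40 / ε) Δ P} : ℝ) ≤
      9 / (1 + 36 / ε) * N + (8 * (s ^ Δ)⁻¹ * N + ε / 4 * N) := by
    refine le_trans ?_ (add_le_add b1 (add_le_add b2 b3))
    exact_mod_cast (Finset.card_le_card hsub).trans ((Finset.card_union_le _ _).trans
      (Nat.add_le_add_left (Finset.card_union_le _ _) _))
  have d2 : 9 / (1 + 36 / ε) < ε / 4 := by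
    rw [div_lt_iff₀ hM]; field_simp; linarith
  have d3 : (s ^ Δ)⁻¹ < ε / 32 := by
    refine lt_of_le_of_lt ?_ hΔ
    rw [← inv_pow]
    refine pow_le_pow_left₀ (by positivity) ?_ Δ
    rw [inv_le_comm₀ hs0 (by norm_num)]; norm_num; linarith
  nlinarith

end Density

/-! ### Elements of the Clifford algebra commuting with all vectors -/

section Exterior

variable {K V : Type*} [Field K] [AddCommGroup V] [Module K V]

theorem ExteriorAlgebra.map_id_sub_smulRight (e : V) (d : Module.Dual K V)
    (y : ExteriorAlgebra K V) :
    ExteriorAlgebra.map (LinearMap.id - d.smulRight e) y =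
      y - ExteriorAlgebra.ι K e *
        CliffordAlgebra.contractLeft (Q := (0 : QuadraticForm K V)) d y := by
  induction y using CliffordAlgebra.left_induction with
  | algebraMap r => simp
  | add x y hx hy =>
    rw [map_add, hx, hy, map_add, mul_add]
    abel
  | ι_mul y v hy =>
    have hsq : ExteriorAlgebra.ι K e * ExteriorAlgebra.ι K e = 0 := ExteriorAlgebra.ι_sq_zero e
    have hsw : ExteriorAlgebra.ι K v * ExteriorAlgebra.ι K e =
        -(ExteriorAlgebra.ι K e * ExteriorAlgebra.ι K v) :=
      eq_neg_of_add_eq_zero_left (ExteriorAlgebra.ι_add_mul_swap v e)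
    change ExteriorAlgebra.map _ (ExteriorAlgebra.ι K v * y) = _
    rw [map_mul, hy, ExteriorAlgebra.map_apply_ι, CliffordAlgebra.contractLeft_ι_mul]
    change _ = ExteriorAlgebra.ι K v * y - ExteriorAlgebra.ι K e * (_ - ExteriorAlgebra.ι K v * _)
    simp only [LinearMap.sub_apply, LinearMap.id_apply, LinearMap.smulRight_apply, map_sub,
      map_smul, sub_mul, mul_sub, smul_mul_assoc, mul_smul_comm, ← mul_assoc, hsq, hsw, zero_mul,
      smul_zero]
    simp only [neg_mul]
    abel

/-- An element of the exterior algebra killed by the contractions `B v`, `v ∈ V`, comes from the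
exterior algebra of the radical of `B`: it is fixed by an endomorphism of `V` with image in the
radical. Such an endomorphism is a fixing endomorphism of minimal rank. -/
theorem ExteriorAlgebra.exists_map_eq_self_of_contractLeft_eq_zero [FiniteDimensional K V]
    (B : V →ₗ[K] V →ₗ[K] K) (y : ExteriorAlgebra K V)
    (hy : ∀ v, CliffordAlgebra.contractLeft (Q := (0 : QuadraticForm K V)) (B v) y = 0) :
    ∃ p : V →ₗ[K] V, (∀ v w, B w (p v) = 0) ∧ ExteriorAlgebra.map p y = y := by
  suffices H : ∀ n, ∀ p : V →ₗ[K] V, Module.finrank K (LinearMap.range p) = n →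
      ExteriorAlgebra.map p y = y →
      ∃ p : V →ₗ[K] V, (∀ v w, B w (p v) = 0) ∧ ExteriorAlgebra.map p y = y from
    H _ LinearMap.id rfl (by simp)
  intro n
  induction n using Nat.strong_induction_on with
  | _ n ih =>
    intro p hn hp
    by_cases h : ∀ v w, B w (p v) = 0
    · exact ⟨p, h, hp⟩
    push Not at h
    obtain ⟨v, w, hvw⟩ := h
    set d : Module.Dual K V := B ((B w (p v))⁻¹ • w) with hd
    have hde : d (p v) = 1 := by simp [hd, hvw]
    set q : V →ₗ[K] V := LinearMap.id - d.smulRight (p v) with hq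
    refine ih (Module.finrank K (LinearMap.range (q ∘ₗ p))) ?_ (q ∘ₗ p) rfl ?_
    · rw [← hn]
      apply Submodule.finrank_lt_finrank_of_lt
      refine lt_of_le_of_ne ?_ fun heq => ?_
      · rintro _ ⟨u, rfl⟩
        exact ⟨u - d (p u) • v, by simp [hq]⟩
      · obtain ⟨u, hu⟩ : p v ∈ LinearMap.range (q ∘ₗ p) := heq ▸ LinearMap.mem_range_self p v
        have := congrArg d hu
        simp [hq, hde] at this
    · rw [← ExteriorAlgebra.map_comp_map, AlgHom.comp_apply, hp, hq, map_id_sub_smulRight, hd,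
        hy, mul_zero, sub_zero]

/-- The exterior algebra of a space of dimension at most one consists of scalars and vectors. -/
theorem ExteriorAlgebra.exists_map_eq_of_forall_eq_smul (p : V →ₗ[K] V) (r : V)
    (hr : ∀ v, ∃ c : K, p v = c • r) (y : ExteriorAlgebra K V) :
    ∃ a c : K, ExteriorAlgebra.map p y = algebraMap K _ a + ExteriorAlgebra.ι K (c • r) := by
  induction y using CliffordAlgebra.left_induction with
  | algebraMap a => exact ⟨a, 0, by simp⟩
  | add x y hx hy =>
    obtain ⟨a, c, h⟩ := hx
    obtain ⟨a', c', h'⟩ := hy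
    refine ⟨a + a', c + c', ?_⟩
    rw [map_add, h, h', map_add, add_smul, map_add]
    abel
  | ι_mul y v hy =>
    obtain ⟨a, c, h⟩ := hy
    obtain ⟨b, hb⟩ := hr v
    refine ⟨0, a * b, ?_⟩
    change ExteriorAlgebra.map p (ExteriorAlgebra.ι K v * y) = _
    rw [map_mul, h, ExteriorAlgebra.map_apply_ι, hb, mul_add, map_smul, map_smul,
      smul_mul_smul_comm, ExteriorAlgebra.ι_sq_zero, smul_zero, ← Algebra.commutes, ← Algebra.smul_def,
      map_smul,
      smul_smul, map_zero, zero_add, add_zero]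

end Exterior

section Clifford

variable {K V : Type*} [Field K] [AddCommGroup V] [Module K V] {Q : QuadraticForm K V}

variable (Q) in
theorem CliffordAlgebra.algebraMap_injective_of_field :
    Function.Injective (algebraMap K (CliffordAlgebra Q)) := by
  obtain ⟨B, hB⟩ := LinearMap.BilinMap.toQuadraticMap_surjective (R := K) (-Q)
  have h : B.toQuadraticMap = (0 : QuadraticForm K V) - Q := by rw [hB, zero_sub]
  intro a b hab
  apply (ExteriorAlgebra.algebraMap_leftInverse (R := K) V).injective
  change algebraMap K (CliffordAlgebra (0 : QuadraticForm K V)) a = algebraMap K _ b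
  rw [← CliffordAlgebra.changeForm_algebraMap h a, ← CliffordAlgebra.changeForm_algebraMap h b,
    hab]

/-- The twisted commutator with a vector `v` is the contraction with the functional `polar v`. -/
theorem CliffordAlgebra.ι_mul_sub_involute_mul_ι (v : V) (x : CliffordAlgebra Q) :
    CliffordAlgebra.ι Q v * x - CliffordAlgebra.involute x * CliffordAlgebra.ι Q v =
      CliffordAlgebra.contractLeft (QuadraticMap.polarBilin Q v) x := by
  induction x using CliffordAlgebra.left_induction with
  | algebraMap r =>
    rw [CliffordAlgebra.contractLeft_algebraMap, AlgHom.commutes, Algebra.commutes, sub_self]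
  | add x y hx hy =>
    rw [map_add, map_add, ← hx, ← hy, mul_add, add_mul]
    abel
  | ι_mul x a hx =>
    rw [CliffordAlgebra.contractLeft_ι_mul, ← hx, map_mul, CliffordAlgebra.involute_ι,
      QuadraticMap.polarBilin_apply_apply, Algebra.smul_def,
      ← CliffordAlgebra.ι_mul_ι_add_swap v a]
    noncomm_ring

/-- Over a finite field, the polar form of a nonsingular quadratic form has radical of dimension
at most one. -/
theorem QuadNonsingular.exists_radical_eq_smul [Finite K] (hQ : QuadNonsingular Q) :
    ∃ r : V, ∀ v, (∀ w, QuadraticMap.polar Q w v = 0) → ∃ c : K, v = c • r := by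
  by_cases h : ∃ r, r ≠ 0 ∧ ∀ w, QuadraticMap.polar Q w r = 0
  · obtain ⟨r, hr0, hr⟩ := h
    have hQr : Q r ≠ 0 := fun h0 => hr0 (hQ r h0 fun w => by
      rw [QuadraticMap.polar_comm]; exact hr w)
    have h2 : (2 : K) = 0 := by
      have := hr r
      rw [QuadraticMap.polar_self] at this
      simpa [hQr] using this
    have : CharP K 2 := CharTwo.of_one_ne_zero_of_two_eq_zero one_ne_zero h2
    refine ⟨r, fun v hv => ?_⟩
    -- in characteristic two all scalars are squares, so `v` can be compared with a multiple of `r`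
    -- having the same value of `Q`; the difference is isotropic and in the radical
    obtain ⟨c, hc⟩ := FiniteField.isSquare_of_char_two (ringChar.eq K 2 ▸ rfl) (Q v / Q r)
    refine ⟨c, ?_⟩
    rw [← sub_eq_zero]
    refine hQ _ ?_ fun w => ?_
    · have h1 : Q (v - c • r) = Q v + Q (-(c • r)) + QuadraticMap.polar Q v (-(c • r)) := by
        rw [QuadraticMap.polar, sub_eq_add_neg]; ring
      rw [h1, QuadraticMap.map_neg, QuadraticMap.map_smul, ← hc, ← neg_smul,
        QuadraticMap.polar_smul_right, hr, smul_zero, smul_eq_mul, div_mul_cancel₀ _ hQr,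
        ← two_mul, h2, zero_mul, add_zero]
    · rw [QuadraticMap.polar_comm, QuadraticMap.polar_sub_right, QuadraticMap.polar_smul_right,
        hv, hr, smul_zero, sub_zero]
  · push Not at h
    refine ⟨0, fun v hv => ⟨0, ?_⟩⟩
    by_contra h0
    obtain ⟨w, hw⟩ := h v (by simpa using h0)
    exact hw (hv w)

/-- Even elements of the Clifford algebra that commute with all vectors are scalars. -/
theorem QuadNonsingular.exists_algebraMap_eq [Finite K] [FiniteDimensional K V]
    (hQ : QuadNonsingular Q) (x : CliffordAlgebra Q) (hx : x ∈ CliffordAlgebra.evenOdd Q 0)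
    (hc : ∀ v, CliffordAlgebra.ι Q v * x = x * CliffordAlgebra.ι Q v) :
    ∃ a : K, x = algebraMap K _ a := by
  have h0 : ∀ v, CliffordAlgebra.contractLeft (QuadraticMap.polarBilin Q v) x = 0 := fun v => by
    rw [← CliffordAlgebra.ι_mul_sub_involute_mul_ι, CliffordAlgebra.involute_eq_of_mem_even hx,
      hc, sub_self]
  obtain ⟨B, hB⟩ := LinearMap.BilinMap.toQuadraticMap_surjective (R := K) (-Q)
  have h : B.toQuadraticMap = (0 : QuadraticForm K V) - Q := by rw [hB, zero_sub]
  set y : ExteriorAlgebra K V := CliffordAlgebra.changeForm h x with hy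
  have hy0 : ∀ v, CliffordAlgebra.contractLeft (Q := (0 : QuadraticForm K V))
      (QuadraticMap.polarBilin Q v) y = 0 := fun v => by
    rw [hy, ← CliffordAlgebra.changeForm_contractLeft, h0, map_zero]
  obtain ⟨p, hp, hpy⟩ := ExteriorAlgebra.exists_map_eq_self_of_contractLeft_eq_zero _ y hy0
  obtain ⟨r, hr⟩ := hQ.exists_radical_eq_smul
  obtain ⟨a, c, hac⟩ := ExteriorAlgebra.exists_map_eq_of_forall_eq_smul p r
    (fun v => hr _ (hp v)) y
  have hxa : x = algebraMap K _ a + CliffordAlgebra.ι Q (c • r) := by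
    apply (CliffordAlgebra.changeFormEquiv h).injective
    change CliffordAlgebra.changeForm h x = CliffordAlgebra.changeForm h _
    rw [map_add, CliffordAlgebra.changeForm_algebraMap, CliffordAlgebra.changeForm_ι, ← hy, ← hpy,
      hac]
  have hev : CliffordAlgebra.ι Q (c • r) ∈ CliffordAlgebra.evenOdd Q 0 := by
    have : CliffordAlgebra.ι Q (c • r) = x - algebraMap K _ a := by rw [hxa]; abel
    rw [this]
    exact Submodule.sub_mem _ hx (SetLike.algebraMap_mem_graded (CliffordAlgebra.evenOdd Q) a)
  have h0 : CliffordAlgebra.ι Q (c • r) = 0 :=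
    Submodule.disjoint_def.1 (CliffordAlgebra.evenOdd_isCompl (Q := Q)).disjoint _ hev
      (CliffordAlgebra.ι_mem_evenOdd_one Q _)
  exact ⟨a, by rw [hxa, h0, add_zero]⟩

end Clifford

/-! ### The vector representation of the spin group -/

section Spin

variable {K V : Type*} [Field K] [AddCommGroup V] [Module K V] {Q : QuadraticForm K V}

theorem quadratic_spinVectorRep (g : spinGroup Q) (v : V) : Q (spinVectorRep Q g v) = Q v := by
  have hinj : Function.Injective (algebraMap K (CliffordAlgebra Q)) :=
    CliffordAlgebra.algebraMap_injective_of_field Q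
  apply hinj
  have h := ι_spinVectorAction Q g v
  have hg : ((g⁻¹ : spinGroup Q) : CliffordAlgebra Q) * (g : CliffordAlgebra Q) = 1 := by
    rw [← Submonoid.coe_mul, inv_mul_cancel]; rfl
  have hg' : (g : CliffordAlgebra Q) * ((g⁻¹ : spinGroup Q) : CliffordAlgebra Q) = 1 := by
    rw [← Submonoid.coe_mul, mul_inv_cancel]; rfl
  change algebraMap K _ (Q (spinVectorAction Q g v)) = _
  rw [← CliffordAlgebra.ι_sq_scalar, h]
  calc _ = (g : CliffordAlgebra Q) * CliffordAlgebra.ι Q v *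
        (((g⁻¹ : spinGroup Q) : CliffordAlgebra Q) * (g : CliffordAlgebra Q)) *
        CliffordAlgebra.ι Q v * ((g⁻¹ : spinGroup Q) : CliffordAlgebra Q) := by noncomm_ring
    _ = (g : CliffordAlgebra Q) * (CliffordAlgebra.ι Q v * CliffordAlgebra.ι Q v) *
        ((g⁻¹ : spinGroup Q) : CliffordAlgebra Q) := by rw [hg]; noncomm_ring
    _ = _ := by rw [CliffordAlgebra.ι_sq_scalar, ← Algebra.commutes, mul_assoc, hg', mul_one]

/-- Elements of the spin group with the same image in the orthogonal group differ by a sign. -/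
theorem QuadNonsingular.eq_or_eq_neg_of_spinVectorRep_eq [Finite K] [FiniteDimensional K V]
    (hQ : QuadNonsingular Q) {g h : spinGroup Q} (hgh : spinVectorRep Q g = spinVectorRep Q h) :
    (h : CliffordAlgebra Q) = g ∨ (h : CliffordAlgebra Q) = -g := by
  set x : spinGroup Q := g⁻¹ * h with hx
  have hx1 : spinVectorRep Q x = 1 := by rw [hx, map_mul, ← hgh, ← map_mul, inv_mul_cancel, map_one]
  have hc : ∀ v, CliffordAlgebra.ι Q v * (x : CliffordAlgebra Q) = x * CliffordAlgebra.ι Q v := by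
    intro v
    have h1 := ι_spinVectorAction Q x v
    have h2 : spinVectorAction Q x v = v := LinearMap.congr_fun hx1 v
    rw [h2] at h1
    have hxx : ((x⁻¹ : spinGroup Q) : CliffordAlgebra Q) * (x : CliffordAlgebra Q) = 1 := by
      rw [← Submonoid.coe_mul, inv_mul_cancel]; rfl
    calc _ = _ * CliffordAlgebra.ι Q v * _ * _ := by rw [← h1]
      _ = _ := by rw [mul_assoc _ _ (x : CliffordAlgebra Q), hxx, mul_one]
  obtain ⟨a, ha⟩ := hQ.exists_algebraMap_eq (x : CliffordAlgebra Q) (spinGroup.mem_even x.2) hc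
  -- the scalar `a` has spinor norm `a * a`
  have haa : a * a = 1 := by
    have h1 := spinGroup.coe_star_mul_self x
    rw [ha, CliffordAlgebra.star_algebraMap, ← map_mul] at h1
    exact CliffordAlgebra.algebraMap_injective_of_field Q (h1.trans (map_one _).symm)
  have hgx : (h : CliffordAlgebra Q) = g * x := by
    rw [← Submonoid.coe_mul, hx, mul_inv_cancel_left]
  rcases mul_self_eq_one_iff.1 haa with rfl | rfl
  · left; rw [hgx, ha, map_one, mul_one]
  · right; rw [hgx, ha, map_neg, map_one, mul_neg, mul_one]

/-- The vector representation has a kernel of order at most two, hence the centralizer of an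
element of the spin group is at most twice as large as the centralizer of its image among the
isometries. -/
theorem QuadNonsingular.card_centralizer_le [Finite K] [FiniteDimensional K V]
    (hQ : QuadNonsingular Q) (g : spinGroup Q) :
    Nat.card (Subgroup.centralizer {g}) ≤
      2 * {h : Module.End K V | Commute h (spinVectorRep Q g) ∧ ∀ v, Q (h v) = Q v}.ncard := by
  classical
  cases finite_or_infinite (Subgroup.centralizer {g})
  swap
  · simp
  have : Finite V := Module.finite_of_finite K
  have : Finite (Module.End K V) :=
    Finite.of_injective (fun f : Module.End K V => (f : V → V)) DFunLike.coe_injective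
  have := Fintype.ofFinite (Subgroup.centralizer {g})
  rw [Nat.card_eq_fintype_card, ← Finset.card_univ]
  set f : Subgroup.centralizer {g} → Module.End K V := fun x => spinVectorRep Q x with hf
  refine (Finset.card_le_mul_card_image (f := f) Finset.univ 2 fun b hb => ?_).trans
    (Nat.mul_le_mul_left 2 ?_)
  · obtain ⟨a, -, rfl⟩ := Finset.mem_image.1 hb
    refine le_trans (Finset.card_le_card_of_injOn (t := {((a : spinGroup Q) : CliffordAlgebra Q),
      -((a : spinGroup Q) : CliffordAlgebra Q)})
      (fun x => ((x : spinGroup Q) : CliffordAlgebra Q)) (fun x hx => ?_) fun x _ y _ hxy => ?_)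
      Finset.card_le_two
    · have hx' : f x = f a := by simpa using hx
      simpa using hQ.eq_or_eq_neg_of_spinVectorRep_eq hx'.symm
    · exact Subtype.ext (Subtype.ext hxy)
  · rw [← Set.ncard_coe_finset]
    refine Set.ncard_le_ncard (fun b hb => ?_) (Set.toFinite _)
    obtain ⟨a, -, rfl⟩ := Finset.mem_image.1 (Finset.mem_coe.1 hb)
    refine ⟨?_, quadratic_spinVectorRep _⟩
    have h := Subgroup.mem_centralizer_singleton_iff.1 a.2
    exact (by rw [hf, ← map_mul, ← map_mul, h] :
      f a * spinVectorRep Q g = spinVectorRep Q g * f a)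

/-- In odd dimension the generators `ι a` of the Lipschitz group act on the vectors by negatives of
reflections, and these have determinant one. -/
theorem exists_det_eq_one_of_mem_lipschitzGroup [FiniteDimensional K V]
    (hodd : Odd (Module.finrank K V)) {x : (CliffordAlgebra Q)ˣ} (hx : x ∈ lipschitzGroup Q) :
    ∃ T : Module.End K V, LinearMap.det T = 1 ∧ ∀ v, CliffordAlgebra.ι Q (T v) =
      (x : CliffordAlgebra Q) * CliffordAlgebra.ι Q v *
        ((x⁻¹ : (CliffordAlgebra Q)ˣ) : CliffordAlgebra Q) := by
  have : Nontrivial (CliffordAlgebra Q) :=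
    (CliffordAlgebra.algebraMap_injective_of_field Q).nontrivial
  have key : ∀ (x : (CliffordAlgebra Q)ˣ) (a : V), CliffordAlgebra.ι Q a = x → Q a ≠ 0 := by
    intro x a ha h0
    have h := CliffordAlgebra.ι_sq_scalar Q a
    rw [h0, map_zero, ha, ← Units.val_mul] at h
    exact (x * x).ne_zero h
  have hdet : ∀ (a : V) (c : K), c * Q a = 1 → LinearMap.det
      ((c • QuadraticMap.polarBilin Q a).smulRight a - LinearMap.id : Module.End K V) = 1 := by
    intro a c hc
    have h : ((c • QuadraticMap.polarBilin Q a).smulRight a - LinearMap.id : Module.End K V) =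
        -LinearMap.transvection (-(c • QuadraticMap.polarBilin Q a)) a := by
      ext v
      simp [LinearMap.transvection.apply, sub_eq_add_neg]
    rw [h, ← neg_one_smul K, LinearMap.det_smul, hodd.neg_one_pow, LinearMap.transvection.det]
    simp only [LinearMap.neg_apply, LinearMap.smul_apply, QuadraticMap.polarBilin_apply_apply,
      QuadraticMap.polar_self, smul_eq_mul]
    linear_combination 2 * hc
  unfold lipschitzGroup at hx
  induction hx using Subgroup.closure_induction'' with
  | mem x hx =>
    obtain ⟨a, ha⟩ := hx
    let := x.invertible
    let : Invertible (CliffordAlgebra.ι Q a) := by rwa [ha]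
    let : Invertible (Q a) := invertibleOfNonzero (key x a ha)
    refine ⟨_, hdet a (⅟(Q a)) (invOf_mul_self _), fun v => ?_⟩
    rw [← invOf_units x]
    simp_rw [← ha, CliffordAlgebra.ι_mul_ι_mul_invOf_ι]
    simp
  | inv_mem x hx =>
    obtain ⟨a, ha⟩ := hx
    let := x.invertible
    let : Invertible (CliffordAlgebra.ι Q a) := by rwa [ha]
    let : Invertible (Q a) := invertibleOfNonzero (key x a ha)
    refine ⟨_, hdet a (⅟(Q a)) (invOf_mul_self _), fun v => ?_⟩
    rw [← invOf_units x, inv_inv]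
    simp_rw [← ha, CliffordAlgebra.invOf_ι_mul_ι_mul_ι]
    simp
  | one => exact ⟨1, by simp, by simp⟩
  | mul y z _ _ hy hz =>
    obtain ⟨T, hT, hT'⟩ := hy
    obtain ⟨U, hU, hU'⟩ := hz
    refine ⟨T * U, by rw [map_mul, hT, hU, one_mul], fun v => ?_⟩
    rw [Module.End.mul_apply, hT', hU', mul_inv_rev, Units.val_mul, Units.val_mul]
    simp only [mul_assoc]

theorem det_spinVectorRep_of_odd [FiniteDimensional K V] (hodd : Odd (Module.finrank K V))
    (g : spinGroup Q) : LinearMap.det (spinVectorRep Q g) = 1 := by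
  obtain ⟨T, hT, hT'⟩ := exists_det_eq_one_of_mem_lipschitzGroup hodd
    (x := spinGroup.toUnits g) (spinGroup.units_mem_lipschitzGroup g.2)
  rw [← hT]
  congr 1
  ext v
  apply clifford_ι_injective Q
  rw [hT']
  exact ι_spinVectorAction Q g v

/-- In odd dimension, an element of the spin group whose characteristic polynomial has quotient `P`
by `X - 1` with `P(0) = 1` has characteristic polynomial exactly `(X - 1) P`. -/
theorem spinCharpoly_eq_of_spinOddCharpoly_eq [FiniteDimensional K V]
    (hodd : Odd (Module.finrank K V)) {g : spinGroup Q} {P : K[X]}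
    (h : spinOddCharpoly Q g = P) (hP : P.eval 0 = 1) :
    spinCharpoly Q g = (X - C 1) * P := by
  have h0 : (spinCharpoly Q g).eval 0 = -1 := by
    have := LinearMap.det_eq_sign_charpoly_coeff (spinVectorRep Q g)
    rw [det_spinVectorRep_of_odd hodd, hodd.neg_one_pow] at this
    rw [spinCharpoly, ← coeff_zero_eq_eval_zero]
    linear_combination this
  have h1 := modByMonic_add_div (spinCharpoly Q g) (X - C 1)
  rw [modByMonic_X_sub_C_eq_C_eval] at h1
  rw [spinOddCharpoly] at h
  rw [h] at h1
  have h2 := congrArg (eval 0) h1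
  simp only [eval_add, eval_C, eval_mul, eval_sub, eval_X, hP, h0] at h2
  have h3 : (spinCharpoly Q g).eval 1 = 0 := by linear_combination h2
  rw [h3, C_0, zero_add] at h1
  exact h1.symm

end Spin

/-! ### The three families of polynomials -/

section Families

variable {K : Type*} [Field K] [Finite K]

theorem two_le_natCard_cast : (2 : ℝ) ≤ Nat.card K := by
  exact_mod_cast Finite.one_lt_card (α := K)

omit [Finite K] in
open Classical in
theorem card_toFinset_nthRoots_le (n : ℕ) : (nthRoots n (1 : K)).toFinset.card ≤ n :=
  (Multiset.toFinset_card_le _).trans (card_nthRoots n 1)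

theorem sliceBounds_monic {n : ℕ} (hn : 2 ≤ n) {c : K} (hc : c ≠ 0) :
    SliceBounds (fun P : K[X] => P.Monic ∧ P.coeff 0 ≠ 0) (Nat.card K) (Nat.card K : ℝ)⁻¹ n c := by
  have h2 := two_le_natCard_cast (K := K)
  have hpow : ∀ m : ℕ, 1 ≤ m → (Nat.card K : ℝ)⁻¹ * (Nat.card K : ℝ) ^ m =
      (Nat.card K : ℝ) ^ (m - 1) := by
    intro m hm
    obtain ⟨k, rfl⟩ := Nat.exists_eq_add_of_le' hm
    rw [pow_succ', inv_mul_cancel_left₀ (by positivity), Nat.add_sub_cancel]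
  refine ⟨isDivisorFamily_coeff_zero_ne, by linarith, by positivity, hn, fun h => h.2,
    fun m c hm => ?_, ?_, ?_⟩
  · rw [hpow m hm]
    exact_mod_cast card_slice_monic_le m c
  · rw [hpow n (by omega)]
    exact_mod_cast le_card_slice_monic (by omega) hc
  · have := Fintype.ofFinite K
    refine ⟨Finset.univ, fun _ _ => Finset.mem_univ _, ?_⟩
    rw [Finset.card_univ, ← Nat.card_eq_fintype_card, mul_inv_cancel₀ (by positivity)]
    norm_num

/-- Polynomials that are self-dual with respect to the identity have constant term `1` or `-1`. -/
theorem sliceBounds_selfDual_id {r : ℕ} (hr : 1 ≤ r) :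
    SliceBounds (IsSelfDual (RingHom.id K)) √(Nat.card K) 1 (2 * r) 1 := by
  classical
  have h2 := two_le_natCard_cast (K := K)
  have hs : 4 / 3 ≤ √(Nat.card K : ℝ) := Real.le_sqrt_of_sq_le (by norm_num; linarith)
  refine ⟨isDivisorFamily_isSelfDual fun _ => rfl, hs, one_pos, by omega,
    fun h => h.coeff_zero_ne, fun m c _ => ?_, ?_, ⟨(nthRoots 2 (1 : K)).toFinset,
    fun D hD => ?_, ?_⟩⟩
  · rw [one_mul]
    calc ((slice (IsSelfDual (RingHom.id K)) m c).card : ℝ) ≤ (Nat.card K : ℝ) ^ (m / 2) := by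
          exact_mod_cast card_slice_selfDual_id_le m c
      _ = √(Nat.card K : ℝ) ^ (2 * (m / 2)) := by rw [pow_mul, Real.sq_sqrt (by positivity)]
      _ ≤ _ := pow_le_pow_right₀ (by linarith) (Nat.mul_div_le m 2)
  · rw [one_mul, pow_mul, Real.sq_sqrt (by positivity)]
    exact_mod_cast le_card_slice_selfDual_id (K := K) hr
  · rw [Multiset.mem_toFinset, mem_nthRoots two_pos]
    have := hD.coeff_eq (Nat.zero_le _)
    rw [Nat.sub_zero, hD.monic.coeff_natDegree] at this
    simpa [sq] using this.symm
  · rw [mul_one]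
    exact (Nat.cast_le.2 (card_toFinset_nthRoots_le (K := K) 2)).trans (by norm_num)

omit [Field K] [Finite K] in
theorem sqrt_natCard_eq {q : ℕ} (hq : Nat.card K = q ^ 2) : √(Nat.card K : ℝ) = q := by
  rw [hq, Nat.cast_pow, Real.sqrt_sq (Nat.cast_nonneg _)]

theorem two_le_of_natCard_eq_sq {q : ℕ} (hq : Nat.card K = q ^ 2) : 2 ≤ q := by
  have := Finite.one_lt_card (α := K)
  rw [hq] at this
  by_contra h
  interval_cases q <;> omega

/-- The `q`-Frobenius of a field with `q²` elements is not the identity. -/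
theorem exists_pow_ne_self {q : ℕ} (hq : Nat.card K = q ^ 2) : ∃ t : K, t ^ q ≠ t := by
  classical
  by_contra! h
  have h2 := two_le_of_natCard_eq_sq hq
  have := Fintype.ofFinite K
  have h0 : (X ^ q - X : K[X]) ≠ 0 := FiniteField.X_pow_card_sub_X_ne_zero K (by omega)
  have h1 : (Finset.univ : Finset K) ⊆ (X ^ q - X : K[X]).roots.toFinset := by
    intro t _
    rw [Multiset.mem_toFinset, mem_roots h0]
    simp [h t]
  have h3 := (Finset.card_le_card h1).trans
    ((Multiset.toFinset_card_le _).trans (card_roots' _))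
  rw [FiniteField.X_pow_card_sub_X_natDegree_eq K (by omega), Finset.card_univ,
    ← Nat.card_eq_fintype_card, hq] at h3
  nlinarith

/-- Polynomials that are self-dual with respect to the `q`-Frobenius have as constant term one of
the `q + 1` elements of norm one. -/
theorem sliceBounds_selfDual_star [StarRing K] {q : ℕ} (hq : Nat.card K = q ^ 2)
    (hstar : ∀ x : K, star x = x ^ q) {n : ℕ} (hn : 2 ≤ n) {e : K} (he : e * e = 1)
    (hse : star e = e) :
    SliceBounds (IsSelfDual (starRingEnd K)) √(Nat.card K) (q : ℝ)⁻¹ n e := by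
  classical
  have hq2 := two_le_of_natCard_eq_sq hq
  have hq2' : (2 : ℝ) ≤ q := by exact_mod_cast hq2
  obtain ⟨t, ht⟩ := exists_pow_ne_self hq
  have ht' : starRingEnd K t ≠ t := by rwa [starRingEnd_apply, hstar]
  have hpow : ∀ m : ℕ, 1 ≤ m → (q : ℝ)⁻¹ * (q : ℝ) ^ m = (q : ℝ) ^ (m - 1) := by
    intro m hm
    obtain ⟨k, rfl⟩ := Nat.exists_eq_add_of_le' hm
    rw [pow_succ', inv_mul_cancel_left₀ (by positivity), Nat.add_sub_cancel]
  rw [sqrt_natCard_eq hq]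
  refine ⟨isDivisorFamily_isSelfDual star_star, by linarith, by positivity, hn,
    fun h => h.coeff_zero_ne, fun m c hm => ?_, ?_,
    ⟨(nthRoots (q + 1) (1 : K)).toFinset, fun D hD => ?_, ?_⟩⟩
  · rw [hpow m hm]
    have := card_slice_selfDual_sq_le ht' hm c
    rw [hq, ← pow_mul, mul_comm, pow_mul] at this
    exact_mod_cast (Nat.pow_le_pow_iff_left two_ne_zero).1 this
  · rw [hpow n (by omega)]
    have := le_card_slice_selfDual_sq star_star ht' (show 1 ≤ n by omega) he hse
    rw [hq, ← pow_mul, mul_comm, pow_mul] at this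
    exact_mod_cast (Nat.pow_le_pow_iff_left two_ne_zero).1 this
  · rw [Multiset.mem_toFinset, mem_nthRoots (by omega)]
    have := hD.coeff_eq (Nat.zero_le _)
    rw [Nat.sub_zero, hD.monic.coeff_natDegree, map_one, starRingEnd_apply, hstar] at this
    rw [pow_succ, ← this]
  · have h1 : ((nthRoots (q + 1) (1 : K)).toFinset.card : ℝ) ≤ q + 1 :=
      (Nat.cast_le.2 (card_toFinset_nthRoots_le (K := K) (q + 1))).trans (by push_cast; rfl)
    rw [mul_inv_le_iff₀ (by positivity)]
    linarith

theorem linearPolys_eq_slice (n : ℕ) : linearPolys K n =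
    ↑(slice (fun P : K[X] => P.Monic ∧ P.coeff 0 ≠ 0) n ((-1) ^ n)) := by
  ext P
  simp only [linearPolys, Set.mem_ofPred_eq, Finset.mem_coe, mem_slice, ← coeff_zero_eq_eval_zero]
  constructor
  · rintro ⟨h1, h2, h3⟩
    exact ⟨⟨h1, h3 ▸ pow_ne_zero _ (neg_ne_zero.2 one_ne_zero)⟩, h2, h3⟩
  · rintro ⟨⟨h1, -⟩, h2, h3⟩
    exact ⟨h1, h2, h3⟩

theorem unitaryPolys_eq_slice [StarRing K] (n : ℕ) : unitaryPolys K n =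
    ↑(slice (IsSelfDual (starRingEnd K)) n ((-1) ^ n)) := by
  ext P
  simp only [unitaryPolys, Set.mem_ofPred_eq, Finset.mem_coe, mem_slice, coeff_zero_eq_eval_zero]
  constructor
  · rintro ⟨h1, h2, h3, h4⟩
    exact ⟨isSelfDual_of_dualPoly h1 (h4 ▸ pow_ne_zero _ (neg_ne_zero.2 one_ne_zero)) h3, h2, h4⟩
  · rintro ⟨h1, h2, h3⟩
    exact ⟨h1.monic, h2, h1.dualPoly_eq, h3⟩

theorem orthogonalPolys_eq_slice (n : ℕ) : orthogonalPolys K n =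
    ↑(slice (IsSelfDual (RingHom.id K)) n 1) := by
  ext P
  simp only [orthogonalPolys, Set.mem_ofPred_eq, Finset.mem_coe, mem_slice,
    coeff_zero_eq_eval_zero]
  constructor
  · rintro ⟨h1, h2, h3, h4⟩
    exact ⟨isSelfDual_of_dualPoly h1 (h4 ▸ one_ne_zero) (by rwa [map_id]), h2, h4⟩
  · rintro ⟨h1, h2, h3⟩
    exact ⟨h1.monic, h2, by simpa using h1.dualPoly_eq, h3⟩

/-- Polynomials with large centralizers are few if they are all exceptional. -/
theorem fewLargeCentralizers_of_card_exceptional_lt {Γ : Type*} [Group Γ] {f : Γ → K[X]}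
    {S : Set K[X]} {B ε : ℝ} {F : K[X] → Prop} {n : ℕ} {c₀ : K} {E : Finset K[X]} {s M s₀ : ℝ}
    {Δ : ℕ} (hS : S = ↑(slice F n c₀))
    (hcard : open Classical in
      (Finset.card {P ∈ slice F n c₀ | IsExceptional F E s M s₀ Δ P} : ℝ) <
        ε * (slice F n c₀).card)
    (h : ∀ g, f g ∈ slice F n c₀ → ¬ IsExceptional F E s M s₀ Δ (f g) →
      (Nat.card (Subgroup.centralizer {g}) : ℝ) ≤ B) : FewLargeCentralizers f S B ε := by
  classical
  subst hS
  rw [FewLargeCentralizers, Set.ncard_coe_finset]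
  refine lt_of_le_of_lt ?_ hcard
  rw [← Set.ncard_coe_finset, Nat.cast_le]
  refine Set.ncard_le_ncard ?_ (Finset.finite_toSet _)
  rintro P ⟨hP, g, rfl, hg⟩
  rw [Finset.mem_coe, Finset.mem_filter]
  exact ⟨hP, by_contra fun hn => (h g hP hn).not_gt hg⟩

/-- A polynomial that is not exceptional is a product of a factor `R` of small degree, which is
trivial if the field is large, and a squarefree factor `S` prime to `R` and to `E₀`. -/
theorem exists_factorization_of_not_isExceptional {F : K[X] → Prop} (hF : IsDivisorFamily F)
    {E : Finset K[X]} {E₀ : K[X]} (hE₀ : F E₀) (hdeg : E₀.natDegree ≤ 2)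
    (hE : ∀ R, F R → R ∣ E₀ → R ≠ 1 → ∃ D ∈ E, D ∣ R) {s M s₀ : ℝ} {Δ : ℕ} (hs : 0 ≤ s)
    {P : K[X]} (hP : F P) (h : ¬ IsExceptional F E s M s₀ Δ P) :
    ∃ R S, F R ∧ F S ∧ P = R * S ∧ Squarefree S ∧ IsCoprime R S ∧ IsCoprime S E₀ ∧
      R.natDegree ≤ 3 * Δ + 2 ∧ (s₀ ≤ s → R = 1) ∧ weightedDivisorSum F s S ≤ M := by
  simp only [IsExceptional, not_or, not_lt, not_exists, not_and] at h
  obtain ⟨hM, hΔ, hlarge⟩ := h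
  obtain ⟨D, R, S, hD, hR, hS, hDP, rfl, hsq, hRS, hSE, hRdeg, hD1⟩ :=
    hF.exists_coprime_factorization hP hE₀
  refine ⟨R, S, hR, hS, rfl, hsq, hRS, hSE, ?_, fun hs₀ => ?_, ?_⟩
  · have : D.natDegree < Δ := by
      by_contra hn
      exact hΔ D hD (not_lt.1 hn) hDP
    omega
  · obtain ⟨h1, h2⟩ := hlarge hs₀
    have hD0 : D.natDegree = 0 := by
      by_contra hn
      exact h1 D hD (Nat.one_le_iff_ne_zero.2 hn) hDP
    have hRE := hD1 ((hF.monic hD).natDegree_eq_zero.1 hD0)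
    by_contra hR1
    obtain ⟨D', hD', hDR⟩ := hE R hR hRE hR1
    exact h2 D' hD' (hDR.mul_right S)
  · exact (weightedDivisorSum_le_of_dvd F hs (dvd_mul_left S R) (hF.monic hP).ne_zero).trans hM

end Families

/-! ### Centralizers over polynomials that are not exceptional -/

/-- A set in the kernel of a multiplicative map `φ`, some translates of which lie in `G` and realize
all values of `φ` in `T`, is smaller than `G` by a factor of the size of `T`. -/
theorem ncard_mul_ncard_le {A N : Type*} [Monoid A] [Monoid N] (φ : A →* N)
    {H G : Set A} (hG : G.Finite) (T : Set N) (hH : ∀ x ∈ H, φ x = 1)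
    (hT : ∀ t ∈ T, ∃ u, IsUnit u ∧ φ u = t ∧ ∀ x ∈ H, x * u ∈ G) :
    H.ncard * T.ncard ≤ G.ncard := by
  choose! u hu hφ hG' using hT
  rw [← Set.ncard_prod]
  refine Set.ncard_le_ncard_of_injOn (fun z : A × N => z.1 * u z.2)
    (fun z hz => hG' _ hz.2 _ hz.1) ?_ hG
  rintro ⟨x, t⟩ ⟨hx, ht⟩ ⟨y, s⟩ ⟨hy, hs⟩ hxy
  have h1 := congrArg φ hxy
  simp only [map_mul, hH x hx, hH y hy, hφ t ht, hφ s hs, one_mul] at h1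
  subst h1
  exact Prod.ext ((hu t ht).mul_left_injective hxy) rfl

section Bounds

variable {K V : Type*} [Field K] [Finite K] [AddCommGroup V] [Module K V] [FiniteDimensional K V]

/-- The number of isometries commuting with an isometry `g` whose characteristic polynomial is
`L P`, where `P` is not exceptional and `L` has degree at most one. Over a small field the repeated
part of the characteristic polynomial contributes a bounded factor; over a large field there is no
repeated part. -/
theorem ncard_commuting_isometries_le {σ : K →+* K} (hσ : ∀ x, σ (σ x) = x)
    {B : V →ₗ[K] V →ₛₗ[σ] K} {g : Module.End K V} (hg : ∀ v w, B (g v) (g w) = B v w)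
    {L P E₀ : K[X]} (hχ : g.charpoly = L * P) (hL : IsSelfDual σ L) (hLdeg : L.natDegree ≤ 1)
    (hLE : L ∣ E₀) (hE₀ : IsSelfDual σ E₀) (hdeg : E₀.natDegree ≤ 2) {E : Finset K[X]}
    (hE : ∀ R, IsSelfDual σ R → R ∣ E₀ → R ≠ 1 → ∃ D ∈ E, D ∣ R)
    (ht : (∃ c, σ c ≠ c) ∨ X ^ 2 - 1 ∣ E₀)
    (hB : ∀ v, (∀ w, B v w = 0) → aeval g E₀ v = 0)
    (hP : IsSelfDual σ P) {M s₀ : ℝ} {Δ : ℕ} (hs₀ : 1 ≤ s₀)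
    (h : ¬ IsExceptional (IsSelfDual σ) E √(Nat.card K) M s₀ Δ P)
    {H : Set (Module.End K V)} (hHg : ∀ x ∈ H, Commute x g)
    (hHB : ∀ x ∈ H, ∀ v w, B (x v) (x w) = B v w)
    (hHL : IsCoprime L P →
      ((fun x : Module.End K V => x.domRestrict (LinearMap.ker (aeval g L))) '' H).ncard ≤ 2) :
    (H.ncard : ℝ) ≤ 2 * s₀ ^ (2 * (3 * Δ + 3) ^ 2) * M * √(Nat.card K) ^ P.natDegree := by
  have hcard : 1 ≤ √(Nat.card K : ℝ) :=
    Real.one_le_sqrt.2 (by have := two_le_natCard_cast (K := K); linarith)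
  obtain ⟨R, S, hR, hS, hPRS, hsq, hRS, hSE, hRdeg, hR1, hM⟩ :=
    exists_factorization_of_not_isExceptional (isDivisorFamily_isSelfDual hσ) hE₀ hdeg hE
      (Real.sqrt_nonneg _) hP h
  have hLS : IsCoprime (L * R) S := IsCoprime.mul_left (hSE.symm.of_isCoprime_of_dvd_left hLE) hRS
  have hχ' : g.charpoly = (L * R) * S := by rw [hχ, hPRS, mul_assoc]
  have h1 := card_isometries_le_mul hg (hL.mul hR) hS hsq hLS hχ'
    (ht.imp_right fun hd => hSE.of_isCoprime_of_dvd_right hd) (fun v hv hv' => ?_)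
    (fun x : H => (x : Module.End K V)) Subtype.val_injective (fun x => hHg x x.2)
    (fun x => hHB x x.2)
  swap
  · obtain ⟨a, b, hab⟩ := hSE
    have := congrArg (fun p => aeval g p v) hab
    simpa [hv, hB v hv'] using this.symm
  rw [Nat.card_coe_set_eq] at h1
  set N := (Set.range fun x : H => (x : Module.End K V).domRestrict
    (LinearMap.ker (aeval g (L * R)))).ncard with hN
  have hNle : (N : ℝ) ≤ 2 * s₀ ^ (2 * (3 * Δ + 3) ^ 2) := by
    have hpow : 1 ≤ s₀ ^ (2 * (3 * Δ + 3) ^ 2) := one_le_pow₀ hs₀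
    by_cases hlarge : s₀ ≤ √(Nat.card K : ℝ)
    · have hR' := hR1 hlarge
      have hLP : IsCoprime L P := by
        rw [hPRS, hR', one_mul]
        rwa [hR', mul_one] at hLS
      have h2 : N ≤ 2 := by
        rw [hN, hR', mul_one]
        convert hHL hLP using 2
        ext
        simp
      have : (N : ℝ) ≤ 2 := by exact_mod_cast h2
      linarith
    · have h2 : N ≤ Nat.card K ^ (L * R).natDegree ^ 2 :=
        ncard_range_domRestrict_le hLS (hL.mul hR).monic hS.monic hχ' _ (fun x => hHg x x.2)
      have hd : (L * R).natDegree ≤ 3 * Δ + 3 := by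
        rw [hL.monic.natDegree_mul hR.monic]; omega
      calc (N : ℝ) ≤ (Nat.card K : ℝ) ^ (L * R).natDegree ^ 2 := by exact_mod_cast h2
        _ = √(Nat.card K : ℝ) ^ (2 * (L * R).natDegree ^ 2) := by
            rw [pow_mul, Real.sq_sqrt (Nat.cast_nonneg _)]
        _ ≤ √(Nat.card K : ℝ) ^ (2 * (3 * Δ + 3) ^ 2) :=
            pow_le_pow_right₀ hcard (Nat.mul_le_mul_left 2 (Nat.pow_le_pow_left hd 2))
        _ ≤ s₀ ^ (2 * (3 * Δ + 3) ^ 2) := by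
            gcongr
            exact (not_le.1 hlarge).le
        _ ≤ _ := by linarith
  have hdegS : S.natDegree ≤ P.natDegree := by
    rw [hPRS, hR.monic.natDegree_mul hS.monic]; omega
  have hw0 := zero_le_one.trans
    (one_le_weightedDivisorSum (isSelfDual_one (σ := σ)) (Real.sqrt_nonneg (Nat.card K : ℝ)) S)
  have hM0 : 0 ≤ M := hw0.trans hM
  calc (H.ncard : ℝ) ≤ _ := h1
    _ ≤ (2 * s₀ ^ (2 * (3 * Δ + 3) ^ 2)) * (√(Nat.card K : ℝ) ^ P.natDegree * M) := by
        gcongr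
    _ = _ := by ring

omit [Finite K] [FiniteDimensional K V] in
theorem ncard_image_domRestrict_ker_aeval_one_le (g : Module.End K V)
    (H : Set (Module.End K V)) :
    ((fun x : Module.End K V => x.domRestrict (LinearMap.ker (aeval g (1 : K[X])))) '' H).ncard
      ≤ 2 := by
  have : ((fun x : Module.End K V => x.domRestrict (LinearMap.ker (aeval g (1 : K[X])))) '' H)
      ⊆ {0} := by
    rintro _ ⟨x, -, rfl⟩
    rw [Set.mem_singleton_iff]
    ext ⟨v, hv⟩
    have : v = 0 := by simpa using hv
    simp [this]
  exact (Set.ncard_le_ncard this).trans (by simp)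

omit [Finite K] in
theorem X_sub_C_dvd_of_dvd_mul {a b : K} {R : K[X]} (hR : R.Monic)
    (h : R ∣ (X - C a) * (X - C b)) (h1 : R ≠ 1) : X - C a ∣ R ∨ X - C b ∣ R := by
  have hu : ¬ IsUnit R := fun hu => h1 (hR.isUnit_iff.1 hu)
  obtain ⟨p, hp, hpR⟩ := WfDvdMonoid.exists_irreducible_factor hu hR.ne_zero
  rcases hp.prime.dvd_or_dvd (hpR.trans h) with h2 | h2
  · exact Or.inl ((hp.dvd_symm (irreducible_X_sub_C a) h2).trans hpR)
  · exact Or.inr ((hp.dvd_symm (irreducible_X_sub_C b) h2).trans hpR)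

/-- An endomorphism commuting with `g` is determined by its restriction to the kernel of `R(g)` and
its value at a cyclic vector of the kernel of `S(g)`. -/
theorem ncard_commuting_le_mul {g : Module.End K V} {R S : K[X]} (hRS : IsCoprime R S)
    (hR : R.Monic) (hS : S.Monic) (hsq : Squarefree S) (hχ : g.charpoly = R * S)
    {H : Set (Module.End K V)} (hHg : ∀ x ∈ H, Commute x g) :
    H.ncard ≤
      (Set.range fun x : H => (x : Module.End K V).domRestrict (LinearMap.ker (aeval g R))).ncard *
        Nat.card K ^ S.natDegree := by
  set U := LinearMap.ker (aeval g R)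
  set W := LinearMap.ker (aeval g S) with hW
  have : Finite V := Module.finite_of_finite K
  have : Finite (Module.End K V) :=
    Finite.of_injective (fun f : Module.End K V => (f : V → V)) DFunLike.coe_injective
  have hc : IsCompl U W := isCompl_ker_aeval g hRS (hχ ▸ g.aeval_self_charpoly)
  let gW : Module.End K W := g.restrict (map_mem_ker_aeval (Commute.refl g) S)
  have hgW : gW.charpoly = S := (charpoly_restrict_ker_aeval g hRS hR hS hχ).2
  have hrank : Module.finrank K W = S.natDegree := by
    rw [← hgW, LinearMap.charpoly_natDegree]
  obtain ⟨u, -, hu⟩ := exists_cyclic_vector gW (hgW.symm ▸ hsq)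
  have hWcard : Nat.card W = Nat.card K ^ S.natDegree := by
    rw [Module.natCard_eq_pow_finrank (K := K), hrank]
  rw [← hWcard, ← Nat.card_coe_set_eq, ← Nat.card_coe_set_eq, ← Nat.card_prod]
  refine Nat.card_le_card_of_injective
    (fun x : H => (⟨(x : Module.End K V).domRestrict U, x, rfl⟩,
      ⟨(x : Module.End K V) u, map_mem_ker_aeval (hHg x x.2) S u u.2⟩)) fun x y hxy => ?_
  rw [Prod.mk.injEq] at hxy
  have h1 : (x : Module.End K V).domRestrict U = (y : Module.End K V).domRestrict U :=
    Subtype.mk.inj hxy.1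
  have h2 : (x : Module.End K V) u = (y : Module.End K V) u := Subtype.mk.inj hxy.2
  refine Subtype.ext (LinearMap.ext fun v => ?_)
  obtain ⟨a, ha, w, hw, rfl⟩ := Submodule.mem_sup.1 (hc.sup_eq_top ▸ Submodule.mem_top (x := v))
  obtain ⟨p, hp⟩ := hu ⟨w, hw⟩
  have hpw : aeval g p (u : V) = w := by
    rw [← aeval_restrict_apply g (map_mem_ker_aeval (Commute.refl g) S) p u, hp]
  have h3 : ∀ z : H, (z : Module.End K V) w = aeval g p ((z : Module.End K V) u) := by
    intro z
    rw [← hpw]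
    exact LinearMap.congr_fun (commute_aeval (hHg z z.2) p) (u : V)
  rw [map_add, map_add, h3 x, h3 y, h2]
  congr 1
  exact LinearMap.congr_fun h1 ⟨a, ha⟩

/-- The number of endomorphisms of determinant one commuting with an endomorphism whose
characteristic polynomial is not exceptional. Over a large field the determinant takes all values
on the commutant. -/
theorem ncard_commuting_det_one_le {g : Module.End K V} (hpos : 0 < Module.finrank K V)
    (h0 : g.charpoly.coeff 0 ≠ 0) {M s₀ : ℝ} {Δ : ℕ} (hs₀ : 1 ≤ s₀)
    (h : ¬ IsExceptional (fun P : K[X] => P.Monic ∧ P.coeff 0 ≠ 0) ∅ (Nat.card K) M s₀ Δ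
      g.charpoly)
    {H : Set (Module.End K V)} (hHg : ∀ x ∈ H, Commute x g)
    (hH1 : ∀ x ∈ H, LinearMap.det x = 1) :
    (H.ncard : ℝ) ≤
      2 * s₀ ^ ((3 * Δ + 3) ^ 2 + 1) * (Nat.card K : ℝ) ^ (Module.finrank K V - 1) := by
  have h2 := two_le_natCard_cast (K := K)
  have hcard : (1 : ℝ) ≤ Nat.card K := by linarith
  have hpow1 := fun m : ℕ => one_le_pow₀ (n := m) hs₀
  have : Finite V := Module.finite_of_finite K
  have : Finite (Module.End K V) :=
    Finite.of_injective (fun f : Module.End K V => (f : V → V)) DFunLike.coe_injective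
  obtain ⟨k, hk⟩ := Nat.exists_eq_add_of_le' hpos
  have hn := g.charpoly_natDegree
  rw [hk, Nat.add_sub_cancel]
  obtain ⟨R, S, hR, hS, hPRS, hsq, hRS, -, hRdeg, hR1, -⟩ :=
    exists_factorization_of_not_isExceptional isDivisorFamily_coeff_zero_ne
      (E₀ := 1) (by simp) (by simp) (fun R hR hR1 hne =>
        absurd (hR.1.isUnit_iff.1 (isUnit_of_dvd_one hR1)) hne) (Nat.cast_nonneg _)
      ⟨g.charpoly_monic, h0⟩ h
  by_cases hlarge : s₀ ≤ (Nat.card K : ℝ)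
  -- multiplication by elements of `K[g]` with all nonzero determinants embeds `H × Kˣ` in the
  -- commutant
  · rw [hR1 hlarge, one_mul] at hPRS
    rw [← hPRS] at hsq
    have h3 : H.ncard * ({0}ᶜ : Set K).ncard ≤ {x : Module.End K V | Commute x g}.ncard := by
      refine ncard_mul_ncard_le LinearMap.det (Set.toFinite _) _ hH1 fun t ht => ?_
      obtain ⟨p, hp⟩ := exists_det_aeval_eq g hsq hpos t
      refine ⟨aeval g p, ?_, hp, fun x hx =>
        (hHg x hx).mul_left (commute_aeval (Commute.refl g) p).symm⟩
      rw [LinearMap.isUnit_iff_isUnit_det, hp]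
      exact IsUnit.mk0 _ ht
    have h4 := ncard_commuting_le_mul (g := g) (isCoprime_one_left (x := g.charpoly)) monic_one
      g.charpoly_monic hsq (one_mul _).symm (H := {x : Module.End K V | Commute x g})
      fun x hx => hx
    have h5 := ncard_range_domRestrict_le (g := g) (isCoprime_one_left (x := g.charpoly)) monic_one
      g.charpoly_monic (one_mul _).symm
      (fun x : {x : Module.End K V | Commute x g} => (x : Module.End K V)) fun x => x.2
    have h6 : ((({0}ᶜ : Set K).ncard : ℕ) : ℝ) = Nat.card K - 1 := by
      have := Set.ncard_add_ncard_compl ({0} : Set K)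
      rw [Set.ncard_singleton] at this
      rw [← this]; push_cast; ring
    have h7 : H.ncard * ({0}ᶜ : Set K).ncard ≤ Nat.card K ^ (k + 1) := by
      rw [hn, hk] at h4
      rw [natDegree_one, zero_pow two_ne_zero, pow_zero] at h5
      exact (h3.trans h4).trans ((Nat.mul_le_mul_right _ h5).trans (one_mul _).le)
    have h8 : (H.ncard : ℝ) * (Nat.card K - 1) ≤ (Nat.card K : ℝ) ^ (k + 1) := by
      rw [← h6]; exact_mod_cast h7
    have h9 : (H.ncard : ℝ) ≤ 2 * (Nat.card K : ℝ) ^ k := by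
      rw [pow_succ] at h8
      have hH0 : (0 : ℝ) ≤ H.ncard := Nat.cast_nonneg _
      by_contra hcon
      nlinarith
    calc (H.ncard : ℝ) ≤ 2 * 1 * (Nat.card K : ℝ) ^ k := by linarith
      _ ≤ _ := by
        gcongr
        exact hpow1 _
  · rw [not_le] at hlarge
    have h3 := ncard_commuting_le_mul hRS hR.1 hS.1 hsq hPRS hHg
    have h4 := ncard_range_domRestrict_le hRS hR.1 hS.1 hPRS
      (fun x : H => (x : Module.End K V)) fun x => hHg x x.2
    have hdeg : S.natDegree ≤ k + 1 := by
      rw [hPRS, hR.1.natDegree_mul hS.1] at hn; omega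
    calc (H.ncard : ℝ) ≤ (Nat.card K : ℝ) ^ R.natDegree ^ 2 * (Nat.card K : ℝ) ^ S.natDegree := by
          exact_mod_cast h3.trans (Nat.mul_le_mul_right _ h4)
      _ ≤ (Nat.card K : ℝ) ^ (3 * Δ + 3) ^ 2 * (Nat.card K : ℝ) ^ (k + 1) := by
          gcongr
          · omega
      _ = (Nat.card K : ℝ) ^ ((3 * Δ + 3) ^ 2 + 1) * (Nat.card K : ℝ) ^ k := by ring
      _ ≤ s₀ ^ ((3 * Δ + 3) ^ 2 + 1) * (Nat.card K : ℝ) ^ k := by gcongr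
      _ ≤ _ := by
          have := hpow1 ((3 * Δ + 3) ^ 2 + 1)
          gcongr
          linarith

end Bounds

theorem natCard_le_ncard {A C : Type*} [Finite A] {f : C → A} (hf : Function.Injective f)
    {H : Set A} (h : ∀ c, f c ∈ H) : Nat.card C ≤ H.ncard := by
  rw [← Nat.card_coe_set_eq]
  exact Nat.card_le_card_of_injective (fun c => (⟨f c, h c⟩ : H))
    fun c d hcd => hf (Subtype.mk.inj hcd)

/-! ### Special linear groups -/

section SpecialLinear

variable {K : Type*} [Field K] [Finite K]

instance finite_end_fun {n : Type*} [Finite n] : Finite (Module.End K (n → K)) :=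
  Finite.of_injective (fun f : Module.End K (n → K) => (f : (n → K) → (n → K)))
    DFunLike.coe_injective

theorem card_centralizer_specialLinearGroup_le {r : ℕ}
    (g : Matrix.SpecialLinearGroup (Fin (r + 1)) K) {M s₀ : ℝ} {Δ : ℕ} (hs₀ : 1 ≤ s₀)
    (h0 : (slCharpoly K (r + 1) g).coeff 0 ≠ 0)
    (h : ¬ IsExceptional (fun P : K[X] => P.Monic ∧ P.coeff 0 ≠ 0) ∅ (Nat.card K) M s₀ Δ
      (slCharpoly K (r + 1) g)) :
    (Nat.card (Subgroup.centralizer {g}) : ℝ) ≤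
      2 * s₀ ^ ((3 * Δ + 3) ^ 2 + 1) * (Nat.card K : ℝ) ^ r := by
  set A : Matrix (Fin (r + 1)) (Fin (r + 1)) K := g.1 with hA
  have hχ : (Matrix.toLin' A).charpoly = slCharpoly K (r + 1) g := Matrix.charpoly_toLin' _
  have h1 := ncard_commuting_det_one_le (g := Matrix.toLin' A) (by simp)
    (hχ ▸ h0) hs₀ (hχ ▸ h)
    (H := {x | Commute x (Matrix.toLin' A) ∧ LinearMap.det x = 1})
    (fun x hx => hx.1) (fun x hx => hx.2)
  rw [Module.finrank_fin_fun, Nat.add_sub_cancel] at h1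
  refine le_trans (Nat.cast_le.2 (natCard_le_ncard
    (f := fun x : Subgroup.centralizer {g} => Matrix.toLin'
      x.1.1) ?_ ?_)) h1
  · intro x y hxy
    exact Subtype.ext (Subtype.ext (Matrix.toLin'.injective hxy))
  · intro x
    refine ⟨?_, by rw [LinearMap.det_toLin']; exact x.1.2⟩
    have hgx : x.1 * g = g * x.1 := Subgroup.mem_centralizer_singleton_iff.1 x.2
    have hx : x.1.1 * A = A * x.1.1 := congrArg Subtype.val hgx
    exact (Matrix.toLin'_mul _ _).symm.trans ((congrArg Matrix.toLin' hx).trans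
      (Matrix.toLin'_mul _ _))

end SpecialLinear

/-! ### Special unitary groups -/

section SpecialUnitary

variable {K : Type*} [Field K] [StarRing K] {n : Type*} [Fintype n] [DecidableEq n]

variable (K n) in
/-- The standard hermitian form `∑ vᵢ w̄ᵢ`. -/
def hermitianForm : (n → K) →ₗ[K] (n → K) →ₛₗ[starRingEnd K] K :=
  LinearMap.mk₂'ₛₗ (RingHom.id K) (starRingEnd K) (fun v w => v ⬝ᵥ star w)
    (fun _ _ _ => add_dotProduct _ _ _) (fun _ _ _ => smul_dotProduct _ _ _)
    (fun _ _ _ => by rw [star_add, dotProduct_add])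
    (fun _ _ _ => by rw [star_smul, dotProduct_smul]; rfl)

omit [DecidableEq n] in
theorem hermitianForm_apply (v w : n → K) : hermitianForm K n v w = v ⬝ᵥ star w := rfl

theorem hermitianForm_toLin' {A : Matrix n n K} (hA : A ∈ Matrix.unitaryGroup n K) (v w : n → K) :
    hermitianForm K n (Matrix.toLin' A v) (Matrix.toLin' A w) = hermitianForm K n v w := by
  have h : A.conjTranspose * A = 1 := Matrix.mem_unitaryGroup_iff'.1 hA
  rw [hermitianForm_apply, hermitianForm_apply, Matrix.toLin'_apply, Matrix.toLin'_apply,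
    Matrix.star_mulVec, dotProduct_comm, ← Matrix.dotProduct_mulVec, Matrix.mulVec_mulVec, h,
    Matrix.one_mulVec, dotProduct_comm]

theorem eq_zero_of_hermitianForm_eq_zero {v : n → K} (h : ∀ w, hermitianForm K n v w = 0) :
    v = 0 := by
  funext i
  have := h (Pi.single i 1)
  rw [hermitianForm_apply, ← Pi.single_star, star_one, dotProduct_single_one] at this
  exact this

/-- If `b` commutes with its adjoint, then `b* b⁻¹` is unitary. -/
theorem mul_inv_mem_unitaryGroup {b : Matrix n n K} (hb : IsUnit b.det)
    (hc : Commute b (star b)) : star b * b⁻¹ ∈ Matrix.unitaryGroup n K := by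
  have h1 : b⁻¹ * b = 1 := Matrix.nonsing_inv_mul b hb
  have h2 : b * b⁻¹ = 1 := Matrix.mul_nonsing_inv b hb
  have h3 : star b⁻¹ * star b = 1 := by rw [← star_mul, h2, star_one]
  rw [Matrix.mem_unitaryGroup_iff', star_mul, star_star]
  calc star b⁻¹ * b * (star b * b⁻¹) = star b⁻¹ * (b * star b) * b⁻¹ := by noncomm_ring
    _ = (star b⁻¹ * star b) * (b * b⁻¹) := by rw [hc.eq]; noncomm_ring
    _ = 1 := by rw [h2, h3, one_mul]

theorem Commute.star_left_of_mem_unitaryGroup {A b : Matrix n n K}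
    (hA : A ∈ Matrix.unitaryGroup n K) (h : Commute A b) : Commute (star A) b := by
  have h1 : star A * A = 1 := Matrix.mem_unitaryGroup_iff'.1 hA
  have h2 : A * star A = 1 := Matrix.mem_unitaryGroup_iff.1 hA
  calc star A * b = star A * (b * A) * star A := by rw [mul_assoc, mul_assoc, h2, mul_one]
    _ = b * star A := by rw [← h.eq, ← mul_assoc, h1, one_mul]

variable [Finite K]

/-- The determinants of the unitary matrices commuting with a unitary matrix with squarefree
characteristic polynomial include all `(q - 1)`-st powers: the matrix `b* b⁻¹`, for `b` in the
commutant of determinant `t`, has determinant `t ^ (q - 1)`. -/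
theorem exists_unitary_commuting_det_eq [Nonempty n] {q : ℕ} (hq : 1 ≤ q)
    (hstar : ∀ x : K, star x = x ^ q) {A : Matrix n n K}
    (hA : A ∈ Matrix.unitaryGroup n K) (hsq : Squarefree A.charpoly) {t : K} (ht : t ≠ 0) :
    ∃ u ∈ Matrix.unitaryGroup n K, Commute u A ∧ u.det = t ^ (q - 1) := by
  set g := Matrix.toLin' A with hg
  have hχ : g.charpoly = A.charpoly := Matrix.charpoly_toLin' A
  obtain ⟨p, hp⟩ := exists_det_aeval_eq g (hχ ▸ hsq) (by simp [Fintype.card_pos]) t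
  set b : Matrix n n K := LinearMap.toMatrix' (aeval g p) with hb
  have hbg : Matrix.toLin' b = aeval g p := Matrix.toLin'_toMatrix' _
  have htransfer : ∀ x y : Matrix n n K, Commute (Matrix.toLin' x : Module.End K (n → K))
      (Matrix.toLin' y) → Commute x y := by
    intro x y h
    apply Matrix.toLin'.injective
    rw [Matrix.toLin'_mul, Matrix.toLin'_mul]
    exact h
  have hAb : Commute A b := htransfer A b (by rw [hbg]; exact commute_aeval (Commute.refl g) p)
  have hAb' : Commute (star A) b := hAb.star_left_of_mem_unitaryGroup hA
  have hbA : Commute (star b) A := by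
    have := hAb'.star_star
    rw [star_star] at this
    exact this.symm
  have hbb : Commute b (star b) := by
    refine (htransfer (star b) b ?_).symm
    rw [hbg]
    refine commute_aeval ?_ p
    have := congrArg Matrix.toLin' hbA.eq
    rw [Matrix.toLin'_mul, Matrix.toLin'_mul] at this
    exact this
  have hdet : b.det = t := by rw [← LinearMap.det_toLin', hbg, hp]
  have hunit : IsUnit b.det := by rw [hdet]; exact IsUnit.mk0 _ ht
  refine ⟨star b * b⁻¹, mul_inv_mem_unitaryGroup hunit hbb, ?_, ?_⟩
  · refine hbA.mul_left ?_
    have h1 : b⁻¹ * b = 1 := Matrix.nonsing_inv_mul b hunit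
    have h2 : b * b⁻¹ = 1 := Matrix.mul_nonsing_inv b hunit
    calc b⁻¹ * A = b⁻¹ * (A * b) * b⁻¹ := by rw [mul_assoc, mul_assoc, h2, mul_one]
      _ = A * b⁻¹ := by rw [hAb.eq, ← mul_assoc, h1, one_mul]
  · obtain ⟨k, rfl⟩ := Nat.exists_eq_add_of_le' hq
    rw [Matrix.det_mul, Matrix.star_eq_conjTranspose, Matrix.det_conjTranspose, hdet, hstar,
      Matrix.det_nonsing_inv, Ring.inverse_eq_inv', hdet, pow_succ, mul_assoc,
      mul_inv_cancel₀ ht, mul_one, Nat.add_sub_cancel]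

omit [StarRing K] in
theorem le_ncard_range_pow {q : ℕ} (hq : Nat.card K = q ^ 2) :
    q ≤ (Set.range fun t : Kˣ => (t : K) ^ (q - 1)).ncard := by
  have hq2 := two_le_of_natCard_eq_sq hq
  obtain ⟨k, rfl⟩ := Nat.exists_eq_add_of_le' (show 1 ≤ q by omega)
  have h1 := IsCyclic.card_powMonoidHom_range (G := Kˣ) k
  have h2 : Nat.card Kˣ = k * (k + 2) := by
    rw [Nat.card_units, hq]
    have : (k + 1) ^ 2 = k * (k + 2) + 1 := by ring
    omega
  rw [h2, Nat.gcd_eq_right (Dvd.intro _ rfl), Nat.mul_div_cancel_left _ (by omega)] at h1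
  have h3 : (Set.range fun t : Kˣ => (t : K) ^ (k + 1 - 1)) =
      Units.val '' ((powMonoidHom k : Kˣ →* Kˣ).range : Set Kˣ) := by
    ext x
    simp
  rw [h3, Set.ncard_image_of_injective _ Units.val_injective, ← Nat.card_coe_set_eq]
  exact (Nat.le_succ _).trans h1.ge

theorem card_centralizer_specialUnitaryGroup_le {q r : ℕ} (hq : Nat.card K = q ^ 2)
    (hstar : ∀ x : K, star x = x ^ q) (g : Matrix.specialUnitaryGroup (Fin (r + 1)) K)
    {M s₀ : ℝ} {Δ : ℕ} (hs₀ : 1 ≤ s₀) (hM : 1 ≤ M)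
    (hP : IsSelfDual (starRingEnd K) (suCharpoly K (r + 1) g))
    (h : ¬ IsExceptional (IsSelfDual (starRingEnd K)) ∅ √(Nat.card K) M s₀ Δ
      (suCharpoly K (r + 1) g)) :
    (Nat.card (Subgroup.centralizer {g}) : ℝ) ≤
      2 * s₀ ^ (2 * (3 * Δ + 3) ^ 2 + 1) * M * (q : ℝ) ^ r := by
  set A : Matrix (Fin (r + 1)) (Fin (r + 1)) K := g.1 with hA
  have hAu : A ∈ Matrix.unitaryGroup (Fin (r + 1)) K :=
    Matrix.specialUnitaryGroup_le_unitaryGroup g.2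
  have hχ : (Matrix.toLin' A).charpoly = suCharpoly K (r + 1) g := Matrix.charpoly_toLin' A
  have hq2 := two_le_of_natCard_eq_sq hq
  obtain ⟨t, ht⟩ := exists_pow_ne_self hq
  have : Finite (Matrix (Fin (r + 1)) (Fin (r + 1)) K) :=
    inferInstanceAs (Finite (Fin (r + 1) → Fin (r + 1) → K))
  set G : Set (Matrix (Fin (r + 1)) (Fin (r + 1)) K) :=
    {x | x ∈ Matrix.unitaryGroup (Fin (r + 1)) K ∧ Commute x A} with hG
  set H : Set (Matrix (Fin (r + 1)) (Fin (r + 1)) K) :=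
    {x | x ∈ Matrix.specialUnitaryGroup (Fin (r + 1)) K ∧ Commute x A} with hH
  have hcard : Nat.card (Subgroup.centralizer {g}) ≤ H.ncard :=
    natCard_le_ncard (f := fun x : Subgroup.centralizer {g} =>
      x.1.1)
      (fun x y hxy => Subtype.ext (Subtype.ext hxy))
      fun x => ⟨x.1.2, congrArg Subtype.val (Subgroup.mem_centralizer_singleton_iff.1 x.2)⟩
  have hHG : H ⊆ G := fun x hx => ⟨Matrix.specialUnitaryGroup_le_unitaryGroup hx.1, hx.2⟩
  have hE : ∀ R : K[X], IsSelfDual (starRingEnd K) R → R ∣ 1 → R ≠ 1 →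
      ∃ D ∈ (∅ : Finset K[X]), D ∣ R := fun R hR hR1 hne =>
    absurd (hR.monic.isUnit_iff.1 (isUnit_of_dvd_one hR1)) hne
  have hGle : (G.ncard : ℝ) ≤ 2 * s₀ ^ (2 * (3 * Δ + 3) ^ 2) * M * (q : ℝ) ^ (r + 1) := by
    have h1 := ncard_commuting_isometries_le (star_star (R := K)) (hermitianForm_toLin' hAu)
      (hχ.trans (one_mul _).symm) isSelfDual_one (by simp) dvd_rfl isSelfDual_one (by simp) hE
      (Or.inl ⟨t, by rwa [starRingEnd_apply, hstar]⟩)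
      (fun v hv => by rw [eq_zero_of_hermitianForm_eq_zero hv, map_zero]) hP hs₀ h
      (H := Matrix.toLin' '' G) ?_ ?_ fun _ => ncard_image_domRestrict_ker_aeval_one_le _ _
    · rw [Set.ncard_image_of_injective _ Matrix.toLin'.injective, sqrt_natCard_eq hq, suCharpoly,
        Matrix.charpoly_natDegree_eq_dim, Fintype.card_fin] at h1
      exact h1
    · rintro _ ⟨x, hx, rfl⟩
      have := congrArg Matrix.toLin' hx.2.eq
      rw [Matrix.toLin'_mul, Matrix.toLin'_mul] at this
      exact this
    · rintro _ ⟨x, hx, rfl⟩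
      exact hermitianForm_toLin' hx.1
  have hM0 : 0 ≤ M := by linarith
  have hcard' : (Nat.card (Subgroup.centralizer {g}) : ℝ) ≤ H.ncard := Nat.cast_le.2 hcard
  refine hcard'.trans ?_
  have hHG' : (H.ncard : ℝ) ≤ G.ncard := Nat.cast_le.2 (Set.ncard_le_ncard hHG (Set.toFinite _))
  -- over a large field a factor `q` is gained from the determinants of unitary elements of `K[g]`;
  -- over a small field the missing factor `q` is bounded by `s₀`
  by_cases hlarge : s₀ ≤ √(Nat.card K : ℝ)
  · obtain ⟨R, S, hR, hS, hPRS, hsq, -, -, -, hR1, -⟩ :=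
      exists_factorization_of_not_isExceptional (isDivisorFamily_isSelfDual (star_star (R := K)))
        isSelfDual_one (by simp) hE (Real.sqrt_nonneg _) hP h
    rw [hR1 hlarge, one_mul] at hPRS
    have h1 : H.ncard * (Set.range fun t : Kˣ => (t : K) ^ (q - 1)).ncard ≤ G.ncard := by
      refine ncard_mul_ncard_le Matrix.detMonoidHom (Set.toFinite _) _
        (fun x hx => MonoidHom.mem_mker.1 hx.1.2) ?_
      rintro _ ⟨t, rfl⟩
      obtain ⟨u, hu, huA, hdet⟩ := exists_unitary_commuting_det_eq (by omega) hstar hAu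
        (show Squarefree A.charpoly by change Squarefree (suCharpoly K (r + 1) g); rwa [hPRS])
        t.ne_zero
      refine ⟨u, ?_, hdet, fun x hx => ⟨mul_mem (hHG hx).1 hu, hx.2.mul_left huA⟩⟩
      rw [Matrix.isUnit_iff_isUnit_det, hdet]
      exact IsUnit.mk0 _ (pow_ne_zero _ t.ne_zero)
    have h2 : (H.ncard : ℝ) * q ≤ G.ncard := by
      exact_mod_cast (Nat.mul_le_mul_left _ (le_ncard_range_pow hq)).trans h1
    have hq0 : (0 : ℝ) < q := by exact_mod_cast (by omega : 0 < q)
    have h3 : (H.ncard : ℝ) ≤ 2 * s₀ ^ (2 * (3 * Δ + 3) ^ 2) * M * (q : ℝ) ^ r := by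
      refine le_of_mul_le_mul_right (h2.trans (hGle.trans_eq ?_)) hq0
      ring
    refine h3.trans ?_
    gcongr
    omega
  · refine hHG'.trans (hGle.trans ?_)
    rw [not_le, sqrt_natCard_eq hq] at hlarge
    calc 2 * s₀ ^ (2 * (3 * Δ + 3) ^ 2) * M * (q : ℝ) ^ (r + 1)
        = 2 * s₀ ^ (2 * (3 * Δ + 3) ^ 2) * M * q ^ r * q := by ring
      _ ≤ 2 * s₀ ^ (2 * (3 * Δ + 3) ^ 2) * M * q ^ r * s₀ := by gcongr
      _ = _ := by ring

end SpecialUnitary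

/-! ### Symplectic and spin groups -/

section Orthogonal

variable {K : Type*} [Field K]

variable (K) in
/-- The polynomial `X ^ 2 - 1`, as a product. Its linear factors may be repeated in the polynomials
belonging to symplectic and orthogonal groups. -/
def sqSubOne : K[X] := (X - C 1) * (X - C (-1))

theorem sqSubOne_eq : sqSubOne K = X ^ 2 - 1 := by
  rw [sqSubOne, C_neg, C_1]
  ring

theorem isSelfDual_sqSubOne : IsSelfDual (RingHom.id K) (sqSubOne K) :=
  (isSelfDual_X_sub_C (one_mul 1)).mul (isSelfDual_X_sub_C (by ring))

theorem natDegree_sqSubOne_le : (sqSubOne K).natDegree ≤ 2 :=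
  natDegree_mul_le.trans (by rw [natDegree_X_sub_C, natDegree_X_sub_C])

open Classical in
theorem exists_mem_dvd_of_dvd_sqSubOne (R : K[X]) (hR : IsSelfDual (RingHom.id K) R)
    (h : R ∣ sqSubOne K) (h1 : R ≠ 1) :
    ∃ D ∈ ({X - C 1, X - C (-1)} : Finset K[X]), D ∣ R := by
  rcases X_sub_C_dvd_of_dvd_mul hR.monic h h1 with h | h
  · exact ⟨_, by simp, h⟩
  · exact ⟨_, by simp, h⟩

variable [Finite K]

omit [Field K] [Finite K] in
theorem sqrt_natCard_pow (r : ℕ) : √(Nat.card K : ℝ) ^ (2 * r) = (Nat.card K : ℝ) ^ r := by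
  rw [pow_mul, Real.sq_sqrt (Nat.cast_nonneg _)]

open Classical in
theorem card_centralizer_symplecticGroup_le {r : ℕ} (g : Matrix.symplecticGroup (Fin r) K)
    {M s₀ : ℝ} {Δ : ℕ} (hs₀ : 1 ≤ s₀) (hP : IsSelfDual (RingHom.id K) (spCharpoly K r g))
    (h : ¬ IsExceptional (IsSelfDual (RingHom.id K)) {X - C 1, X - C (-1)} √(Nat.card K) M s₀ Δ
      (spCharpoly K r g)) :
    (Nat.card (Subgroup.centralizer {g}) : ℝ) ≤
      2 * s₀ ^ (2 * (3 * Δ + 3) ^ 2) * M * (Nat.card K : ℝ) ^ r := by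
  set A : Matrix (Fin r ⊕ Fin r) (Fin r ⊕ Fin r) K := g.1 with hA
  have hχ : (Matrix.toLin' A).charpoly = spCharpoly K r g := Matrix.charpoly_toLin' A
  set B : (Fin r ⊕ Fin r → K) →ₗ[K] (Fin r ⊕ Fin r → K) →ₗ[K] K :=
    Matrix.toLinearMap₂' K (Matrix.J (Fin r) K) with hB
  have hinv : ∀ x ∈ Matrix.symplecticGroup (Fin r) K, ∀ v w,
      B (Matrix.toLin' x v) (Matrix.toLin' x w) = B v w := by
    intro x hx v w
    rw [hB, Matrix.toLinearMap₂'_apply', Matrix.toLinearMap₂'_apply', Matrix.toLin'_apply,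
      Matrix.toLin'_apply, ← Matrix.vecMul_transpose, ← Matrix.dotProduct_mulVec,
      Matrix.mulVec_mulVec, Matrix.mulVec_mulVec,
      SymplecticGroup.mem_iff'.1 hx]
  have hnon : ∀ v, (∀ w, B v w = 0) → v = 0 := by
    intro v hv
    funext i
    have := hv ((Matrix.J (Fin r) K).mulVec (Pi.single i 1))
    rw [hB, Matrix.toLinearMap₂'_apply', Matrix.mulVec_mulVec, Matrix.J_squared,
      Matrix.neg_mulVec, Matrix.one_mulVec, dotProduct_neg, dotProduct_single_one,
      neg_eq_zero] at this
    exact this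
  set H : Set (Module.End K (Fin r ⊕ Fin r → K)) :=
    {x | Commute x (Matrix.toLin' A) ∧ ∀ v w, B (x v) (x w) = B v w} with hH
  have h1 := ncard_commuting_isometries_le (fun _ => rfl) (hinv A g.2) (hχ.trans (one_mul _).symm)
    isSelfDual_one (by simp) (one_dvd _) isSelfDual_sqSubOne natDegree_sqSubOne_le
    exists_mem_dvd_of_dvd_sqSubOne (Or.inr sqSubOne_eq.symm.dvd)
    (fun v hv => by rw [hnon v hv, map_zero]) hP hs₀ h (H := H) (fun x hx => hx.1)
    (fun x hx => hx.2) fun _ => ncard_image_domRestrict_ker_aeval_one_le _ _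
  rw [spCharpoly, Matrix.charpoly_natDegree_eq_dim, Fintype.card_sum, Fintype.card_fin, ← two_mul,
    sqrt_natCard_pow] at h1
  refine le_trans (Nat.cast_le.2 (natCard_le_ncard
    (f := fun x : Subgroup.centralizer {g} => Matrix.toLin' x.1.1) ?_ ?_)) h1
  · intro x y hxy
    exact Subtype.ext (Subtype.ext (Matrix.toLin'.injective hxy))
  · intro x
    refine ⟨?_, hinv x.1.1 x.1.2⟩
    have hgx : x.1 * g = g * x.1 := Subgroup.mem_centralizer_singleton_iff.1 x.2
    have hx : x.1.1 * A = A * x.1.1 := congrArg Subtype.val hgx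
    exact (Matrix.toLin'_mul _ _).symm.trans ((congrArg Matrix.toLin' hx).trans
      (Matrix.toLin'_mul _ _))

end Orthogonal

section Spin

variable {K V : Type*} [Field K] [AddCommGroup V] [Module K V] {Q : QuadraticForm K V}

theorem polar_map_of_forall_eq {x : Module.End K V} (hx : ∀ v, Q (x v) = Q v) (v w : V) :
    QuadraticMap.polar Q (x v) (x w) = QuadraticMap.polar Q v w := by
  rw [QuadraticMap.polar, QuadraticMap.polar, ← map_add, hx, hx, hx]

/-- The vectors in the radical of the polar form are fixed by the spin group. -/
theorem QuadNonsingular.spinVectorRep_apply_of_polar_eq_zero (hQ : QuadNonsingular Q)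
    (g : spinGroup Q) {v : V} (hv : ∀ w, QuadraticMap.polar Q v w = 0) :
    spinVectorRep Q g v = v := by
  have hgv : ∀ w, QuadraticMap.polar Q (spinVectorRep Q g v) w = 0 := by
    intro w
    have h1 : spinVectorRep Q g (spinVectorRep Q g⁻¹ w) = w := by
      rw [← Module.End.mul_apply, ← map_mul, mul_inv_cancel, map_one, Module.End.one_apply]
    rw [← h1, polar_map_of_forall_eq (quadratic_spinVectorRep g), hv]
  rw [← sub_eq_zero]
  refine hQ _ ?_ fun w => by rw [QuadraticMap.polar_sub_left, hgv, hv, sub_zero]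
  have h1 : Q (spinVectorRep Q g v - v) = Q (spinVectorRep Q g v) + Q (-v) +
      QuadraticMap.polar Q (spinVectorRep Q g v) (-v) := by
    rw [QuadraticMap.polar, sub_eq_add_neg]; ring
  have h2 := hv v
  rw [QuadraticMap.polar_self] at h2
  rw [h1, quadratic_spinVectorRep, QuadraticMap.map_neg, hgv, add_zero, ← two_mul]
  simpa using h2

/-- If `1` is a simple root of the characteristic polynomial of an isometry `g`, then the isometries
commuting with `g` act as `1` or `-1` on the kernel of `g - 1`, because this kernel is an
anisotropic line. -/
theorem QuadNonsingular.ncard_image_domRestrict_le [FiniteDimensional K V]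
    (hQ : QuadNonsingular Q) {g : Module.End K V} (hg : ∀ v, Q (g v) = Q v) {P : K[X]}
    (hP : P.Monic) (hχ : g.charpoly = (X - C 1) * P) (hcop : IsCoprime (X - C 1) P)
    {H : Set (Module.End K V)} (hHg : ∀ x ∈ H, Commute x g) (hHQ : ∀ x ∈ H, ∀ v, Q (x v) = Q v) :
    ((fun x : Module.End K V => x.domRestrict (LinearMap.ker (aeval g (X - C (1 : K))))) '' H).ncard
      ≤ 2 := by
  set U := LinearMap.ker (aeval g (X - C (1 : K))) with hU
  have hrank : Module.finrank K U = 1 := by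
    rw [finrank_ker_aeval hcop (monic_X_sub_C 1) hP hχ, natDegree_X_sub_C]
  have hself : IsSelfDual (RingHom.id K) (X - C (1 : K)) := isSelfDual_X_sub_C (one_mul 1)
  obtain ⟨u, hu0, hu⟩ := finrank_eq_one_iff'.1 hrank
  have hgB : ∀ v w, QuadraticMap.polarBilin Q (g v) (g w) = QuadraticMap.polarBilin Q v w :=
    polar_map_of_forall_eq hg
  have hc : IsCompl U (LinearMap.ker (aeval g P)) :=
    isCompl_ker_aeval g hcop (hχ ▸ g.aeval_self_charpoly)
  -- `u` is orthogonal to itself if it is isotropic, and to the kernel of `P(g)`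
  have hQu : Q (u : V) ≠ 0 := by
    intro h0
    refine hu0 (Subtype.ext (hQ u h0 fun w => ?_))
    obtain ⟨a, ha, b, hb, rfl⟩ := Submodule.mem_sup.1 (hc.sup_eq_top ▸ Submodule.mem_top (x := w))
    obtain ⟨c, hc⟩ := hu ⟨a, ha⟩
    have hca : c • (u : V) = a := congrArg Subtype.val hc
    have hb0 : QuadraticMap.polar Q (b : V) u = 0 :=
      apply_eq_zero_of_mem_ker_aeval (B := QuadraticMap.polarBilin Q) hgB hself hcop hb u.2
    rw [QuadraticMap.polar_add_right, ← hca, QuadraticMap.polar_smul_right,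
      QuadraticMap.polar_self, h0, QuadraticMap.polar_comm, hb0]
    simp
  have hsub : ((fun x : Module.End K V => x.domRestrict U) '' H) ⊆ {U.subtype, -U.subtype} := by
    rintro _ ⟨x, hx, rfl⟩
    obtain ⟨c, hc⟩ := hu ⟨x u, map_mem_ker_aeval (hHg x hx) _ u u.2⟩
    have hcu : c • (u : V) = x u := congrArg Subtype.val hc
    have hcc : c * c = 1 := by
      have := hHQ x hx u
      rw [← hcu, QuadraticMap.map_smul, smul_eq_mul] at this
      exact mul_right_cancel₀ hQu (this.trans (one_mul _).symm)
    have hx' : x.domRestrict U = c • U.subtype := by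
      ext v
      obtain ⟨d, rfl⟩ := hu v
      simp [← hcu]
    rcases mul_self_eq_one_iff.1 hcc with rfl | rfl
    · left
      exact hx'.trans (one_smul _ _)
    · right
      exact hx'.trans (neg_one_smul _ _)
  refine (Set.ncard_le_ncard hsub (Set.toFinite _)).trans ?_
  exact (Set.ncard_insert_le _ _).trans (by rw [Set.ncard_singleton])

open Classical in
theorem QuadNonsingular.card_centralizer_spinGroup_le [Finite K] [FiniteDimensional K V]
    (hQ : QuadNonsingular Q) (g : spinGroup Q) {L P : K[X]} {r : ℕ}
    (hχ : spinCharpoly Q g = L * P) (hL : L = 1 ∨ L = X - C 1) (hr : P.natDegree = 2 * r)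
    {M s₀ : ℝ} {Δ : ℕ} (hs₀ : 1 ≤ s₀) (hP : IsSelfDual (RingHom.id K) P)
    (h : ¬ IsExceptional (IsSelfDual (RingHom.id K)) {X - C 1, X - C (-1)} √(Nat.card K) M s₀ Δ
      P) :
    (Nat.card (Subgroup.centralizer {g}) : ℝ) ≤
      4 * s₀ ^ (2 * (3 * Δ + 3) ^ 2) * M * (Nat.card K : ℝ) ^ r := by
  have hLself : IsSelfDual (RingHom.id K) L := by
    rcases hL with rfl | rfl
    · exact isSelfDual_one
    · exact isSelfDual_X_sub_C (one_mul 1)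
  have hLdeg : L.natDegree ≤ 1 := by
    rcases hL with rfl | rfl
    · simp
    · rw [natDegree_X_sub_C]
  have hLdvd : L ∣ sqSubOne K := by
    rcases hL with rfl | rfl
    · exact one_dvd _
    · exact dvd_mul_right _ _
  have h1 := ncard_commuting_isometries_le (B := QuadraticMap.polarBilin Q) (fun _ => rfl)
    (polar_map_of_forall_eq (quadratic_spinVectorRep g)) hχ hLself hLdeg hLdvd isSelfDual_sqSubOne
    natDegree_sqSubOne_le exists_mem_dvd_of_dvd_sqSubOne (Or.inr sqSubOne_eq.symm.dvd)
    (fun v hv => ?_) hP hs₀ h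
    (H := {x | Commute x (spinVectorRep Q g) ∧ ∀ v, Q (x v) = Q v}) (fun x hx => hx.1)
    (fun x hx => polar_map_of_forall_eq hx.2) fun hcop => ?_
  · have h2 := Nat.cast_le (α := ℝ).2 (hQ.card_centralizer_le g)
    rw [Nat.cast_mul, Nat.cast_two] at h2
    rw [hr, sqrt_natCard_pow] at h1
    linarith
  · rw [sqSubOne, mul_comm, map_mul, Module.End.mul_apply]
    have : aeval (spinVectorRep Q g) (X - C (1 : K)) v = 0 := by
      simp [hQ.spinVectorRep_apply_of_polar_eq_zero g hv]
    rw [this, map_zero]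
  · rcases hL with rfl | rfl
    · exact ncard_image_domRestrict_ker_aeval_one_le _ _
    · exact hQ.ncard_image_domRestrict_le (quadratic_spinVectorRep g) hP.monic hχ hcop
        (fun x hx => hx.1) fun x hx => hx.2

end Spin

end

/-- In each case the finite simple group is `G = Γ ⧸ Z(Γ)`, where `Γ = G̃` is the group of
rational points of the simply connected group: `SL_{r+1}(q)`, `SU_{r+1}(q)`, `Spin_{2r+1}(q)`,
`Sp_{2r}(q)`, `Spin_{2r}^±(q)`. The two isometry classes of nonsingular quadratic forms in
dimension `2 * r` give the types `D_r` and `²D_r`. -/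
theorem mainTheorem4 (ε : ℝ) (hε : 0 < ε) :
    ∃ C : ℝ,
      -- type `A_r`
      (∀ (K : Type) [Field K] [Finite K] (r : ℕ), 1 ≤ r →
        IsSimpleGroup (Matrix.SpecialLinearGroup (Fin (r + 1)) K ⧸
          Subgroup.center (Matrix.SpecialLinearGroup (Fin (r + 1)) K)) →
        FewLargeCentralizers (slCharpoly K (r + 1)) (linearPolys K (r + 1))
          (C * (Nat.card K : ℝ) ^ r) ε) ∧
      -- type `²A_r`
      (∀ (K : Type) [Field K] [Finite K] [StarRing K] (q r : ℕ), 1 ≤ r →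
        Nat.card K = q ^ 2 → (∀ x : K, star x = x ^ q) →
        IsSimpleGroup (Matrix.specialUnitaryGroup (Fin (r + 1)) K ⧸
          Subgroup.center (Matrix.specialUnitaryGroup (Fin (r + 1)) K)) →
        FewLargeCentralizers (suCharpoly K (r + 1)) (unitaryPolys K (r + 1))
          (C * (q : ℝ) ^ r) ε) ∧
      -- type `B_r`
      (∀ (K : Type) [Field K] [Finite K] (r : ℕ)
        (Q : QuadraticForm K (Fin (2 * r + 1) → K)), 1 ≤ r → QuadNonsingular Q →
        IsSimpleGroup (spinGroup Q ⧸ Subgroup.center (spinGroup Q)) →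
        FewLargeCentralizers (spinOddCharpoly Q) (orthogonalPolys K (2 * r))
          (C * (Nat.card K : ℝ) ^ r) ε) ∧
      -- type `C_r`
      (∀ (K : Type) [Field K] [Finite K] (r : ℕ), 1 ≤ r →
        IsSimpleGroup (Matrix.symplecticGroup (Fin r) K ⧸
          Subgroup.center (Matrix.symplecticGroup (Fin r) K)) →
        FewLargeCentralizers (spCharpoly K r) (orthogonalPolys K (2 * r))
          (C * (Nat.card K : ℝ) ^ r) ε) ∧
      -- types `D_r` and `²D_r`
      (∀ (K : Type) [Field K] [Finite K] (r : ℕ)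
        (Q : QuadraticForm K (Fin (2 * r) → K)), 1 ≤ r → QuadNonsingular Q →
        IsSimpleGroup (spinGroup Q ⧸ Subgroup.center (spinGroup Q)) →
        FewLargeCentralizers (spinCharpoly Q) (orthogonalPolys K (2 * r))
          (C * (Nat.card K : ℝ) ^ r) ε) := by
  classical
  obtain ⟨M, s₀, Δ, hM, hs₀, key⟩ := exists_card_exceptional_lt ε hε
  have hM0 : 0 ≤ M := zero_le_one.trans hM
  have hpow : ∀ {a b : ℕ}, a ≤ b → s₀ ^ a ≤ s₀ ^ b := fun h => pow_le_pow_right₀ hs₀ h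
  have hpow0 : ∀ a : ℕ, 0 ≤ s₀ ^ a := fun a => pow_nonneg (zero_le_one.trans hs₀) a
  have hne : ∀ {K : Type} [Field K] (n : ℕ), ((-1 : K)) ^ n ≠ 0 :=
    fun n => pow_ne_zero _ (neg_ne_zero.2 one_ne_zero)
  have hlin : ∀ {K : Type} [Field K], ∀ D ∈ ({X - C 1, X - C (-1)} : Finset K[X]),
      IsSelfDual (RingHom.id K) D ∧ D.natDegree = 1 := by
    intro K _ D hD
    rw [Finset.mem_insert, Finset.mem_singleton] at hD
    rcases hD with rfl | rfl
    · exact ⟨isSelfDual_X_sub_C (one_mul 1), natDegree_X_sub_C _⟩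
    · exact ⟨isSelfDual_X_sub_C (by ring), natDegree_X_sub_C _⟩
  refine ⟨4 * s₀ ^ (2 * (3 * Δ + 3) ^ 2 + 1) * M, ?_, ?_, ?_, ?_, ?_⟩
  · intro K _ _ r hr _
    refine fewLargeCentralizers_of_card_exceptional_lt (linearPolys_eq_slice _)
      (key K _ _ _ _ _ ∅ (sliceBounds_monic (by omega) (hne _)) (by simp) (by simp))
      fun g hg hex => ?_
    refine (card_centralizer_specialLinearGroup_le g hs₀ (mem_slice.1 hg).1.2 hex).trans ?_
    gcongr ?_ * _
    calc 2 * s₀ ^ ((3 * Δ + 3) ^ 2 + 1) ≤ 4 * s₀ ^ (2 * (3 * Δ + 3) ^ 2 + 1) * 1 := by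
          have h1 := hpow (show (3 * Δ + 3) ^ 2 + 1 ≤ 2 * (3 * Δ + 3) ^ 2 + 1 by omega)
          have h2 := hpow0 ((3 * Δ + 3) ^ 2 + 1)
          linarith
      _ ≤ _ := mul_le_mul_of_nonneg_left hM (mul_nonneg (by norm_num) (hpow0 _))
  · intro K _ _ _ q r hr hq hstar _
    refine fewLargeCentralizers_of_card_exceptional_lt (unitaryPolys_eq_slice _)
      (key K _ _ _ _ _ ∅ (sliceBounds_selfDual_star hq hstar (by omega)
        (by rw [← mul_pow]; simp) (by simp)) (by simp) (by simp))
      fun g hg hex => ?_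
    refine (card_centralizer_specialUnitaryGroup_le hq hstar g hs₀ hM (mem_slice.1 hg).1
      hex).trans ?_
    have := hpow0 (2 * (3 * Δ + 3) ^ 2 + 1)
    gcongr
    norm_num
  · intro K _ _ r Q hr hQ _
    refine fewLargeCentralizers_of_card_exceptional_lt (orthogonalPolys_eq_slice _)
      (key K _ _ _ _ _ {X - C 1, X - C (-1)} (sliceBounds_selfDual_id hr) hlin
        Finset.card_le_two)
      fun g hg hex => ?_
    obtain ⟨h1, h2, h3⟩ := mem_slice.1 hg
    refine (hQ.card_centralizer_spinGroup_le g (spinCharpoly_eq_of_spinOddCharpoly_eq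
      (by rw [Module.finrank_fin_fun]; exact odd_two_mul_add_one r) rfl
      (by rwa [← coeff_zero_eq_eval_zero])) (Or.inr rfl) h2 hs₀ h1 hex).trans ?_
    gcongr
    omega
  · intro K _ _ r hr _
    refine fewLargeCentralizers_of_card_exceptional_lt (orthogonalPolys_eq_slice _)
      (key K _ _ _ _ _ {X - C 1, X - C (-1)} (sliceBounds_selfDual_id hr) hlin
        Finset.card_le_two)
      fun g hg hex => ?_
    refine (card_centralizer_symplecticGroup_le g hs₀ (mem_slice.1 hg).1 hex).trans ?_
    have := hpow0 (2 * (3 * Δ + 3) ^ 2)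
    gcongr
    · norm_num
    · omega
  · intro K _ _ r Q hr hQ _
    refine fewLargeCentralizers_of_card_exceptional_lt (orthogonalPolys_eq_slice _)
      (key K _ _ _ _ _ {X - C 1, X - C (-1)} (sliceBounds_selfDual_id hr) hlin
        Finset.card_le_two)
      fun g hg hex => ?_
    obtain ⟨h1, h2, -⟩ := mem_slice.1 hg
    refine (hQ.card_centralizer_spinGroup_le g (one_mul _).symm (Or.inl rfl) h2 hs₀ h1 hex).trans
      ?_
    gcongr
    omega
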